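/- Let $TG$ be the triangular grid in $\mathbb{C}$: its vertices are the integer span of $1$ and $e^{\pi i/3}$, with straight edges joining vertices at distance $1$. Let $TG^*$ be the dual hexagonal grid, whose closed hexagonal faces are centered at the vertices of $TG$, and let $\mathfrak{B}_R$ be the union of all closed $TG^*$-hexagons that intersect the ball $B(0,R)=\{|z|<R\}$. For a finite graph $G=(V,E)$, a nonempty boundary set $V_\partial\subset V$ and $h_\partial:V_\partial\to\mathbb{R}$, the discrete Gaussian free field (DGFF) with boundary values $h_\partial$ is the random function $h:V\to\mathbb{R}$ that agrees with $h_\partial$ on $V_\partial$ and whose density with respect to Lebesgue measure on $\mathbb{R}^{V\setminus V_\partial}$ is proportional to $\exp\bigl(-\tfrac12\sum_{\{u,v\}\in E}(h(v)-h(u))^2\bigr)$. **Proposition (Near independence).** For every $\bar\Lambda>0$ and $C>1$ there is a constant $c=c(\bar\Lambda,C)>0$ such that the following holds. Let $D\subset\mathbb{R}^2$ be a bounded domain (nonempty, open, connected) whose boundary $\partial D$ is a subgraph of $TG$, let $V_\partial$ be the set of vertices of $TG$ in $\partial D$, and let $h_\partial:V_\partial\to\mathbb{R}$ satisfy $\|h_\partial\|_\infty\le\bar\Lambda$.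 Let $h$ be the DGFF on $D$ with boundary values $h_\partial$, that is, the DGFF on the subgraph of $TG$ induced on the vertices in $\overline D$, with boundary set $V_\partial$. Let $R>10^3\,C$ with $\mathfrak{B}_{5R}\subset D$, and let $R_1,R_2,R_3\in[R,5R]$ satisfy $R_1+C^{-1}R<R_2$, $R_2+C^{-1}R<R_3$ and $R_3+C^{-1}R<5R$. Let $V^3_+,V^3_-$ be disjoint sets of vertices in $D\setminus\mathfrak{B}_{R_3}$ and let $V^1_+,V^1_-$ be disjoint sets of vertices in $\mathfrak{B}_{R_1}$. Suppose that every vertex of $V^1_+$ neighbors a vertex of $V^1_-$ and every vertex of $V^1_-$ neighbors a vertex of $V^1_+$, and similarly for $V^3_+$ and $V^3_-$. Suppose also that simple random walk on $TG$ started at $0$ has probability at least $1/C$ to hit $V^3_-\cup V^3_+$ before exiting $\mathfrak{B}_{5R}$. Let $\mathcal{K}_1$ be the event that $h>0$ on $V^1_+$ and $h<0$ on $V^1_-$, and let $\mathcal{K}_3$ be the corresponding event for $V^3_+$ and $V^3_-$. Let $a(V^1_+,V^1_-)$ be the probability of $\mathcal{K}_1$ for the DGFF on $\mathfrak{B}_{R_2}$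 with zero boundary values outside $\mathfrak{B}_{R_2}$. Then $$c^{-1}\,a(V^1_+,V^1_-)\;\le\;\mathbf{P}\bigl[\mathcal{K}_1\mid\mathcal{K}_3\bigr]\;\le\;c\,a(V^1_+,V^1_-).$$ -/

import Mathlib

open MeasureTheory

noncomputable section

/-! ## Discrete Gaussian free field on a finite graph -/

section FiniteGraph

variable {V : Type*} [Fintype V]

open Classical in
/-- `‖∇h‖² = ∑_{{u,v} ∈ E} (h v - h u)²`, the sum being over undirected edges: the sum over ordered
pairs of adjacent vertices counts each edge twice. -/
def dirichletEnergy (G : SimpleGraph V) (h : V → ℝ) : ℝ :=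
  (1 / 2) * ∑ u : V, ∑ v : V, if G.Adj u v then (h v - h u) ^ 2 else 0

open Classical in
/-- The function on `V` that agrees with `b` on `B` and with `x` off `B`. -/
def glue (B : Set V) (b : V → ℝ) (x : (↥Bᶜ) → ℝ) : V → ℝ :=
  fun v => if hv : v ∈ B then b v else x ⟨v, hv⟩

open Classical in
/-- The measure on `ℝ^(V \ B)` with Lebesgue density `exp (-‖∇h‖² / 2)`, where `h` is the function
on `V` with boundary values `b` on `B` and the given values off `B`. -/
def dgffWeight (G : SimpleGraph V) (B : Set V) (b : V → ℝ) : Measure ((↥Bᶜ) → ℝ) :=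
  (volume : Measure ((↥Bᶜ) → ℝ)).withDensity fun x =>
    ENNReal.ofReal (Real.exp (-(1 / 2) * dirichletEnergy G (glue B b x)))

/-- The law of the discrete Gaussian free field on the finite graph `G` with boundary set `B` and
boundary values `b` (only the restriction of `b` to `B` matters), as a measure on functions
`V → ℝ`. -/
def dgff (G : SimpleGraph V) (B : Set V) (b : V → ℝ) : Measure (V → ℝ) :=
  ((dgffWeight G B b Set.univ)⁻¹ • dgffWeight G B b).map (glue B b)

end FiniteGraph

namespace TriGrid

/-! ## The triangular grid and its dual -/

/-- The vertex with index `(a, b)` is the point `a + b e^{πi/3}` of the plane. -/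
def pos (v : ℤ × ℤ) : ℂ :=
  (v.1 : ℂ) + (v.2 : ℂ) * ((1 + (Real.sqrt 3 : ℂ) * Complex.I) / 2)

/-- The triangular grid `TG`: two vertices are joined when they are at Euclidean distance one. -/
def TG : SimpleGraph (ℤ × ℤ) where
  Adj v w := dist (pos v) (pos w) = 1
  symm := ⟨fun v w h => by rw [dist_comm]; exact h⟩
  loopless := ⟨fun v h => by simp at h⟩

/-- The closed face of the dual hexagonal grid that is centered at the vertex `v`: the points of the
plane to which no vertex of `TG` is closer than `v`. -/
def hexagon (v : ℤ × ℤ) : Set ℂ := {z | ∀ w : ℤ × ℤ, dist z (pos v) ≤ dist z (pos w)}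

/-- The union of all the closed hexagons that intersect the ball `B(0, R)`. -/
def hexBall (R : ℝ) : Set ℂ :=
  ⋃ v : {v : ℤ × ℤ // (hexagon v ∩ Metric.ball (0 : ℂ) R).Nonempty}, hexagon v.1

/-- The subset of the plane that is drawn by a subgraph of `TG`, with straight edges. -/
def drawing (H : TG.Subgraph) : Set ℂ :=
  {z | (∃ v ∈ H.verts, z = pos v) ∨ ∃ v w, H.Adj v w ∧ z ∈ segment ℝ (pos v) (pos w)}

/-- A bounded domain (nonempty, open, connected set) in the plane whose boundary is a subgraph
of `TG`. -/
structure GridDomain where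
  carrier : Set ℂ
  nonempty : carrier.Nonempty
  isOpen : IsOpen carrier
  isPreconnected : IsPreconnected carrier
  isBounded : Bornology.IsBounded carrier
  frontier_eq : ∃ H : TG.Subgraph, frontier carrier = drawing H

/-! ## Finiteness of the vertex sets in use -/

lemma finite_pos_preimage {A : Set ℂ} (hA : Bornology.IsBounded A) : (pos ⁻¹' A).Finite := by
  obtain ⟨M, hM⟩ := hA.exists_norm_le
  obtain ⟨N, hN⟩ := exists_nat_gt (2 * M)
  refine (Set.finite_Icc ((-N : ℤ), (-N : ℤ)) ((N : ℤ), (N : ℤ))).subset ?_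
  rintro ⟨a, b⟩ hv
  have h := hM _ hv
  have hre := (Complex.abs_re_le_norm _).trans h
  have him := (Complex.abs_im_le_norm _).trans h
  simp only [pos, Complex.add_re, Complex.mul_re, Complex.add_im, Complex.mul_im,
    Complex.intCast_re, Complex.intCast_im, Complex.div_ofNat_re, Complex.div_ofNat_im,
    Complex.one_re, Complex.one_im, Complex.ofReal_re, Complex.ofReal_im, Complex.I_re,
    Complex.I_im] at hre him
  have h3 : (1.5 : ℝ) ≤ Real.sqrt 3 := Real.le_sqrt_of_sq_le (by norm_num)
  have hb : |(b : ℝ)| * (Real.sqrt 3 / 2) ≤ M := by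
    have : |(b : ℝ)| * (Real.sqrt 3 / 2) = |(b : ℝ) * (Real.sqrt 3 / 2)| := by
      rw [abs_mul, abs_of_nonneg (by positivity : (0 : ℝ) ≤ Real.sqrt 3 / 2)]
    rw [this]
    refine le_of_eq_of_le (congrArg abs ?_) him
    ring
  have hb' : |(b : ℝ)| * (3 / 4) ≤ M := by nlinarith [abs_nonneg (b : ℝ)]
  have ha : |(a : ℝ) + b / 2| ≤ M := by
    refine le_of_eq_of_le (congrArg abs ?_) hre
    ring
  rw [abs_le] at ha
  have hb1 := le_abs_self (b : ℝ)
  have hb2 := neg_abs_le (b : ℝ)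
  have e1 : (a : ℝ) ≤ N := by linarith
  have e2 : (-N : ℝ) ≤ a := by linarith
  have e3 : (b : ℝ) ≤ N := by linarith
  have e4 : (-N : ℝ) ≤ b := by linarith
  refine Set.mem_Icc.mpr ⟨Prod.mk_le_mk.mpr ⟨?_, ?_⟩, Prod.mk_le_mk.mpr ⟨?_, ?_⟩⟩
  · exact_mod_cast e2
  · exact_mod_cast e4
  · exact_mod_cast e1
  · exact_mod_cast e3

lemma norm_pos_lt_of_mem_hexBall {R : ℝ} {v : ℤ × ℤ} (hv : pos v ∈ hexBall R) :
    ‖pos v‖ < 2 * R := by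
  obtain ⟨⟨w, z, hz, hzR⟩, hw⟩ := Set.mem_iUnion.mp hv
  have h0 : pos 0 = 0 := by simp [pos]
  have e : dist (pos v) (pos w) ≤ 0 := by simpa using hw v
  have e' : pos v = pos w := dist_le_zero.mp e
  have h1 := hz 0
  rw [h0, ← e'] at h1
  have h2 : dist z 0 < R := hzR
  have h3 := dist_triangle (pos v) z 0
  rw [dist_comm (pos v) z, dist_zero_right] at h3
  linarith

/-! ## The DGFF on a domain, and on a hexagon ball with zero boundary values -/

/-- The vertices of `TG` in the closure of `D`. -/
def GridDomain.vertices (D : GridDomain) : Set (ℤ × ℤ) := pos ⁻¹' closure D.carrier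

instance (D : GridDomain) : Fintype D.vertices :=
  (finite_pos_preimage D.isBounded.closure).fintype

/-- The DGFF on `D` with boundary values `b`: the graph is induced by `TG` on the vertices in the
closure of `D`, and the boundary vertices are those in the boundary of `D`. -/
def GridDomain.field (D : GridDomain) (b : ℤ × ℤ → ℝ) : Measure (D.vertices → ℝ) :=
  dgff (TG.induce D.vertices) {v | pos v.1 ∈ frontier D.carrier} (fun v => b v.1)

/-- The vertices of `TG` in the hexagon ball, together with their neighbors. -/
def ballVertices (R : ℝ) : Set (ℤ × ℤ) :=
  {v | pos v ∈ hexBall R ∨ ∃ w, pos w ∈ hexBall R ∧ TG.Adj v w}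

instance (R : ℝ) : Fintype (ballVertices R) := by
  refine ((finite_pos_preimage (A := Metric.closedBall 0 (2 * R + 1))
    Metric.isBounded_closedBall).subset ?_).fintype
  rintro v (hv | ⟨w, hw, hvw⟩)
  · have := norm_pos_lt_of_mem_hexBall hv
    simp only [Set.mem_preimage, mem_closedBall_zero_iff]
    linarith
  · have h1 := norm_pos_lt_of_mem_hexBall hw
    have h2 : dist (pos v) (pos w) = 1 := hvw
    have h3 := dist_triangle (pos v) (pos w) 0
    rw [dist_zero_right, dist_zero_right] at h3
    simp only [Set.mem_preimage, mem_closedBall_zero_iff]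
    linarith

/-- The DGFF on the hexagon ball of radius `R` with zero boundary values outside it. -/
def ballField (R : ℝ) : Measure (ballVertices R → ℝ) :=
  dgff (TG.induce (ballVertices R)) {v | pos v.1 ∉ hexBall R} (fun _ => 0)

/-- The event that the field `h`, defined on the set `A` of vertices, is positive on `P` and
negative on `M`. -/
def signEvent (A P M : Set (ℤ × ℤ)) : Set (A → ℝ) :=
  {h | (∀ v : A, v.1 ∈ P → 0 < h v) ∧ ∀ v : A, v.1 ∈ M → h v < 0}

/-! ## Simple random walk on `TG` -/

/-- The six neighbors of the vertex `0`. -/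
def step : Fin 6 → ℤ × ℤ := ![(1, 0), (0, 1), (-1, 1), (-1, 0), (0, -1), (1, -1)]

/-- The law of a sequence of independent uniform choices among the six directions. -/
def stepLaw : Measure (ℕ → Fin 6) :=
  Measure.infinitePi fun _ : ℕ => (PMF.uniformOfFintype (Fin 6)).toMeasure

/-- The position after `n` steps of the walk from `v` that takes the steps `ω`. -/
def walk (v : ℤ × ℤ) (ω : ℕ → Fin 6) (n : ℕ) : ℤ × ℤ := v + ∑ i ∈ Finset.range n, step (ω i)

/-- The probability that simple random walk on `TG` from `v` hits `A` before exiting `K`. -/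
def hitProb (v : ℤ × ℤ) (A : Set (ℤ × ℤ)) (K : Set ℂ) : ℝ :=
  stepLaw.real {ω | ∃ n, walk v ω n ∈ A ∧ ∀ m ≤ n, pos (walk v ω m) ∈ K}

end TriGrid

end

open TriGrid

noncomputable section

namespace TriGrid

/-! ## The lattice Laplacian -/

/-! Let `B` be the vertices of the hexagon ball of radius `R₂`, and let Y be the harmonic extension
into `B` of the values of the field h off `B` (`harm`). By the domain Markov property h - Y is a
zero-boundary field on `B`, independent of h off `B`. So the decoupled event, that h - Y has the
prescribed signs on V¹ and h those on V³, has probability exactly a(V¹₊, V¹₋) · P[K₃]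
(`map_decouple`, `measureReal_decoupled_mul`). It remains to compare this event with K₁ ∩ K₃.

Let φ be a cut-off equal to one on V¹ and zero off `B`. The shears h ↦ h ∓ φY preserve Lebesgue
measure and exchange the two events. By Jensen's inequality the ratio of the probabilities is at
least exp(-mean change of the action), the mean being conditional on the event one starts from
(`measure_mul_exp_le`). No pointwise control of the field is needed, only a bound on this mean
change. It involves the energy of φY, which by Caccioppoli is controlled by Y² on the edges where φ
varies, and the pairing of φY with h. In the pairing, h may be replaced by a function harmonic off
V¹, and that one by its product with a second cut-off ψ living where φ varies
(`two_form_cutoff_le`). Both cut-offs have energy O(C²), since the dimension is two.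

Everything thus reduces to second moments given signs. Gaussian integration by parts shows that
E[h(v) Δh(u)] is minus the indicator of u = v at every unconstrained u, and is -1 for u = v even at
constrained vertices. If m is the constrained vertex with the largest second moment Q, a neighbor of
opposite sign has nonpositive correlation with m, so -1 ≤ 5Q - 6Q and Q ≤ 1 (`corr_self_le`). The
maximum principle extends this to `corr_le_green`: second moments are at most max(1, Λ²) plus
Green's function of the unconstrained vertices.

Finally Green's function between the layer of the cut-offs and the complement of `B` is bounded. A
logarithmic barrier handles the pole, and from the rim of `B` the walk hits V³ before exiting the
ball of radius `5R` with probability bounded below, by the hypothesis at 0 and a chain of Harnack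
inequalities (`harnack`, `green_le_div`, `green_le_greenBound`). `Separated.comparison` combines
these ingredients. -/

/-- The graph Laplacian on the triangular lattice. -/
def lap (f : ℤ × ℤ → ℝ) (z : ℤ × ℤ) : ℝ := ∑ i, (f (z + step i) - f z)

lemma lap_eq (f : ℤ × ℤ → ℝ) (z : ℤ × ℤ) : lap f z = (∑ i, f (z + step i)) - 6 * f z := by
  simp [lap, Finset.sum_sub_distrib]

lemma lap_add (f g : ℤ × ℤ → ℝ) (z : ℤ × ℤ) :
    lap (fun x => f x + g x) z = lap f z + lap g z := by
  simp only [lap, ← Finset.sum_add_distrib]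
  exact Finset.sum_congr rfl fun i _ => by ring

lemma lap_sub (f g : ℤ × ℤ → ℝ) (z : ℤ × ℤ) :
    lap (fun x => f x - g x) z = lap f z - lap g z := by
  simp only [lap, ← Finset.sum_sub_distrib]
  exact Finset.sum_congr rfl fun i _ => by ring

lemma lap_const_mul (c : ℝ) (f : ℤ × ℤ → ℝ) (z : ℤ × ℤ) :
    lap (fun x => c * f x) z = c * lap f z := by
  simp only [lap, Finset.mul_sum]
  exact Finset.sum_congr rfl fun i _ => by ring

lemma lap_neg (f : ℤ × ℤ → ℝ) (z : ℤ × ℤ) : lap (fun x => -f x) z = -lap f z := by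
  simpa using lap_const_mul (-1) f z

lemma lap_const (c : ℝ) (z : ℤ × ℤ) : lap (fun _ => c) z = 0 := by simp [lap]

lemma lap_sum {ι : Type*} (s : Finset ι) (F : ι → ℤ × ℤ → ℝ) (z : ℤ × ℤ) :
    lap (fun x => ∑ j ∈ s, F j x) z = ∑ j ∈ s, lap (F j) z := by
  simp only [lap, ← Finset.sum_sub_distrib]
  exact Finset.sum_comm

lemma step_injective : Function.Injective step := by decide

lemma step_add_three (i : Fin 6) : step (i + 3) = -step i := by
  revert i; decide

/-! ## The maximum principle -/

/-- A function that is subharmonic on a finite set is bounded by one of its values outside. -/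
lemma exists_boundary_ge (I : Finset (ℤ × ℤ)) (f : ℤ × ℤ → ℝ) (hf : ∀ z ∈ I, 0 ≤ lap f z)
    {y : ℤ × ℤ} (hy : y ∈ I) : ∃ z ∈ I, ∃ i, z + step i ∉ I ∧ f y ≤ f (z + step i) := by
  by_contra! hcon
  obtain ⟨m, hmI, hm⟩ := I.exists_max_image f ⟨y, hy⟩
  -- Among the maximizers in `I` take one with the largest first coordinate. Its neighbor in
  -- direction `step 0 = (1, 0)` is again a maximizer, further to the right.
  obtain ⟨z, hz, hzmax⟩ := (I.filter fun z => f z = f m).exists_max_image (fun z => z.1)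
    ⟨m, by simp [hmI]⟩
  rw [Finset.mem_filter] at hz
  have hle : ∀ i, f (z + step i) ≤ f z := by
    intro i
    by_cases h : z + step i ∈ I
    · rw [hz.2]; exact hm _ h
    · rw [hz.2]; exact ((hcon z hz.1 i h).trans_le (hm y hy)).le
  have hall : ∀ i ∈ Finset.univ, f (z + step i) - f z = 0 := by
    refine (Finset.sum_eq_zero_iff_of_nonpos fun i _ => sub_nonpos.2 (hle i)).1 ?_
    exact le_antisymm (Finset.sum_nonpos fun i _ => sub_nonpos.2 (hle i)) (hf z hz.1)
  have h0 := hall 0 (Finset.mem_univ _)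
  have hin : z + step 0 ∈ I := by
    by_contra h
    have := hcon z hz.1 0 h
    have := hm y hy
    linarith [hz.2]
  have := hzmax (z + step 0) (by
    rw [Finset.mem_filter]; exact ⟨hin, by rw [← hz.2]; linarith⟩)
  simp [step] at this

lemma le_of_subharmonic (I : Finset (ℤ × ℤ)) (f : ℤ × ℤ → ℝ) (c : ℝ)
    (hf : ∀ z ∈ I, 0 ≤ lap f z) (hc : ∀ z ∉ I, f z ≤ c) (z : ℤ × ℤ) : f z ≤ c := by
  by_cases hz : z ∈ I
  · obtain ⟨w, _, i, hi, h⟩ := exists_boundary_ge I f hf hz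
    exact h.trans (hc _ hi)
  · exact hc z hz

/-- Comparison principle. -/
lemma le_of_lap_le (I : Finset (ℤ × ℤ)) (f g : ℤ × ℤ → ℝ)
    (hfg : ∀ z ∈ I, lap g z ≤ lap f z) (hc : ∀ z ∉ I, f z ≤ g z) (z : ℤ × ℤ) : f z ≤ g z := by
  have := le_of_subharmonic I (fun x => f x - g x) 0
    (fun z hz => by rw [lap_sub]; linarith [hfg z hz]) (fun z hz => by linarith [hc z hz]) z
  simpa using this

lemma eq_of_lap_eq (I : Finset (ℤ × ℤ)) (f g : ℤ × ℤ → ℝ)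
    (hfg : ∀ z ∈ I, lap f z = lap g z) (hc : ∀ z ∉ I, f z = g z) (z : ℤ × ℤ) : f z = g z :=
  le_antisymm (le_of_lap_le I f g (fun z hz => (hfg z hz).ge) (fun z hz => (hc z hz).le) z)
    (le_of_lap_le I g f (fun z hz => (hfg z hz).le) (fun z hz => (hc z hz).ge) z)

/-- Two-sided bound for harmonic functions. -/
lemma abs_le_of_harmonic (I : Finset (ℤ × ℤ)) (f : ℤ × ℤ → ℝ) (c : ℝ)
    (hf : ∀ z ∈ I, lap f z = 0) (hc : ∀ z ∉ I, |f z| ≤ c) (z : ℤ × ℤ) : |f z| ≤ c := by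
  rw [abs_le]
  constructor
  · have := le_of_subharmonic I (fun x => -f x) c (fun z hz => by rw [lap_neg, hf z hz]; simp)
      (fun z hz => (neg_le_abs _).trans (hc z hz)) z
    linarith
  · exact le_of_subharmonic I f c (fun z hz => (hf z hz).ge)
      (fun z hz => (le_abs_self _).trans (hc z hz)) z

/-! ## Extending functions from a finite set -/

/-- The function that equals `x` on `J` and `b` elsewhere. -/
def ext (J : Finset (ℤ × ℤ)) (b : ℤ × ℤ → ℝ) (x : J → ℝ) (z : ℤ × ℤ) : ℝ :=
  if h : z ∈ J then x ⟨z, h⟩ else b z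

@[simp] lemma ext_coe (J : Finset (ℤ × ℤ)) (b : ℤ × ℤ → ℝ) (x : J → ℝ) (z : J) :
    ext J b x z = x z := by simp [ext]

lemma ext_of_mem {J : Finset (ℤ × ℤ)} (b : ℤ × ℤ → ℝ) (x : J → ℝ) {z : ℤ × ℤ} (h : z ∈ J) :
    ext J b x z = x ⟨z, h⟩ := by simp [ext, h]

lemma ext_of_notMem {J : Finset (ℤ × ℤ)} (b : ℤ × ℤ → ℝ) (x : J → ℝ) {z : ℤ × ℤ} (h : z ∉ J) :
    ext J b x z = b z := by simp [ext, h]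

/-! ## Green's function -/

/-- The Dirichlet Laplacian on `I` is injective by the maximum principle, hence surjective in finite
dimension. -/
lemma exists_green (I : Finset (ℤ × ℤ)) (y : ℤ × ℤ) : ∃ g : ℤ × ℤ → ℝ,
    (∀ z ∉ I, g z = 0) ∧ ∀ z ∈ I, lap g z = if z = y then -1 else 0 := by
  let A : (I → ℝ) →ₗ[ℝ] (I → ℝ) :=
    { toFun := fun x z => lap (ext I (fun _ => 0) x) z
      map_add' := by
        intro x x'
        ext z
        rw [Pi.add_apply, ← lap_add]
        congr 1
        ext w
        by_cases h : w ∈ I <;> simp [TriGrid.ext, h]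
      map_smul' := by
        intro c x
        ext z
        rw [RingHom.id_apply, Pi.smul_apply, smul_eq_mul, ← lap_const_mul]
        congr 1
        ext w
        by_cases h : w ∈ I <;> simp [TriGrid.ext, h] }
  have hinj : Function.Injective A := by
    rw [← LinearMap.ker_eq_bot, LinearMap.ker_eq_bot']
    intro x hx
    ext z
    have := eq_of_lap_eq I (TriGrid.ext I (fun _ => 0) x) (fun _ => 0) (fun w hw => by
      rw [lap_const]; exact congrFun hx ⟨w, hw⟩) (fun w hw => ext_of_notMem _ _ hw) z
    simpa using this
  obtain ⟨x, hx⟩ := (LinearMap.injective_iff_surjective.1 hinj)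
    (fun z => if z.1 = y then -1 else 0)
  exact ⟨TriGrid.ext I (fun _ => 0) x, fun z hz => ext_of_notMem _ _ hz,
    fun z hz => congrFun hx ⟨z, hz⟩⟩

/-- Green's function of the finite set `I` with zero boundary values, with pole `y`. -/
def green (I : Finset (ℤ × ℤ)) (y : ℤ × ℤ) : ℤ × ℤ → ℝ := (exists_green I y).choose

lemma green_of_notMem {I : Finset (ℤ × ℤ)} (y : ℤ × ℤ) {z : ℤ × ℤ} (hz : z ∉ I) :
    green I y z = 0 := (exists_green I y).choose_spec.1 z hz

lemma lap_green {I : Finset (ℤ × ℤ)} (y : ℤ × ℤ) {z : ℤ × ℤ} (hz : z ∈ I) :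
    lap (green I y) z = if z = y then -1 else 0 := (exists_green I y).choose_spec.2 z hz

lemma green_nonneg (I : Finset (ℤ × ℤ)) (y z : ℤ × ℤ) : 0 ≤ green I y z :=
  le_of_lap_le I (fun _ => 0) (green I y)
    (fun w hw => by rw [lap_const, lap_green y hw]; split_ifs <;> norm_num)
    (fun w hw => (green_of_notMem y hw).ge) z

lemma green_pole_notMem {I : Finset (ℤ × ℤ)} {y : ℤ × ℤ} (hy : y ∉ I) (z : ℤ × ℤ) :
    green I y z = 0 :=
  eq_of_lap_eq I (green I y) (fun _ => 0)
    (fun w hw => by rw [lap_const, lap_green y hw, if_neg (by rintro rfl; exact hy hw)])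
    (fun w hw => green_of_notMem y hw) z

lemma green_mono {I I' : Finset (ℤ × ℤ)} (h : I ⊆ I') (y z : ℤ × ℤ) :
    green I y z ≤ green I' y z :=
  le_of_lap_le I _ _ (fun w hw => by rw [lap_green y hw, lap_green y (h hw)])
    (fun w hw => by rw [green_of_notMem y hw]; exact green_nonneg _ _ _) z

/-! ## Harmonic extension -/

/-- The function that equals `f` off the finite set `I` and is harmonic on `I`. -/
def harm (I : Finset (ℤ × ℤ)) (f : ℤ × ℤ → ℝ) (x : ℤ × ℤ) : ℝ :=
  f x + ∑ y ∈ I, lap f y * green I y x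

lemma harm_of_notMem {I : Finset (ℤ × ℤ)} (f : ℤ × ℤ → ℝ) {z : ℤ × ℤ} (hz : z ∉ I) :
    harm I f z = f z := by
  simp [harm, green_of_notMem _ hz]

lemma lap_harm {I : Finset (ℤ × ℤ)} (f : ℤ × ℤ → ℝ) {z : ℤ × ℤ} (hz : z ∈ I) :
    lap (harm I f) z = 0 := by
  have : harm I f = fun x => f x + ∑ y ∈ I, lap f y * green I y x := rfl
  rw [this, lap_add, lap_sum]
  simp_rw [lap_const_mul, lap_green _ hz]
  simp [hz]

lemma harm_mono {I : Finset (ℤ × ℤ)} {f g : ℤ × ℤ → ℝ} (h : ∀ z ∉ I, f z ≤ g z) (z : ℤ × ℤ) :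
    harm I f z ≤ harm I g z :=
  le_of_lap_le I _ _ (fun w hw => by rw [lap_harm _ hw, lap_harm _ hw])
    (fun w hw => by rw [harm_of_notMem _ hw, harm_of_notMem _ hw]; exact h w hw) z

lemma harm_congr {I : Finset (ℤ × ℤ)} {f g : ℤ × ℤ → ℝ} (h : ∀ z ∉ I, f z = g z) (z : ℤ × ℤ) :
    harm I f z = harm I g z :=
  le_antisymm (harm_mono (fun z hz => (h z hz).le) z) (harm_mono (fun z hz => (h z hz).ge) z)

lemma harm_eq_of_harmonic {I : Finset (ℤ × ℤ)} {f : ℤ × ℤ → ℝ} (h : ∀ z ∈ I, lap f z = 0)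
    (z : ℤ × ℤ) : harm I f z = f z := by
  simp only [harm, add_eq_left]
  exact Finset.sum_eq_zero fun y hy => by rw [h y hy, zero_mul]

lemma harm_le_const {I : Finset (ℤ × ℤ)} {f : ℤ × ℤ → ℝ} {c : ℝ} (h : ∀ z ∉ I, f z ≤ c)
    (z : ℤ × ℤ) : harm I f z ≤ c :=
  le_of_subharmonic I _ c (fun w hw => (lap_harm f hw).ge)
    (fun w hw => by rw [harm_of_notMem f hw]; exact h w hw) z

lemma harm_add (I : Finset (ℤ × ℤ)) (f g : ℤ × ℤ → ℝ) (z : ℤ × ℤ) :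
    harm I (fun x => f x + g x) z = harm I f z + harm I g z := by
  simp only [harm, lap_add, add_mul, Finset.sum_add_distrib]
  ring

/-! ## The Dirichlet form -/

/-- The Dirichlet form `⟨∇k, ∇f⟩` when `k` is supported in `J`. -/
def form (J : Finset (ℤ × ℤ)) (k f : ℤ × ℤ → ℝ) : ℝ := -∑ z ∈ J, k z * lap f z

lemma form_add_left (J : Finset (ℤ × ℤ)) (k k' f : ℤ × ℤ → ℝ) :
    form J (fun z => k z + k' z) f = form J k f + form J k' f := by
  simp only [form, add_mul, Finset.sum_add_distrib]; ring

lemma form_add_right (J : Finset (ℤ × ℤ)) (k f f' : ℤ × ℤ → ℝ) :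
    form J k (fun z => f z + f' z) = form J k f + form J k f' := by
  simp only [form, lap_add, mul_add, Finset.sum_add_distrib]; ring

lemma form_smul_left (J : Finset (ℤ × ℤ)) (c : ℝ) (k f : ℤ × ℤ → ℝ) :
    form J (fun z => c * k z) f = c * form J k f := by
  simp only [form, mul_assoc, ← Finset.mul_sum]; ring

lemma form_smul_right (J : Finset (ℤ × ℤ)) (c : ℝ) (k f : ℤ × ℤ → ℝ) :
    form J k (fun z => c * f z) = c * form J k f := by
  simp only [form, lap_const_mul, mul_left_comm _ c, ← Finset.mul_sum]; ring

lemma form_superset {J J' : Finset (ℤ × ℤ)} (h : J ⊆ J') {k : ℤ × ℤ → ℝ}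
    (hk : ∀ z ∉ J, k z = 0) (f : ℤ × ℤ → ℝ) : form J k f = form J' k f := by
  simp only [form]
  rw [Finset.sum_subset h fun z _ hz => by rw [hk z hz, zero_mul]]

/-! ### Neighborhoods, norms of lattice points and adjacency. -/

/-- A finite set together with its neighbors. -/
def nbhd (J : Finset (ℤ × ℤ)) : Finset (ℤ × ℤ) :=
  J ∪ J.biUnion fun z => Finset.univ.image fun i => z + step i

lemma subset_nbhd (J : Finset (ℤ × ℤ)) : J ⊆ nbhd J := Finset.subset_union_left

lemma add_step_mem_nbhd {J : Finset (ℤ × ℤ)} {z : ℤ × ℤ} (hz : z ∈ J) (i : Fin 6) :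
    z + step i ∈ nbhd J := by
  refine Finset.mem_union_right _ (Finset.mem_biUnion.2 ⟨z, hz, ?_⟩)
  exact Finset.mem_image_of_mem _ (Finset.mem_univ i)

lemma norm_pos_sq (v : ℤ × ℤ) : ‖pos v‖ ^ 2 = ((v.1 ^ 2 + v.1 * v.2 + v.2 ^ 2 : ℤ) : ℝ) := by
  rw [← Complex.normSq_eq_norm_sq, Complex.normSq_apply]
  simp only [pos, Complex.add_re, Complex.mul_re, Complex.add_im, Complex.mul_im,
    Complex.intCast_re, Complex.intCast_im, Complex.div_ofNat_re, Complex.div_ofNat_im,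
    Complex.one_re, Complex.one_im, Complex.ofReal_re, Complex.ofReal_im, Complex.I_re,
    Complex.I_im]
  have h3 : Real.sqrt 3 ^ 2 = 3 := Real.sq_sqrt (by norm_num)
  push_cast
  ring_nf
  rw [h3]
  ring

lemma pos_add (v w : ℤ × ℤ) : pos (v + w) = pos v + pos w := by
  simp only [pos, Prod.fst_add, Prod.snd_add]; push_cast; ring

lemma pos_neg (v : ℤ × ℤ) : pos (-v) = -pos v := by
  simp only [pos, Prod.fst_neg, Prod.snd_neg]; push_cast; ring

lemma pos_sub (v w : ℤ × ℤ) : pos (v - w) = pos v - pos w := by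
  rw [sub_eq_add_neg, pos_add, pos_neg, sub_eq_add_neg]

lemma pos_zero : pos 0 = 0 := by simp [pos]

lemma norm_pos_step (i : Fin 6) : ‖pos (step i)‖ = 1 := by
  have h := norm_pos_sq (step i)
  have h1 : (step i).1 ^ 2 + (step i).1 * (step i).2 + (step i).2 ^ 2 = 1 := by
    clear h
    revert i; decide
  rw [h1] at h
  have := norm_nonneg (pos (step i))
  push_cast at h
  nlinarith

/-- Distance one means that the norm form a² + ab + b² of the difference is one, and its only
integer solutions are the six steps. -/
lemma adj_iff (v w : ℤ × ℤ) : TG.Adj v w ↔ ∃ i, w = v + step i := by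
  constructor
  · intro h
    have h1 : dist (pos v) (pos w) = 1 := h
    rw [dist_comm, dist_eq_norm, ← pos_sub] at h1
    have h2 := norm_pos_sq (w - v)
    rw [h1] at h2
    set d := w - v with hd
    have h3 : d.1 ^ 2 + d.1 * d.2 + d.2 ^ 2 = 1 := by
      have h4 : ((d.1 ^ 2 + d.1 * d.2 + d.2 ^ 2 : ℤ) : ℝ) = 1 := by linarith
      exact_mod_cast h4
    have hw : w = v + d := by simp [hd]
    have : ∃ i, d = step i := by
      obtain ⟨a, b⟩ := d
      simp only at h3
      have ha : -1 ≤ a ∧ a ≤ 1 := by constructor <;> nlinarith [sq_nonneg (a + 2 * b)]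
      have hb : -1 ≤ b ∧ b ≤ 1 := by constructor <;> nlinarith [sq_nonneg (2 * a + b)]
      obtain ⟨ha1, ha2⟩ := ha
      obtain ⟨hb1, hb2⟩ := hb
      interval_cases a <;> interval_cases b <;> first | (exfalso; omega) | decide
    obtain ⟨i, hi⟩ := this
    exact ⟨i, hi ▸ hw⟩
  · rintro ⟨i, rfl⟩
    change dist (pos v) (pos (v + step i)) = 1
    rw [dist_comm, dist_eq_norm, ← pos_sub, add_sub_cancel_left, norm_pos_step]

/-! ### Summation by parts and energy inequalities. -/

open Classical in
lemma sum_adj_eq {A : Finset (ℤ × ℤ)} {u : ℤ × ℤ} (h : ∀ i, u + step i ∈ A)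
    (F : ℤ × ℤ → ℝ) : (∑ v ∈ A, if TG.Adj u v then F v else 0) = ∑ i, F (u + step i) := by
  rw [← Finset.sum_filter]
  symm
  refine Finset.sum_bij (fun i _ => u + step i) (fun i _ => ?_) (fun i _ j _ hij => ?_)
    (fun v hv => ?_) fun i _ => rfl
  · exact Finset.mem_filter.2 ⟨h i, (adj_iff _ _).2 ⟨i, rfl⟩⟩
  · exact step_injective (add_left_cancel hij)
  · obtain ⟨i, hi⟩ := (adj_iff _ _).1 (Finset.mem_filter.1 hv).2
    exact ⟨i, Finset.mem_univ _, hi.symm⟩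

open Classical in
/-- Summation by parts: sums over ordered pairs of adjacent vertices. -/
lemma form_eq_sum {J A : Finset (ℤ × ℤ)} (hA : nbhd J ⊆ A) {k : ℤ × ℤ → ℝ}
    (hk : ∀ z ∉ J, k z = 0) (f : ℤ × ℤ → ℝ) :
    form J k f = (1 / 2) * ∑ u ∈ A, ∑ v ∈ A,
      if TG.Adj u v then (k v - k u) * (f v - f u) else 0 := by
  have key : ∑ u ∈ A, ∑ v ∈ A, (if TG.Adj u v then k u * (f v - f u) else 0) = -form J k f := by
    rw [form, neg_neg, ← Finset.sum_subset ((subset_nbhd J).trans hA)]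
    · refine Finset.sum_congr rfl fun u hu => ?_
      rw [sum_adj_eq (fun i => hA (add_step_mem_nbhd hu i)) fun v => k u * (f v - f u), lap,
        Finset.mul_sum]
    · intro u _ hu
      exact Finset.sum_eq_zero fun v _ => by rw [hk u hu]; simp
  have key2 : ∑ u ∈ A, ∑ v ∈ A, (if TG.Adj u v then k v * (f v - f u) else 0) = form J k f := by
    rw [Finset.sum_comm, ← neg_neg (form J k f), ← key, ← Finset.sum_neg_distrib]
    refine Finset.sum_congr rfl fun u _ => ?_
    rw [← Finset.sum_neg_distrib]
    refine Finset.sum_congr rfl fun v _ => ?_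
    by_cases h : TG.Adj u v
    · rw [if_pos h, if_pos h.symm]; ring
    · rw [if_neg h, if_neg fun h' => h h'.symm]; simp
  have : ∑ u ∈ A, ∑ v ∈ A, (if TG.Adj u v then (k v - k u) * (f v - f u) else 0)
      = form J k f - -form J k f := by
    rw [← key, ← key2, ← Finset.sum_sub_distrib]
    refine Finset.sum_congr rfl fun u _ => ?_
    rw [← Finset.sum_sub_distrib]
    refine Finset.sum_congr rfl fun v _ => ?_
    split_ifs <;> ring
  rw [this]; ring

lemma form_comm {J : Finset (ℤ × ℤ)} {k f : ℤ × ℤ → ℝ}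
    (hk : ∀ z ∉ J, k z = 0) (hf : ∀ z ∉ J, f z = 0) : form J k f = form J f k := by
  classical
  rw [form_eq_sum subset_rfl hk, form_eq_sum subset_rfl hf]
  simp_rw [mul_comm (k _ - k _)]

lemma form_nonneg {J : Finset (ℤ × ℤ)} {k : ℤ × ℤ → ℝ} (hk : ∀ z ∉ J, k z = 0) :
    0 ≤ form J k k := by
  classical
  rw [form_eq_sum subset_rfl hk]
  refine mul_nonneg (by norm_num) (Finset.sum_nonneg fun u _ => Finset.sum_nonneg fun v _ => ?_)
  split_ifs
  · exact mul_self_nonneg _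
  · exact le_rfl

/-- The inequality of arithmetic and geometric means for the Dirichlet form. -/
lemma two_form_le {J : Finset (ℤ × ℤ)} {k f : ℤ × ℤ → ℝ}
    (hk : ∀ z ∉ J, k z = 0) (hf : ∀ z ∉ J, f z = 0) :
    2 * form J k f ≤ form J k k + form J f f := by
  have h := form_nonneg (J := J) (k := fun z => k z + (-1) * f z)
    (fun z hz => by rw [hk z hz, hf z hz]; simp)
  rw [form_add_left, form_add_right, form_add_right, form_smul_left, form_smul_left,
    form_smul_right, form_smul_right, form_comm hf hk] at h
  linarith

/-- Green's function is the reproducing kernel of the Dirichlet form. Its symmetry and the Poincaré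
inequality follow from this. -/
lemma form_green {J : Finset (ℤ × ℤ)} {y : ℤ × ℤ} (hy : y ∈ J) (k : ℤ × ℤ → ℝ) :
    form J k (green J y) = k y := by
  simp only [form]
  rw [Finset.sum_congr rfl fun z hz => by rw [lap_green y hz]]
  simp [hy]

lemma green_symm (I : Finset (ℤ × ℤ)) (y z : ℤ × ℤ) : green I y z = green I z y := by
  by_cases hy : y ∈ I
  · by_cases hz : z ∈ I
    · rw [← form_green hy (green I z), ← form_green hz (green I y)]
      exact form_comm (fun w hw => green_of_notMem _ hw) fun w hw => green_of_notMem _ hw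
    · rw [green_of_notMem _ hz, green_pole_notMem hz]
  · rw [green_pole_notMem hy, green_of_notMem _ hy]

/-- Poincaré inequality: the Dirichlet form is coercive. -/
lemma exists_coercive (J : Finset (ℤ × ℤ)) : ∃ ε : ℝ, 0 < ε ∧ ∀ k : ℤ × ℤ → ℝ,
    (∀ z ∉ J, k z = 0) → ε * ∑ z ∈ J, k z ^ 2 ≤ form J k k := by
  set S : ℝ := ∑ z ∈ J, green J z z
  have hS : 0 ≤ S := Finset.sum_nonneg fun z _ => green_nonneg _ _ _
  -- Cauchy–Schwarz against the reproducing kernel bounds k(y)² by `green J y y` times the energy,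
  -- and this is summed over y. The added 1 keeps the denominator positive when S = 0.
  refine ⟨(1 + S)⁻¹, by positivity, fun k hk => ?_⟩
  have hpt : ∀ y ∈ J, k y ^ 2 ≤ green J y y * form J k k := by
    intro y hy
    have hq : ∀ t : ℝ, 0 ≤ green J y y * (t * t) + (2 * k y) * t + form J k k := by
      intro t
      have h := form_nonneg (J := J) (k := fun z => k z + t * green J y z)
        (fun z hz => by rw [hk z hz, green_of_notMem _ hz]; simp)
      rw [form_add_left, form_add_right, form_add_right, form_smul_left, form_smul_left,
        form_smul_right, form_smul_right,
        form_comm (fun w hw => green_of_notMem y hw) hk, form_green hy, form_green hy] at h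
      linarith
    have := discrim_le_zero hq
    rw [discrim] at this
    linarith
  rw [inv_mul_le_iff₀ (by positivity)]
  calc ∑ z ∈ J, k z ^ 2 ≤ ∑ z ∈ J, green J z z * form J k k := Finset.sum_le_sum hpt
    _ = S * form J k k := by rw [Finset.sum_mul]
    _ ≤ (1 + S) * form J k k := by
      have := form_nonneg hk
      nlinarith

/-- Caccioppoli's identity. -/
lemma form_mul_self {J A : Finset (ℤ × ℤ)} (hA : nbhd J ⊆ A) {φ f : ℤ × ℤ → ℝ}
    (hφ : ∀ z ∉ J, φ z = 0) (hf : ∀ z ∈ J, φ z ≠ 0 → lap f z = 0) :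
    form J (fun z => φ z * f z) (fun z => φ z * f z) = (1 / 2) * ∑ u ∈ A, ∑ v ∈ A,
      open Classical in if TG.Adj u v then (φ v - φ u) ^ 2 * (f u * f v) else 0 := by
  classical
  have h0 : form J (fun z => φ z * φ z * f z) f = 0 := by
    rw [form, neg_eq_zero]
    refine Finset.sum_eq_zero fun z hz => ?_
    by_cases h : φ z = 0
    · simp [h]
    · rw [hf z hz h, mul_zero]
  rw [form_eq_sum hA (fun z hz => by rw [hφ z hz]; simp)] at h0
  rw [form_eq_sum hA (fun z hz => by rw [hφ z hz]; simp)]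
  -- Subtract the vanishing form of φ²f against f. Edge by edge, (φ_v f_v - φ_u f_u)² - (φ_v² f_v -
  -- φ_u² f_u)(f_v - f_u) = (φ_v - φ_u)² f_u f_v.
  refine Eq.trans (sub_zero _).symm ?_
  nth_rw 2 [← h0]
  rw [← mul_sub, ← Finset.sum_sub_distrib]
  congr 1
  refine Finset.sum_congr rfl fun u _ => ?_
  rw [← Finset.sum_sub_distrib]
  refine Finset.sum_congr rfl fun v _ => ?_
  split_ifs <;> ring

/-! ## The Gaussian measure on functions on a finite set -/

/-- The energy of the function that equals `x` on `J` and `b` elsewhere, up to a constant that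
does not depend on `x`. -/
def action (J : Finset (ℤ × ℤ)) (b : ℤ × ℤ → ℝ) (x : J → ℝ) : ℝ :=
  form J (ext J (fun _ => 0) x) (ext J b fun _ => 0)
    + (1 / 2) * form J (ext J (fun _ => 0) x) (ext J (fun _ => 0) x)

lemma ext_eq_add (J : Finset (ℤ × ℤ)) (b : ℤ × ℤ → ℝ) (x : J → ℝ) :
    ext J b x = fun z => ext J (fun _ => 0) x z + ext J b (fun _ => 0) z := by
  ext z
  by_cases h : z ∈ J <;> simp [TriGrid.ext, h]

/-- The action is quadratic, so its second-order expansion is exact. Every change of energy below is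
computed from it. -/
lemma action_sub (J : Finset (ℤ × ℤ)) (b : ℤ × ℤ → ℝ) (x x' : J → ℝ) (κ : ℤ × ℤ → ℝ)
    (hκ : ∀ z ∉ J, κ z = 0) (h : ∀ z : J, x' z = x z + κ z) :
    action J b x' - action J b x = form J κ (ext J b x) + (1 / 2) * form J κ κ := by
  have hx : ext J (fun _ => 0) x' = fun z => ext J (fun _ => 0) x z + κ z := by
    ext z
    by_cases hz : z ∈ J
    · rw [ext_of_mem _ _ hz, ext_of_mem _ _ hz, h]
    · rw [ext_of_notMem _ _ hz, ext_of_notMem _ _ hz, hκ z hz, add_zero]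
  have h0 : ∀ z ∉ J, ext J (fun _ => 0) x z = 0 := fun z hz => ext_of_notMem _ _ hz
  rw [action, action, hx, ext_eq_add J b x]
  simp only [form_add_left, form_add_right]
  rw [form_comm h0 hκ]
  ring

lemma continuous_ext (J : Finset (ℤ × ℤ)) (b : ℤ × ℤ → ℝ) (z : ℤ × ℤ) :
    Continuous fun x : J → ℝ => ext J b x z := by
  by_cases h : z ∈ J
  · simp only [TriGrid.ext, h, dite_true]; fun_prop
  · simp only [TriGrid.ext, h, dite_false]; fun_prop

lemma continuous_action (J : Finset (ℤ × ℤ)) (b : ℤ × ℤ → ℝ) : Continuous (action J b) := by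
  have h1 := continuous_ext J (fun _ => 0)
  unfold action form lap
  fun_prop (disch := exact h1 _)

/-- The density `exp (-action)` as a measure. -/
def fieldMeasure (J : Finset (ℤ × ℤ)) (b : ℤ × ℤ → ℝ) : Measure (J → ℝ) :=
  volume.withDensity fun x => ENNReal.ofReal (Real.exp (-action J b x))

/-- Coercivity beats the linear term after completing the square. The resulting Gaussian tails give
all the integrability that is needed. -/
lemma exists_le_action (J : Finset (ℤ × ℤ)) (b : ℤ × ℤ → ℝ) :
    ∃ ε : ℝ, 0 < ε ∧ ∃ c : ℝ, ∀ x : J → ℝ, ε * ∑ z, x z ^ 2 - c ≤ action J b x := by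
  obtain ⟨ε, hε, h⟩ := exists_coercive J
  refine ⟨ε / 4, by positivity, ∑ z : J, lap (ext J b fun _ => 0) z ^ 2 / ε, fun x => ?_⟩
  have h1 := h (ext J (fun _ => 0) x) fun z hz => ext_of_notMem _ _ hz
  have h2 : ∑ z ∈ J, ext J (fun _ => 0) x z ^ 2 = ∑ z : J, x z ^ 2 := by
    rw [← Finset.sum_coe_sort J]; simp
  have h3 : form J (ext J (fun _ => 0) x) (ext J b fun _ => 0) =
      ∑ z : J, -(x z * lap (ext J b fun _ => 0) z) := by
    rw [form, ← Finset.sum_coe_sort J, Finset.sum_neg_distrib]; simp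
  have h4 : ∑ z : J, (-(ε / 4) * x z ^ 2 - lap (ext J b fun _ => 0) z ^ 2 / ε) ≤
      ∑ z : J, -(x z * lap (ext J b fun _ => 0) z) := by
    refine Finset.sum_le_sum fun z _ => ?_
    set l := lap (ext J b fun _ => 0) z
    have : 0 ≤ (ε * x z / 2 - l) ^ 2 / ε := by positivity
    have e : (ε * x z / 2 - l) ^ 2 / ε = ε / 4 * x z ^ 2 - x z * l + l ^ 2 / ε := by
      field_simp; ring
    linarith
  rw [Finset.sum_sub_distrib, ← Finset.mul_sum] at h4
  rw [h2] at h1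
  rw [action, h3]
  linarith

lemma integrable_exp_neg_sum_sq {ι : Type*} [Fintype ι] {ε : ℝ} (hε : 0 < ε) :
    Integrable (fun x : ι → ℝ => Real.exp (-(ε * ∑ z, x z ^ 2))) := by
  have : (fun x : ι → ℝ => Real.exp (-(ε * ∑ z, x z ^ 2))) =
      fun x => ∏ z, Real.exp (-ε * x z ^ 2) := by
    ext x
    rw [← Real.exp_sum, ← Finset.mul_sum, neg_mul]
  rw [this]
  exact Integrable.fintype_prod fun _ => integrable_exp_neg_mul_sq hε

lemma integrable_mul_exp_action (J : Finset (ℤ × ℤ)) (b : ℤ × ℤ → ℝ) (f : (J → ℝ) → ℝ)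
    (hf : Continuous f) (a : ℝ) (hfa : ∀ x, |f x| ≤ a * (1 + ∑ z, x z ^ 2)) :
    Integrable fun x => Real.exp (-action J b x) * f x := by
  obtain ⟨ε, hε, c, hc⟩ := exists_le_action J b
  have hg : Integrable fun x : J → ℝ =>
      (a * (1 + 2 / ε) * Real.exp c) * Real.exp (-(ε / 2 * ∑ z, x z ^ 2)) :=
    (integrable_exp_neg_sum_sq (by positivity)).const_mul _
  refine hg.mono' ?_ (.of_forall fun x => ?_)
  · exact (((continuous_action J b).neg.rexp).mul hf).aestronglyMeasurable
  have hS : 0 ≤ ∑ z, x z ^ 2 := by positivity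
  set S := ∑ z, x z ^ 2
  have ha : 0 ≤ a := by
    have := (abs_nonneg _).trans (hfa x)
    by_contra h
    nlinarith
  have h1 : Real.exp (-action J b x) ≤ Real.exp c * Real.exp (-(ε * S)) := by
    rw [← Real.exp_add]
    exact Real.exp_le_exp.2 (by linarith [hc x])
  have h2 : 1 + S ≤ (1 + 2 / ε) * Real.exp (ε / 2 * S) := by
    have e1 := Real.add_one_le_exp (ε / 2 * S)
    have e2 : 1 ≤ Real.exp (ε / 2 * S) := Real.one_le_exp (by positivity)
    have : S = 2 / ε * (ε / 2 * S) := by field_simp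
    have : 2 / ε * (ε / 2 * S) ≤ 2 / ε * Real.exp (ε / 2 * S) := by
      gcongr; linarith
    linarith
  rw [Real.norm_eq_abs, abs_mul, abs_of_pos (Real.exp_pos _)]
  calc Real.exp (-action J b x) * |f x|
      ≤ (Real.exp c * Real.exp (-(ε * S))) * (a * ((1 + 2 / ε) * Real.exp (ε / 2 * S))) := by
        refine mul_le_mul h1 ((hfa x).trans ?_) (abs_nonneg _) (by positivity)
        gcongr
    _ = (a * (1 + 2 / ε) * Real.exp c) * (Real.exp (-(ε * S)) * Real.exp (ε / 2 * S)) := by ring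
    _ = _ := by
      rw [← Real.exp_add]
      congr 2
      ring

lemma integrable_fieldMeasure_iff (J : Finset (ℤ × ℤ)) (b : ℤ × ℤ → ℝ) (f : (J → ℝ) → ℝ) :
    Integrable f (fieldMeasure J b) ↔ Integrable fun x => Real.exp (-action J b x) * f x := by
  have hm : Measurable fun x => ENNReal.ofReal (Real.exp (-action J b x)) :=
    (((continuous_action J b).neg.rexp).measurable).ennreal_ofReal
  rw [fieldMeasure, integrable_withDensity_iff_integrable_smul' hm
    (.of_forall fun x => ENNReal.ofReal_lt_top)]
  simp [ENNReal.toReal_ofReal (Real.exp_pos _).le]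

lemma integrable_of_quadratic_bound (J : Finset (ℤ × ℤ)) (b : ℤ × ℤ → ℝ) (f : (J → ℝ) → ℝ)
    (hf : Continuous f) (a : ℝ) (hfa : ∀ x, |f x| ≤ a * (1 + ∑ z, x z ^ 2)) :
    Integrable f (fieldMeasure J b) :=
  (integrable_fieldMeasure_iff J b f).2 (integrable_mul_exp_action J b f hf a hfa)

instance (J : Finset (ℤ × ℤ)) (b : ℤ × ℤ → ℝ) : IsFiniteMeasure (fieldMeasure J b) := by
  have h := integrable_of_quadratic_bound J b (fun _ => 1) continuous_const 1 fun x => by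
    have : 0 ≤ ∑ z, x z ^ 2 := by positivity
    rw [abs_one]; linarith
  rw [integrable_const_iff] at h
  exact h.resolve_left one_ne_zero

lemma memLp_ext (J : Finset (ℤ × ℤ)) (b : ℤ × ℤ → ℝ) (z : ℤ × ℤ) :
    MemLp (fun x => ext J b x z) 2 (fieldMeasure J b) := by
  by_cases h : z ∈ J
  · refine (memLp_two_iff_integrable_sq (continuous_ext J b z).aestronglyMeasurable).2 ?_
    refine integrable_of_quadratic_bound J b _ ((continuous_ext J b z).pow 2) 1 fun x => ?_
    rw [ext_of_mem _ _ h, abs_of_nonneg (sq_nonneg _), one_mul]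
    have := Finset.single_le_sum (f := fun z => x z ^ 2) (fun i _ => sq_nonneg _)
      (Finset.mem_univ (⟨z, h⟩ : J))
    linarith
  · simp only [ext_of_notMem _ _ h]
    exact memLp_const _

lemma fieldMeasure_pos (J : Finset (ℤ × ℤ)) (b : ℤ × ℤ → ℝ) {K : Set (J → ℝ)} (hK : IsOpen K)
    (hne : K.Nonempty) : fieldMeasure J b K ≠ 0 := by
  intro h
  have hm : Measurable fun x => ENNReal.ofReal (Real.exp (-action J b x)) :=
    (((continuous_action J b).neg.rexp).measurable).ennreal_ofReal
  have : (volume : Measure (J → ℝ)) ≪ fieldMeasure J b :=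
    withDensity_absolutelyContinuous' hm.aemeasurable
      (.of_forall fun x => by simp [Real.exp_pos])
  exact (hK.measure_pos volume hne).ne' (this h)

/-- The field conditioned on an event. -/
def law (J : Finset (ℤ × ℤ)) (b : ℤ × ℤ → ℝ) (K : Set (J → ℝ)) : Measure (J → ℝ) :=
  ProbabilityTheory.cond (fieldMeasure J b) K

lemma isProbabilityMeasure_law {J : Finset (ℤ × ℤ)} {b : ℤ × ℤ → ℝ} {K : Set (J → ℝ)}
    (h : fieldMeasure J b K ≠ 0) : IsProbabilityMeasure (law J b K) :=
  ProbabilityTheory.cond_isProbabilityMeasure h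

instance (J : Finset (ℤ × ℤ)) (b : ℤ × ℤ → ℝ) (K : Set (J → ℝ)) : IsFiniteMeasure (law J b K) := by
  by_cases h : fieldMeasure J b K = 0
  · rw [law, ProbabilityTheory.cond_eq_zero_of_meas_eq_zero h]; infer_instance
  · have := isProbabilityMeasure_law h; infer_instance

lemma memLp_law {J : Finset (ℤ × ℤ)} {b : ℤ × ℤ → ℝ} {K : Set (J → ℝ)} {f : (J → ℝ) → ℝ}
    {p : ENNReal} (hf : MemLp f p (fieldMeasure J b)) : MemLp f p (law J b K) := by
  by_cases h : fieldMeasure J b K = 0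
  · rw [law, ProbabilityTheory.cond_eq_zero_of_meas_eq_zero h]; simp
  · exact (hf.restrict K).smul_measure (by simp [h])

lemma integral_law (J : Finset (ℤ × ℤ)) (b : ℤ × ℤ → ℝ) (K : Set (J → ℝ)) (f : (J → ℝ) → ℝ) :
    ∫ x, f x ∂(law J b K) = ((fieldMeasure J b).real K)⁻¹ * ∫ x in K, f x ∂(fieldMeasure J b) := by
  rw [law, ProbabilityTheory.cond, integral_smul_measure, ENNReal.toReal_inv, smul_eq_mul]
  rfl

/-! ### The basic inequality for a change of variables. -/

/-- Change of variables and Jensen's inequality. -/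
lemma measure_mul_exp_le {J : Finset (ℤ × ℤ)} {b : ℤ × ℤ → ℝ} {T : (J → ℝ) → (J → ℝ)}
    (hT : Measurable T) {c : ℝ} (hc : 0 < c)
    (hTv : Measure.map T volume = ENNReal.ofReal c • volume) {K K' : Set (J → ℝ)}
    (hK : MeasurableSet K) (hK' : MeasurableSet K') (hKK : T ⁻¹' K' = K)
    (hpos : fieldMeasure J b K ≠ 0)
    (hint : Integrable (fun x => action J b (T x) - action J b x) (fieldMeasure J b)) :
    (fieldMeasure J b).real K *
        Real.exp (-∫ x, (action J b (T x) - action J b x) ∂(law J b K)) ≤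
      c * (fieldMeasure J b).real K' := by
  set μ := fieldMeasure J b with hμ
  set Δ : (J → ℝ) → ℝ := fun x => action J b (T x) - action J b x
  set a := ∫ x, Δ x ∂(law J b K) with ha
  have hUc := continuous_action J b
  have hUe : Continuous fun x => Real.exp (-action J b x) := by fun_prop
  have hw : Measurable fun x => ENNReal.ofReal (Real.exp (-action J b x)) :=
    hUe.measurable.ennreal_ofReal
  have hZ : 0 < μ.real K := by
    rw [measureReal_def]; exact ENNReal.toReal_pos hpos (measure_ne_top _ _)
  have hwint : Integrable fun x => Real.exp (-action J b x) := by
    simpa using (integrable_fieldMeasure_iff J b (fun _ => 1)).1 (integrable_const 1)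
  have hwT : Integrable fun x => Real.exp (-action J b (T x)) := by
    have h1 : Integrable (fun x => Real.exp (-action J b x)) (Measure.map T volume) := by
      rw [hTv]; exact hwint.smul_measure ENNReal.ofReal_ne_top
    exact (integrable_map_measure (hUe.aestronglyMeasurable) hT.aemeasurable).1 h1
  have hΔint : Integrable (fun x => Real.exp (-Δ x)) μ := by
    rw [hμ, integrable_fieldMeasure_iff]
    refine hwT.congr (.of_forall fun x => ?_)
    simp only [Δ]
    rw [← Real.exp_add]
    congr 1
    ring
  -- Change of variables: the density of the measure pulled back by `T` is exp(-Δ) relative to the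
  -- measure itself, up to the factor `c`.
  have hleft : c * μ.real K' = ∫ x in K, Real.exp (-Δ x) ∂μ := by
    have e1 : μ.real K' = ∫ x in K', Real.exp (-action J b x) := by
      rw [measureReal_def, hμ, fieldMeasure, withDensity_apply _ hK',
        ← integral_toReal hw.aemeasurable.restrict (.of_forall fun x => ENNReal.ofReal_lt_top)]
      simp [ENNReal.toReal_ofReal (Real.exp_pos _).le]
    have e2 : c * ∫ x in K', Real.exp (-action J b x) =
        ∫ x in K', Real.exp (-action J b x) ∂(Measure.map T volume) := by
      rw [hTv, Measure.restrict_smul, integral_smul_measure, ENNReal.toReal_ofReal hc.le,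
        smul_eq_mul]
    rw [e1, e2, setIntegral_map hK' hUe.aestronglyMeasurable hT.aemeasurable, hKK, hμ,
      fieldMeasure, setIntegral_withDensity_eq_setIntegral_toReal_smul₀ hw.aemeasurable.restrict
        (.of_forall fun x => ENNReal.ofReal_lt_top) _ hK]
    refine integral_congr_ae (.of_forall fun x => ?_)
    simp only [Δ, smul_eq_mul, ENNReal.toReal_ofReal (Real.exp_pos _).le]
    rw [← Real.exp_add]
    congr 1
    ring
  -- Jensen's inequality in tangent-line form. As `a` is the mean of Δ, the factor 1 + a - Δ has
  -- mean one.
  have hlow : ∫ x in K, Real.exp (-a) * (1 + a - Δ x) ∂μ ≤ ∫ x in K, Real.exp (-Δ x) ∂μ := by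
    refine integral_mono ?_ hΔint.integrableOn fun x => ?_
    · exact (((integrable_const (1 + a)).sub hint).const_mul _).integrableOn
    · have h1 := Real.add_one_le_exp (a - Δ x)
      have h2 : Real.exp (-Δ x) = Real.exp (-a) * Real.exp (a - Δ x) := by
        rw [← Real.exp_add]; congr 1; ring
      simp only
      rw [h2]
      gcongr
      linarith
  have hval : ∫ x in K, Real.exp (-a) * (1 + a - Δ x) ∂μ = μ.real K * Real.exp (-a) := by
    rw [integral_const_mul, integral_sub (integrable_const _) hint.integrableOn]
    have : ∫ x in K, Δ x ∂μ = μ.real K * a := by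
      rw [ha, integral_law, ← hμ, ← mul_assoc, mul_inv_cancel₀ hZ.ne', one_mul]
    rw [this, setIntegral_const, smul_eq_mul]
    ring
  rw [hleft, ← hval]
  exact hlow

/-! ## Shears preserve Lebesgue measure -/

/-- The map that adds `τ x` to the coordinates in `B`. -/
def shear {J : Finset (ℤ × ℤ)} (B : Finset (ℤ × ℤ)) (τ : (J → ℝ) → ℤ × ℤ → ℝ) (x : J → ℝ) :
    J → ℝ := fun j => x j + if j.1 ∈ B then τ x j else 0

/-- The displacement does not depend on the coordinates in `B`, so with the others frozen the map is
a translation of these coordinates, and Fubini applies. -/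
lemma measurePreserving_shear {J : Finset (ℤ × ℤ)} (B : Finset (ℤ × ℤ))
    (τ : (J → ℝ) → ℤ × ℤ → ℝ) (hm : ∀ z, Measurable fun x => τ x z)
    (hτ : ∀ x x' : J → ℝ, (∀ j : J, j.1 ∉ B → x j = x' j) → τ x = τ x') :
    MeasurePreserving (shear B τ) volume volume := by
  let e := MeasurableEquiv.piEquivPiSubtypeProd (fun _ : J => ℝ) (fun j => j.1 ∉ B)
  have he : MeasurePreserving e volume volume :=
    volume_preserving_piEquivPiSubtypeProd (fun _ : J => ℝ) (fun j => j.1 ∉ B)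
  let t : ({j : J // j.1 ∉ B} → ℝ) → {j : J // ¬ j.1 ∉ B} → ℝ :=
    fun y i => τ (e.symm (y, 0)) i.1
  have ht : Measurable t := by
    refine measurable_pi_iff.2 fun i => (hm i.1).comp (e.symm.measurable.comp ?_)
    fun_prop
  have hg : MeasurePreserving (fun p : ({j : J // j.1 ∉ B} → ℝ) × ({j : J // ¬ j.1 ∉ B} → ℝ) =>
      (p.1, p.2 + t p.1)) (volume.prod volume) (volume.prod volume) := by
    refine MeasurePreserving.skew_product (g := fun y x => x + t y) (MeasurePreserving.id volume)
      ?_ (.of_forall fun y => ?_)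
    · exact measurable_snd.add (ht.comp measurable_fst)
    · exact map_add_right_eq_self volume (t y)
  have hcomp := (he.symm e).comp (hg.comp he)
  suffices hfun : shear B τ = ⇑e.symm ∘ (fun p => (p.1, p.2 + t p.1)) ∘ ⇑e by
    rw [hfun]; exact hcomp
  funext x j
  have hx : τ (e.symm ((e x).1, 0)) = τ x := by
    refine hτ _ _ fun j hj => ?_
    simp [e, MeasurableEquiv.piEquivPiSubtypeProd, Equiv.piEquivPiSubtypeProd, hj]
  by_cases h : j.1 ∈ B
  · simp only [shear, h, if_true, Function.comp]
    rw [← hx]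
    simp [e, MeasurableEquiv.piEquivPiSubtypeProd, Equiv.piEquivPiSubtypeProd, h, t]
  · simp [shear, h, e, MeasurableEquiv.piEquivPiSubtypeProd, Equiv.piEquivPiSubtypeProd]

/-! ## Sign events -/

/-- The event that the field on `J` is positive on `P` and negative on `M`. -/
def signs (J : Finset (ℤ × ℤ)) (P M : Set (ℤ × ℤ)) : Set (J → ℝ) :=
  {x | (∀ v : J, v.1 ∈ P → 0 < x v) ∧ ∀ v : J, v.1 ∈ M → x v < 0}

lemma isOpen_signs (J : Finset (ℤ × ℤ)) (P M : Set (ℤ × ℤ)) : IsOpen (signs J P M) := by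
  have : signs J P M = (⋂ v : J, {x | v.1 ∈ P → 0 < x v}) ∩ ⋂ v : J, {x | v.1 ∈ M → x v < 0} := by
    ext x; simp [signs]
  rw [this]
  refine (isOpen_iInter_of_finite fun v => ?_).inter (isOpen_iInter_of_finite fun v => ?_)
  · by_cases h : v.1 ∈ P
    · simpa [h] using isOpen_lt continuous_const (continuous_apply v)
    · simp [h]
  · by_cases h : v.1 ∈ M
    · simpa [h] using isOpen_lt (continuous_apply v) continuous_const
    · simp [h]

lemma measurableSet_signs (J : Finset (ℤ × ℤ)) (P M : Set (ℤ × ℤ)) :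
    MeasurableSet (signs J P M) := (isOpen_signs J P M).measurableSet

open Classical in
lemma signs_nonempty (J : Finset (ℤ × ℤ)) {P M : Set (ℤ × ℤ)} (h : Disjoint P M) :
    (signs J P M).Nonempty := by
  refine ⟨fun v => if v.1 ∈ P then 1 else -1, fun v hv => by simp [hv], fun v hv => ?_⟩
  have : v.1 ∉ P := fun h' => Set.disjoint_left.1 h h' hv
  simp [this]

lemma fieldMeasure_signs_ne_zero (J : Finset (ℤ × ℤ)) (b : ℤ × ℤ → ℝ) {P M : Set (ℤ × ℤ)}
    (h : Disjoint P M) : fieldMeasure J b (signs J P M) ≠ 0 :=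
  fieldMeasure_pos J b (isOpen_signs J P M) (signs_nonempty J h)

/-! ## Linear functionals of the field -/

lemma memLp_lap (J : Finset (ℤ × ℤ)) (b : ℤ × ℤ → ℝ) (z : ℤ × ℤ) :
    MemLp (fun x => lap (ext J b x) z) 2 (fieldMeasure J b) := by
  simp only [lap]
  exact memLp_finsetSum _ fun i _ => (memLp_ext J b _).sub (memLp_ext J b _)

lemma memLp_harm (J : Finset (ℤ × ℤ)) (b : ℤ × ℤ → ℝ) (I : Finset (ℤ × ℤ)) (z : ℤ × ℤ) :
    MemLp (fun x => harm I (ext J b x) z) 2 (fieldMeasure J b) := by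
  simp only [harm]
  exact (memLp_ext J b z).add (memLp_finsetSum _ fun y _ => (memLp_lap J b y).mul_const _)

/-! ## Integration by parts -/

/-- A quadratic that vanishes at zero and is nowhere negative has slope zero there. -/
lemma eq_zero_of_forall_quadratic {A q : ℝ} (h : ∀ s : ℝ, 0 ≤ -(s * A) + 3 * s ^ 2 * q) :
    A = 0 := by
  have := discrim_le_zero (a := 3 * q) (b := -A) (c := 0) fun s => by have := h s; linarith
  rw [discrim] at this
  nlinarith [sq_nonneg A]

/-- Both sides equal one at s = 0, so their slopes there, A and -1, must agree. -/
lemma eq_neg_one_of_forall {A q : ℝ} (hq : 0 ≤ q)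
    (h : ∀ s : ℝ, -1 < s → 1 - (-(s * A) + 3 * s ^ 2 * q) ≤ (1 + s)⁻¹) : A = -1 := by
  have h1 : ∀ s : ℝ, |s| ≤ 1 / 2 → 0 ≤ s * (-A - 1) + s ^ 2 * (|A| + 5 * q) := by
    intro s hs
    rw [abs_le] at hs
    have h2 := mul_le_mul_of_nonneg_right (h s (by linarith)) (by linarith : 0 ≤ 1 + s)
    rw [inv_mul_cancel₀ (by linarith)] at h2
    have h3 : s ^ 2 * (-A + 3 * q * (1 + s)) ≤ s ^ 2 * (|A| + 5 * q) := by
      refine mul_le_mul_of_nonneg_left ?_ (sq_nonneg s)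
      nlinarith [neg_abs_le A]
    nlinarith
  by_contra hA
  have hB : 0 < |-A - 1| := abs_pos.2 fun h' => hA (by linarith)
  set B := -A - 1
  set D := |A| + 5 * q
  have hD : 0 ≤ D := by positivity
  have hden : 0 < 2 * (|B| + D + 1) := by positivity
  -- The test value is s = -Bt, with `t` small enough that |s| ≤ 1/2 and the quadratic term cannot
  -- offset the linear one.
  set t := (2 * (|B| + D + 1))⁻¹
  have ht : 0 < t := inv_pos.2 hden
  have ht1 : t * (2 * (|B| + D + 1)) = 1 := inv_mul_cancel₀ hden.ne'
  have h4 := h1 (-(B * t)) (by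
    rw [abs_neg, abs_mul, abs_of_pos ht]
    nlinarith)
  have h5 : 0 < B ^ 2 := by rw [← sq_abs]; positivity
  have h6 : t * D < 1 := by nlinarith
  have h7 : 0 < B ^ 2 * t * (1 - t * D) := by
    have : 0 < 1 - t * D := by linarith
    positivity
  nlinarith

/-- Gaussian integration by parts, without differentiating. Moving the unconstrained coordinate `u`
by sξ preserves both volume and the sign event, so by `measure_mul_exp_le` the mean change of the
action is nonnegative for all s of either sign. Its linear coefficient is minus the integral here;
the 3 is half the degree. -/
lemma integral_mul_lap_eq_zero {J : Finset (ℤ × ℤ)} {b : ℤ × ℤ → ℝ} {P M : Set (ℤ × ℤ)}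
    (hPM : Disjoint P M) {u : ℤ × ℤ} (hu : u ∈ J) (huP : u ∉ P) (huM : u ∉ M)
    (ξ : (J → ℝ) → ℝ) (hξm : Measurable ξ) (hξ2 : MemLp ξ 2 (fieldMeasure J b))
    (hξ : ∀ x x' : J → ℝ, (∀ j : J, j.1 ≠ u → x j = x' j) → ξ x = ξ x') :
    ∫ x, ξ x * lap (ext J b x) u ∂(law J b (signs J P M)) = 0 := by
  have hstep : ∀ i, step i ≠ 0 := by decide
  have hpos := fieldMeasure_signs_ne_zero J b hPM
  set K := signs J P M
  refine eq_zero_of_forall_quadratic (q := ∫ x, ξ x ^ 2 ∂(law J b K)) fun s => ?_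
  let T : (J → ℝ) → J → ℝ := shear {u} fun x _ => s * ξ x
  have hT : MeasurePreserving T volume volume :=
    measurePreserving_shear {u} _ (fun _ => hξm.const_mul s) fun x x' h => by
      rw [hξ x x' fun j hj => h j (by simpa using hj)]
  have hΔ : ∀ x, action J b (T x) - action J b x =
      -(s * (ξ x * lap (ext J b x) u)) + 3 * s ^ 2 * ξ x ^ 2 := by
    intro x
    rw [action_sub J b x (T x) (fun z => if z = u then s * ξ x else 0)]
    · have e1 : ∀ f, form J (fun z => if z = u then s * ξ x else 0) f = -(s * ξ x * lap f u) := by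
        intro f; simp [form, hu]
      rw [e1, e1]
      have e2 : lap (fun z => if z = u then s * ξ x else 0) u = -6 * (s * ξ x) := by
        simp [lap, hstep]
      rw [e2]; ring
    · intro z hz
      rw [if_neg (by rintro rfl; exact hz hu)]
    · intro z
      simp [T, shear]
  have hi1 : Integrable (fun x => ξ x * lap (ext J b x) u) (fieldMeasure J b) :=
    hξ2.integrable_mul (memLp_lap J b u)
  have hi2 : Integrable (fun x => ξ x ^ 2) (fieldMeasure J b) := hξ2.integrable_sq
  have hJ := measure_mul_exp_le (b := b) hT.measurable one_pos (by simpa using hT.map_eq)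
    (measurableSet_signs J P M) (measurableSet_signs J P M) (K' := K) (K := K) ?_ hpos ?_
  · have hZ : 0 < (fieldMeasure J b).real K := ENNReal.toReal_pos hpos (measure_ne_top _ _)
    rw [one_mul, mul_le_iff_le_one_right hZ, Real.exp_le_one_iff, neg_nonpos] at hJ
    simp only [hΔ] at hJ
    rwa [integral_add, integral_neg, integral_const_mul, integral_const_mul] at hJ
    · exact ((memLp_one_iff_integrable.1 (memLp_law (memLp_one_iff_integrable.2 hi1))).const_mul
        _).neg
    · exact (memLp_one_iff_integrable.1 (memLp_law (memLp_one_iff_integrable.2 hi2))).const_mul _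
  · have hTx : ∀ x (v : J), v.1 ≠ u → T x v = x v := fun x v hv => by simp [T, shear, hv]
    ext x
    refine and_congr ?_ ?_ <;> refine forall_congr' fun v => imp_congr_right fun hv => ?_
    · rw [hTx x v (by rintro rfl; exact huP hv)]
    · rw [hTx x v (by rintro rfl; exact huM hv)]
  · simp only [hΔ]
    exact (hi1.const_mul _).neg.add (hi2.const_mul _)

lemma map_scale_volume {J : Finset (ℤ × ℤ)} (v : J) {t : ℝ} (ht : 0 < t) :
    Measure.map (fun (x : J → ℝ) j => (if j = v then t else 1) * x j) volume =
      ENNReal.ofReal t⁻¹ • (volume : Measure (J → ℝ)) := by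
  have hdet : (Matrix.diagonal fun j : J => if j = v then t else 1).det = t := by
    rw [Matrix.det_diagonal]; simp
  have h := Real.smul_map_diagonal_volume_pi (D := fun j : J => if j = v then t else 1)
    (by rw [hdet]; exact ht.ne')
  rw [hdet, abs_of_pos ht] at h
  have hfun : (fun (x : J → ℝ) j => (if j = v then t else 1) * x j) =
      Matrix.toLin' (Matrix.diagonal fun j : J => if j = v then t else 1) := by
    ext x j
    simp [Matrix.mulVec_diagonal]
  rw [hfun]
  conv_rhs => rw [← h]
  rw [smul_smul, ← ENNReal.ofReal_mul (by positivity), inv_mul_cancel₀ ht.ne']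
  simp

/-- Rescaling the coordinate at `v` by 1 + s > 0 keeps all signs, so no freedom of `v` is required.
The value -1 comes from the Jacobian factor (1 + s)⁻¹. -/
lemma integral_self_mul_lap {J : Finset (ℤ × ℤ)} {b : ℤ × ℤ → ℝ} {P M : Set (ℤ × ℤ)}
    (hPM : Disjoint P M) {v : ℤ × ℤ} (hv : v ∈ J) :
    ∫ x, ext J b x v * lap (ext J b x) v ∂(law J b (signs J P M)) = -1 := by
  have hstep : ∀ i, step i ≠ 0 := by decide
  have hpos := fieldMeasure_signs_ne_zero J b hPM
  set K := signs J P M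
  refine eq_neg_one_of_forall (q := ∫ x, ext J b x v ^ 2 ∂(law J b K))
    (integral_nonneg fun x => sq_nonneg _) fun s hs => ?_
  let T : (J → ℝ) → J → ℝ := fun x j => (if j = ⟨v, hv⟩ then 1 + s else 1) * x j
  have hTv := map_scale_volume (J := J) ⟨v, hv⟩ (t := 1 + s) (by linarith)
  have hTm : Measurable T := by fun_prop
  have hΔ : ∀ x, action J b (T x) - action J b x =
      -(s * (ext J b x v * lap (ext J b x) v)) + 3 * s ^ 2 * ext J b x v ^ 2 := by
    intro x
    rw [action_sub J b x (T x) (fun z => if z = v then s * ext J b x v else 0)]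
    · have e1 : ∀ f, form J (fun z => if z = v then s * ext J b x v else 0) f =
          -(s * ext J b x v * lap f v) := by
        intro f; simp [form, hv]
      rw [e1, e1]
      have e2 : lap (fun z => if z = v then s * ext J b x v else 0) v =
          -6 * (s * ext J b x v) := by
        simp [lap, hstep]
      rw [e2]; ring
    · intro z hz
      rw [if_neg (by rintro rfl; exact hz hv)]
    · intro z
      by_cases h : z = ⟨v, hv⟩
      · subst h; simp [T, ext_of_mem b x hv]; ring
      · have : z.1 ≠ v := fun h' => h (Subtype.ext h')
        simp [T, h, this]
  have hi1 : Integrable (fun x => ext J b x v * lap (ext J b x) v) (fieldMeasure J b) :=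
    (memLp_ext J b v).integrable_mul (memLp_lap J b v)
  have hi2 : Integrable (fun x => ext J b x v ^ 2) (fieldMeasure J b) :=
    (memLp_ext J b v).integrable_sq
  have hJ := measure_mul_exp_le (b := b) hTm (inv_pos.2 (by linarith : 0 < 1 + s)) hTv
    (measurableSet_signs J P M) (measurableSet_signs J P M) (K' := K) (K := K) ?_ hpos ?_
  · have hZ : 0 < (fieldMeasure J b).real K := ENNReal.toReal_pos hpos (measure_ne_top _ _)
    rw [mul_comm _ ((fieldMeasure J b).real K), mul_le_mul_iff_right₀ hZ] at hJ
    simp only [hΔ] at hJ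
    rw [integral_add, integral_neg, integral_const_mul, integral_const_mul] at hJ
    · refine le_trans ?_ hJ
      have := Real.add_one_le_exp (-(-(s * ∫ x, ext J b x v * lap (ext J b x) v ∂(law J b K)) +
        3 * s ^ 2 * ∫ x, ext J b x v ^ 2 ∂(law J b K)))
      linarith
    · exact ((memLp_one_iff_integrable.1 (memLp_law (memLp_one_iff_integrable.2 hi1))).const_mul
        _).neg
    · exact (memLp_one_iff_integrable.1 (memLp_law (memLp_one_iff_integrable.2 hi2))).const_mul _
  · ext x
    refine and_congr ?_ ?_ <;> refine forall_congr' fun w => imp_congr_right fun hw => ?_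
    · by_cases h : w = ⟨v, hv⟩
      · simp only [T, h, if_true]; exact mul_pos_iff_of_pos_left (by linarith)
      · simp [T, h]
    · by_cases h : w = ⟨v, hv⟩
      · simp only [T, h, if_true]
        exact ⟨fun h' => by nlinarith, fun h' => mul_neg_of_pos_of_neg (by linarith) h'⟩
      · simp [T, h]
  · simp only [hΔ]
    exact (hi1.const_mul _).neg.add (hi2.const_mul _)

/-! ## Second moments given a sign event -/

/-- The second moments of the field conditioned on `K`. -/
def corr (J : Finset (ℤ × ℤ)) (b : ℤ × ℤ → ℝ) (K : Set (J → ℝ)) (v u : ℤ × ℤ) : ℝ :=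
  ∫ x, ext J b x u * ext J b x v ∂(law J b K)

lemma integrable_law_mul {J : Finset (ℤ × ℤ)} {b : ℤ × ℤ → ℝ} {K : Set (J → ℝ)}
    {f g : (J → ℝ) → ℝ} (hf : MemLp f 2 (fieldMeasure J b)) (hg : MemLp g 2 (fieldMeasure J b)) :
    Integrable (fun x => f x * g x) (law J b K) :=
  (memLp_law hf).integrable_mul (memLp_law hg)

lemma corr_comm (J : Finset (ℤ × ℤ)) (b : ℤ × ℤ → ℝ) (K : Set (J → ℝ)) (v u : ℤ × ℤ) :
    corr J b K v u = corr J b K u v := by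
  simp only [corr, mul_comm]

lemma corr_le (J : Finset (ℤ × ℤ)) (b : ℤ × ℤ → ℝ) (K : Set (J → ℝ)) (v u : ℤ × ℤ) :
    |corr J b K v u| ≤ (corr J b K v v + corr J b K u u) / 2 := by
  have hi := fun v u => integrable_law_mul (K := K) (memLp_ext J b u) (memLp_ext J b v)
  have hs : (corr J b K v v + corr J b K u u) / 2 =
      ∫ x, (ext J b x v * ext J b x v + ext J b x u * ext J b x u) / 2 ∂(law J b K) := by
    rw [integral_div, integral_add (hi v v) (hi u u)]; rfl
  rw [hs]
  refine (abs_integral_le_integral_abs).trans (integral_mono (hi v u).abs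
    (((hi v v).add (hi u u)).div_const 2) fun x => ?_)
  simp only [abs_mul]
  have := sq_nonneg (|ext J b x u| - |ext J b x v|)
  have h1 := abs_mul_abs_self (ext J b x u)
  have h2 := abs_mul_abs_self (ext J b x v)
  linarith

/-- The Laplacian commutes with expectations. -/
lemma lap_integral_mul (J : Finset (ℤ × ℤ)) (b : ℤ × ℤ → ℝ) (K : Set (J → ℝ))
    {g : (J → ℝ) → ℝ} (hg : MemLp g 2 (fieldMeasure J b)) (u : ℤ × ℤ) :
    lap (fun z => ∫ x, ext J b x z * g x ∂(law J b K)) u =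
      ∫ x, lap (ext J b x) u * g x ∂(law J b K) := by
  have hi := fun u => integrable_law_mul (K := K) (memLp_ext J b u) hg
  simp only [lap, Finset.sum_mul, sub_mul]
  refine Eq.trans ?_ (integral_finsetSum _ fun i _ => (hi (u + step i)).sub (hi u)).symm
  exact Finset.sum_congr rfl fun i _ => (integral_sub (hi _) (hi _)).symm

/-- Harmonic extension commutes with expectations. -/
lemma harm_integral_mul (J : Finset (ℤ × ℤ)) (b : ℤ × ℤ → ℝ) (K : Set (J → ℝ))
    {g : (J → ℝ) → ℝ} (hg : MemLp g 2 (fieldMeasure J b)) (I : Finset (ℤ × ℤ)) (u : ℤ × ℤ) :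
    harm I (fun z => ∫ x, ext J b x z * g x ∂(law J b K)) u =
      ∫ x, harm I (ext J b x) u * g x ∂(law J b K) := by
  have hi := fun u => integrable_law_mul (K := K) (memLp_ext J b u) hg
  have hl := fun u => integrable_law_mul (K := K) (memLp_lap J b u) hg
  simp only [harm, lap_integral_mul J b K hg]
  have : ∀ x, (ext J b x u + ∑ y ∈ I, lap (ext J b x) y * green I y u) * g x =
      ext J b x u * g x + ∑ y ∈ I, lap (ext J b x) y * g x * green I y u := by
    intro x
    rw [add_mul, Finset.sum_mul]
    congr 1
    exact Finset.sum_congr rfl fun y _ => by ring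
  simp only [this]
  rw [integral_add (hi u) (integrable_finsetSum _ fun y _ => (hl y).mul_const _),
    integral_finsetSum _ fun y _ => (hl y).mul_const _]
  simp only [integral_mul_const]

/-- Conditioning on signs leaves the Green's function equation intact at unconstrained vertices: the
case u ≠ v is integration by parts, the case u = v is rescaling. -/
lemma lap_corr {J : Finset (ℤ × ℤ)} {b : ℤ × ℤ → ℝ} {P M : Set (ℤ × ℤ)}
    (hPM : Disjoint P M) {u : ℤ × ℤ} (hu : u ∈ J) (huP : u ∉ P) (huM : u ∉ M) (v : ℤ × ℤ) :
    lap (corr J b (signs J P M) v) u = if u = v then -1 else 0 := by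
  have h1 := lap_integral_mul J b (signs J P M) (memLp_ext J b v) u
  have h2 : ∀ x : J → ℝ, lap (ext J b x) u * ext J b x v = ext J b x v * lap (ext J b x) u :=
    fun x => mul_comm _ _
  change lap (fun z => ∫ x, ext J b x z * ext J b x v ∂(law J b (signs J P M))) u = _
  rw [h1]
  simp only [h2]
  split_ifs with h
  · subst h
    exact integral_self_mul_lap hPM hu
  · refine integral_mul_lap_eq_zero hPM hu huP huM _ (continuous_ext J b v).measurable
      (memLp_ext J b v) fun x x' hx => ?_
    by_cases hv : v ∈ J
    · rw [ext_of_mem _ _ hv, ext_of_mem _ _ hv]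
      exact hx ⟨v, hv⟩ fun h' => h h'.symm
    · rw [ext_of_notMem _ _ hv, ext_of_notMem _ _ hv]

lemma lap_corr_self {J : Finset (ℤ × ℤ)} {b : ℤ × ℤ → ℝ} {P M : Set (ℤ × ℤ)}
    (hPM : Disjoint P M) {u : ℤ × ℤ} (hu : u ∈ J) :
    lap (corr J b (signs J P M) u) u = -1 := by
  have h1 := lap_integral_mul J b (signs J P M) (memLp_ext J b u) u
  have h2 : ∀ x : J → ℝ, lap (ext J b x) u * ext J b x u = ext J b x u * lap (ext J b x) u :=
    fun x => mul_comm _ _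
  change lap (fun z => ∫ x, ext J b x z * ext J b x u ∂(law J b (signs J P M))) u = _
  rw [h1]
  simp only [h2]
  exact integral_self_mul_lap hPM hu

lemma corr_nonpos {J : Finset (ℤ × ℤ)} {b : ℤ × ℤ → ℝ} {P M : Set (ℤ × ℤ)}
    {v w : ℤ × ℤ} (hv : v ∈ J) (hw : w ∈ J) (hvw : v ∈ P ∧ w ∈ M ∨ v ∈ M ∧ w ∈ P) :
    corr J b (signs J P M) v w ≤ 0 := by
  refine integral_nonpos_of_ae ?_
  filter_upwards [ProbabilityTheory.ae_cond_mem (μ := fieldMeasure J b)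
    (measurableSet_signs J P M)] with x hx
  rw [ext_of_mem _ _ hv, ext_of_mem _ _ hw]
  rcases hvw with ⟨h1, h2⟩ | ⟨h1, h2⟩
  · exact (mul_neg_of_neg_of_pos (hx.2 ⟨w, hw⟩ h2) (hx.1 ⟨v, hv⟩ h1)).le
  · exact (mul_neg_of_pos_of_neg (hx.1 ⟨w, hw⟩ h2) (hx.2 ⟨v, hv⟩ h1)).le

/-! ### Moments along the interface and their comparison with Green's function. -/

/-- The vertices of `P` and `M` have neighbors of the opposite sign. -/
def Interface (P M : Set (ℤ × ℤ)) : Prop :=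
  (∀ v ∈ P, ∃ w ∈ M, TG.Adj v w) ∧ ∀ v ∈ M, ∃ w ∈ P, TG.Adj v w

open Classical in
/-- The field is of order one along the interface. -/
lemma corr_self_le {J : Finset (ℤ × ℤ)} {b : ℤ × ℤ → ℝ} {P M : Set (ℤ × ℤ)} {Λ : ℝ}
    (hPM : Disjoint P M) (hP : ∀ v ∈ P, v ∈ J) (hM : ∀ v ∈ M, v ∈ J) (hI : Interface P M)
    (hb : ∀ z, |b z| ≤ Λ) {v : ℤ × ℤ} (hv : v ∉ J ∨ v ∈ P ∨ v ∈ M) :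
    corr J b (signs J P M) v v ≤ max 1 (Λ ^ 2) := by
  have := isProbabilityMeasure_law (fieldMeasure_signs_ne_zero J b hPM)
  have hout : ∀ z ∉ J, corr J b (signs J P M) z z ≤ Λ ^ 2 := by
    intro z hz
    simp only [corr, ext_of_notMem _ _ hz]
    simp only [integral_const, probReal_univ, one_smul]
    rw [← sq]
    exact sq_le_sq' (by linarith [abs_le.1 (hb z)]) (abs_le.1 (hb z)).2
  set q := max 1 (Λ ^ 2)
  by_cases hvJ : v ∈ J
  swap
  · exact (hout v hvJ).trans (le_max_right _ _)
  have hvS : v ∈ J.filter fun z => z ∈ P ∨ z ∈ M := by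
    rw [Finset.mem_filter]
    exact ⟨hvJ, hv.resolve_left fun h => h hvJ⟩
  obtain ⟨m, hm, hmax⟩ := Finset.exists_max_image (J.filter fun z => z ∈ P ∨ z ∈ M)
    (fun z => corr J b (signs J P M) z z) ⟨v, hvS⟩
  refine (hmax v hvS).trans ?_
  -- Let Q be the second moment at the worst constrained vertex `m`, and suppose that it is too
  -- large. By the maximum principle `corr m` is at most Q everywhere, and it is nonpositive at a
  -- neighbor of opposite sign. As its Laplacian at `m` is -1, it follows that -1 ≤ 5Q - 6Q.
  by_contra! hlt
  rw [Finset.mem_filter] at hm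
  set Q := corr J b (signs J P M) m m with hQ
  have hoff : ∀ z ∉ J.filter (fun z => ¬ (z ∈ P ∨ z ∈ M)), corr J b (signs J P M) z z ≤ Q := by
    intro z hz
    by_cases hzJ : z ∈ J
    · refine hmax z (Finset.mem_filter.2 ⟨hzJ, ?_⟩)
      by_contra h
      exact hz (Finset.mem_filter.2 ⟨hzJ, h⟩)
    · exact (hout z hzJ).trans ((le_max_right _ _).trans hlt.le)
  have hall : ∀ z, corr J b (signs J P M) m z ≤ Q := by
    refine le_of_subharmonic (J.filter fun z => ¬ (z ∈ P ∨ z ∈ M)) _ Q (fun z hz => ?_)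
      fun z hz => ?_
    · rw [Finset.mem_filter, not_or] at hz
      rw [lap_corr hPM hz.1 hz.2.1 hz.2.2, if_neg]
      rintro rfl
      exact not_or.2 hz.2 hm.2
    · have h1 := (le_abs_self _).trans (corr_le J b (signs J P M) m z)
      have h2 := hoff z hz
      linarith
  have hnb : ∃ i, corr J b (signs J P M) m (m + step i) ≤ 0 := by
    rcases hm.2 with h | h
    · obtain ⟨w, hw, hadj⟩ := hI.1 m h
      obtain ⟨i, rfl⟩ := (adj_iff _ _).1 hadj
      exact ⟨i, corr_nonpos hm.1 (hM _ hw) (.inl ⟨h, hw⟩)⟩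
    · obtain ⟨w, hw, hadj⟩ := hI.2 m h
      obtain ⟨i, rfl⟩ := (adj_iff _ _).1 hadj
      exact ⟨i, corr_nonpos hm.1 (hP _ hw) (.inr ⟨h, hw⟩)⟩
  obtain ⟨i, hi⟩ := hnb
  have hlap := lap_corr_self (b := b) hPM hm.1
  rw [lap_eq, ← Finset.add_sum_erase _ _ (Finset.mem_univ i), ← hQ] at hlap
  have hsum : ∑ j ∈ Finset.univ.erase i, corr J b (signs J P M) m (m + step j) ≤ 5 * Q := by
    refine (Finset.sum_le_card_nsmul _ _ Q fun j _ => hall _).trans ?_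
    rw [Finset.card_erase_of_mem (Finset.mem_univ i)]
    simp
  have : Q ≤ 1 := by linarith
  have := le_max_left 1 (Λ ^ 2)
  linarith

open Classical in
/-- The unconstrained vertices of `J`. -/
def free (J : Finset (ℤ × ℤ)) (P M : Set (ℤ × ℤ)) : Finset (ℤ × ℤ) :=
  J.filter fun z => ¬ (z ∈ P ∨ z ∈ M)

lemma mem_free {J : Finset (ℤ × ℤ)} {P M : Set (ℤ × ℤ)} {z : ℤ × ℤ} :
    z ∈ free J P M ↔ z ∈ J ∧ z ∉ P ∧ z ∉ M := by simp [free]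

lemma notMem_free {J : Finset (ℤ × ℤ)} {P M : Set (ℤ × ℤ)} {z : ℤ × ℤ} :
    z ∉ free J P M ↔ (z ∉ J ∨ z ∈ P ∨ z ∈ M) := by
  rw [mem_free]; tauto

/-- The maximum principle is used twice. For constrained `v` the correlation is harmonic on the free
vertices and bounded by q off them; for free `v` the extra Laplacian -1 at the pole is matched by
Green's function. -/
lemma corr_le_green {J : Finset (ℤ × ℤ)} {b : ℤ × ℤ → ℝ} {P M : Set (ℤ × ℤ)} {Λ : ℝ}
    (hPM : Disjoint P M) (hP : ∀ v ∈ P, v ∈ J) (hM : ∀ v ∈ M, v ∈ J) (hI : Interface P M)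
    (hb : ∀ z, |b z| ≤ Λ) (v u : ℤ × ℤ) :
    corr J b (signs J P M) v u ≤ max 1 (Λ ^ 2) + green (free J P M) v u := by
  set q := max 1 (Λ ^ 2)
  have hfix : ∀ z ∉ free J P M, corr J b (signs J P M) z z ≤ q := fun z hz =>
    corr_self_le hPM hP hM hI hb (notMem_free.1 hz)
  have h0 : ∀ v ∉ free J P M, ∀ u, corr J b (signs J P M) v u ≤ q := by
    intro v hv
    refine le_of_subharmonic (free J P M) _ q (fun z hz => ?_) fun z hz => ?_
    · have hz' := mem_free.1 hz
      rw [lap_corr hPM hz'.1 hz'.2.1 hz'.2.2, if_neg (by rintro rfl; exact hv hz)]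
    · have h1 := (le_abs_self _).trans (corr_le J b (signs J P M) v z)
      linarith [hfix v hv, hfix z hz]
  refine le_of_lap_le (free J P M) _ (fun u => q + green (free J P M) v u) (fun z hz => ?_)
    (fun z hz => ?_) u
  · have hz' := mem_free.1 hz
    rw [lap_corr hPM hz'.1 hz'.2.1 hz'.2.2, lap_add, lap_const, lap_green v hz, zero_add]
  · rw [green_of_notMem v hz, add_zero, corr_comm]
    exact h0 z hz v

/-- The harmonic extension of the field has bounded second moments when Green's function from the
outside is bounded. -/
lemma integral_harm_sq_le {J : Finset (ℤ × ℤ)} {b : ℤ × ℤ → ℝ} {P M : Set (ℤ × ℤ)} {Λ : ℝ}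
    (hPM : Disjoint P M) (hP : ∀ v ∈ P, v ∈ J) (hM : ∀ v ∈ M, v ∈ J) (hI : Interface P M)
    (hb : ∀ z, |b z| ≤ Λ) {B B' Ω : Finset (ℤ × ℤ)} (hB' : B' ⊆ B) (hBΩ : B ⊆ Ω)
    (hΩ : free J P M ⊆ Ω) (hBB : ∀ z ∈ B, z ∉ B' → z ∈ P ∨ z ∈ M) {x : ℤ × ℤ} {m : ℝ} (hm0 : 0 ≤ m)
    (hm : ∀ v ∉ B, green Ω v x ≤ m) :
    ∫ ω, harm B' (ext J b ω) x ^ 2 ∂(law J b (signs J P M)) ≤ max 1 (Λ ^ 2) + m := by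
  set q := max 1 (Λ ^ 2)
  simp only [sq]
  -- The second moment is the harmonic extension of the correlation in both variables. It suffices
  -- to bound the extension in one variable, with the other at a vertex `v` off `B'`.
  rw [← harm_integral_mul J b _ (memLp_harm J b B' x)]
  refine harm_le_const (fun v hv => ?_) x
  have h1 : (∫ ω, ext J b ω v * harm B' (ext J b ω) x ∂(law J b (signs J P M))) =
      harm B' (corr J b (signs J P M) v) x := by
    simp_rw [mul_comm (ext J b _ v)]
    exact (harm_integral_mul J b _ (memLp_ext J b v) B' x).symm
  rw [h1]
  have h2 : harm B' (corr J b (signs J P M) v) x ≤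
      harm B' (fun u => q + green (free J P M) v u) x :=
    harm_mono (fun z _ => corr_le_green hPM hP hM hI hb v z) x
  refine h2.trans ?_
  rw [harm_add, harm_eq_of_harmonic fun z _ => lap_const _ z]
  gcongr
  -- If `v` lies in `B` but not in `B'` it is constrained, and Green's function with that pole
  -- vanishes. If `v` lies off `B`, Green's function of `Ω` is harmonic on `B'`, hence its own
  -- extension.
  by_cases hvB : v ∈ B
  · have hv0 : ∀ z, green (free J P M) v z = 0 :=
      green_pole_notMem (notMem_free.2 (.inr (hBB v hvB hv)))
    exact harm_le_const (fun z _ => by rw [hv0]; exact hm0) x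
  · have h3 : harm B' (green (free J P M) v) x ≤ harm B' (green Ω v) x :=
      harm_mono (fun z _ => green_mono hΩ v z) x
    rw [harm_eq_of_harmonic (f := green Ω v) fun z hz => ?_] at h3
    · exact h3.trans (hm v hvB)
    · rw [lap_green v (hBΩ (hB' hz)), if_neg]
      rintro rfl
      exact hv hz

/-- The expectation of the field is of order one when the boundary values vanish. -/
lemma abs_integral_ext_le {J : Finset (ℤ × ℤ)} {P M : Set (ℤ × ℤ)}
    (hPM : Disjoint P M) (hP : ∀ v ∈ P, v ∈ J) (hM : ∀ v ∈ M, v ∈ J) (hI : Interface P M)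
    (z : ℤ × ℤ) :
    |∫ ω, ext J (fun _ => 0) ω z ∂(law J (fun _ => 0) (signs J P M))| ≤ 1 := by
  have := isProbabilityMeasure_law (fieldMeasure_signs_ne_zero J (fun _ => 0) hPM)
  refine abs_le_of_harmonic (free J P M)
    (fun z => ∫ ω, ext J (fun _ => 0) ω z ∂(law J (fun _ => 0) (signs J P M))) 1
    (fun u hu => ?_) (fun u hu => ?_) z
  · have hu' := mem_free.1 hu
    have h1 := lap_integral_mul J (fun _ => 0) (signs J P M) (memLp_const 1) u
    simp only [mul_one] at h1
    rw [h1]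
    simpa using integral_mul_lap_eq_zero hPM hu'.1 hu'.2.1 hu'.2.2 (fun _ => 1) measurable_const
      (memLp_const 1) fun _ _ _ => rfl
  · have h1 := corr_self_le (b := fun _ => 0) (Λ := 0) hPM hP hM hI (by simp) (notMem_free.1 hu)
    norm_num at h1
    have hi := integrable_law_mul (K := signs J P M) (memLp_ext J (fun _ => 0) u)
      (memLp_ext J (fun _ => 0) u)
    have hi1 : Integrable (fun x => ext J (fun _ => 0) x u) (law J (fun _ => 0) (signs J P M)) :=
      (memLp_law (memLp_ext J (fun _ => 0) u)).integrable (by norm_num)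
    refine abs_integral_le_integral_abs.trans ?_
    have h2 : ∫ x, |ext J (fun _ => 0) x u| ∂(law J (fun _ => 0) (signs J P M)) ≤
        ∫ x, (ext J (fun _ => 0) x u * ext J (fun _ => 0) x u + 1) / 2
          ∂(law J (fun _ => 0) (signs J P M)) := by
      refine integral_mono hi1.abs ((hi.add (integrable_const 1)).div_const 2) fun x => ?_
      have h3 := sq_nonneg (|ext J (fun _ => 0) x u| - 1)
      have h4 := abs_mul_abs_self (ext J (fun _ => 0) x u)
      simp only
      linarith
    refine h2.trans ?_
    rw [integral_div, integral_add hi (integrable_const 1)]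
    simp only [integral_const, probReal_univ, one_smul]
    change (corr J (fun _ => 0) (signs J P M) u u + 1) / 2 ≤ 1
    linarith

/-! ## The domain Markov property -/

lemma measurePreserving_split (J B O : Finset (ℤ × ℤ)) (hd : Disjoint B O) (hJ : B ∪ O = J) :
    MeasurePreserving (fun x : J → ℝ => ((fun z : B => ext J (fun _ => 0) x z,
      fun z : O => ext J (fun _ => 0) x z) : (B → ℝ) × (O → ℝ)))
      volume (volume.prod volume) := by
  subst hJ
  have h := (volume_preserving_piFinsetUnion (fun _ : ℤ × ℤ => ℝ) hd).symm
  refine (congrArg (fun f => MeasurePreserving f volume (volume.prod volume)) ?_).mp h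
  funext x
  rw [MeasurableEquiv.symm_apply_eq]
  funext ⟨z, hz⟩
  rcases Finset.mem_union.1 hz with h | h
  · refine Eq.trans ?_ (Equiv.piFinsetUnion_left (fun _ : ℤ × ℤ => ℝ) hd h hz).symm
    rw [ext_of_mem]
  · refine Eq.trans ?_ (Equiv.piFinsetUnion_right (fun _ : ℤ × ℤ => ℝ) hd h hz).symm
    rw [ext_of_mem]

/-- The field minus the harmonic extension of its values outside `B`, and the field outside. -/
def decouple (J : Finset (ℤ × ℤ)) (b : ℤ × ℤ → ℝ) (B : Finset (ℤ × ℤ)) (x : J → ℝ) :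
    (B → ℝ) × (↥(J \ B) → ℝ) :=
  (fun z => ext J b x z - harm B (ext J b x) z, fun z => ext J b x z)

lemma continuous_harm (J : Finset (ℤ × ℤ)) (b : ℤ × ℤ → ℝ) (I : Finset (ℤ × ℤ)) (z : ℤ × ℤ) :
    Continuous fun x : J → ℝ => harm I (ext J b x) z := by
  have h1 := continuous_ext J b
  unfold harm lap
  fun_prop (disch := exact h1 _)

lemma continuous_decouple (J : Finset (ℤ × ℤ)) (b : ℤ × ℤ → ℝ) (B : Finset (ℤ × ℤ)) :
    Continuous (decouple J b B) := by
  refine (continuous_pi fun z => ?_).prodMk (continuous_pi fun z => continuous_ext J b z)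
  exact (continuous_ext J b z).sub (continuous_harm J b B z)

lemma harm_ext_congr {J : Finset (ℤ × ℤ)} (b : ℤ × ℤ → ℝ) (B : Finset (ℤ × ℤ)) {x x' : J → ℝ}
    (h : ∀ j : J, j.1 ∉ B → x j = x' j) (z : ℤ × ℤ) :
    harm B (ext J b x) z = harm B (ext J b x') z := by
  refine harm_congr (fun w hw => ?_) z
  by_cases hJ : w ∈ J
  · rw [ext_of_mem _ _ hJ, ext_of_mem _ _ hJ]; exact h ⟨w, hJ⟩ hw
  · rw [ext_of_notMem _ _ hJ, ext_of_notMem _ _ hJ]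

lemma harm_ext_outside {J B : Finset (ℤ × ℤ)} (b : ℤ × ℤ → ℝ) (x : J → ℝ) (z : ℤ × ℤ) :
    harm B (ext (J \ B) b (decouple J b B x).2) z = harm B (ext J b x) z := by
  refine harm_congr (fun w hw => ?_) z
  by_cases hJ : w ∈ J
  · rw [ext_of_mem _ _ (Finset.mem_sdiff.2 ⟨hJ, hw⟩)]; rfl
  · rw [ext_of_notMem _ _ hJ, ext_of_notMem _ _ fun h => hJ (Finset.mem_sdiff.1 h).1]

lemma ext_inside {J B : Finset (ℤ × ℤ)} (b : ℤ × ℤ → ℝ) (x : J → ℝ) (z : ℤ × ℤ) :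
    ext B (fun _ => 0) (decouple J b B x).1 z = ext J b x z - harm B (ext J b x) z := by
  by_cases h : z ∈ B
  · rw [ext_of_mem _ _ h]; rfl
  · rw [ext_of_notMem _ _ h, harm_of_notMem _ h, sub_self]

lemma measurePreserving_decouple {J B : Finset (ℤ × ℤ)} (hB : B ⊆ J) (b : ℤ × ℤ → ℝ) :
    MeasurePreserving (decouple J b B) volume (volume.prod volume) := by
  have h1 : MeasurePreserving (shear B fun (x : J → ℝ) z => -harm B (ext J b x) z) volume volume :=
    measurePreserving_shear B _ (fun z => (continuous_harm J b B z).neg.measurable)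
      fun x x' h => funext fun z => by rw [harm_ext_congr b B h]
  have h2 := (measurePreserving_split J B (J \ B) Finset.disjoint_sdiff
    (Finset.union_sdiff_of_subset hB)).comp h1
  refine (congrArg (fun f => MeasurePreserving f volume (volume.prod volume)) ?_).mp h2
  funext x
  refine Prod.ext (funext fun z => ?_) (funext fun z => ?_)
  · simp [decouple, ext_of_mem _ _ (hB z.2), shear, sub_eq_add_neg]
  · have hz := Finset.mem_sdiff.1 z.2
    simp [decouple, ext_of_mem _ _ hz.1, shear, hz.2]

/-- The energy of the harmonic part of the field. -/
def outerAction (J : Finset (ℤ × ℤ)) (b : ℤ × ℤ → ℝ) (B : Finset (ℤ × ℤ))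
    (y : ↥(J \ B) → ℝ) : ℝ :=
  action J b fun z => harm B (ext (J \ B) b y) z

/-- The difference of the field and its harmonic part vanishes off `B`, and the harmonic part is
harmonic on `B`, so the cross term of the energy is zero. -/
lemma action_eq_add {J B : Finset (ℤ × ℤ)} (hB : B ⊆ J) (b : ℤ × ℤ → ℝ) (x : J → ℝ) :
    action J b x = action B (fun _ => 0) (decouple J b B x).1 +
      outerAction J b B (decouple J b B x).2 := by
  set κ : ℤ × ℤ → ℝ := fun z => ext J b x z - harm B (ext J b x) z with hκ
  have hκB : ∀ z ∉ B, κ z = 0 := fun z hz => by simp [hκ, harm_of_notMem _ hz]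
  have e1 : ext B (fun _ => 0) (decouple J b B x).1 = κ := funext fun z => ext_inside b x z
  have e2 : action B (fun _ => 0) (decouple J b B x).1 = (1 / 2) * form B κ κ := by
    rw [action, e1]
    have : ext B (fun _ => 0) (fun _ : B => (0 : ℝ)) = fun _ => 0 := by
      ext z; by_cases h : z ∈ B <;> simp [TriGrid.ext, h]
    rw [this]
    simp [form, lap_const]
  have e3 : outerAction J b B (decouple J b B x).2 =
      action J b fun z => harm B (ext J b x) z := by
    simp only [outerAction, harm_ext_outside]
  have e4 := action_sub J b (fun z => harm B (ext J b x) z) x κ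
    (fun z hz => hκB z fun h => hz (hB h)) (fun z => by simp [hκ])
  have e5 : ext J b (fun z : J => harm B (ext J b x) z) = harm B (ext J b x) := by
    ext z
    by_cases h : z ∈ J
    · rw [ext_of_mem _ _ h]
    · rw [ext_of_notMem _ _ h, harm_of_notMem _ fun h' => h (hB h'), ext_of_notMem _ _ h]
  rw [e5, ← form_superset hB hκB, ← form_superset hB hκB] at e4
  have e6 : form B κ (harm B (ext J b x)) = 0 := by
    rw [form, neg_eq_zero]
    exact Finset.sum_eq_zero fun z hz => by rw [lap_harm _ hz, mul_zero]
  rw [e6] at e4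
  rw [e2, e3]
  linarith

/-- The law of the field outside `B`, unnormalized. -/
def outerMeasure (J : Finset (ℤ × ℤ)) (b : ℤ × ℤ → ℝ) (B : Finset (ℤ × ℤ)) :
    Measure (↥(J \ B) → ℝ) :=
  volume.withDensity fun y => ENNReal.ofReal (Real.exp (-outerAction J b B y))

instance (J : Finset (ℤ × ℤ)) (b : ℤ × ℤ → ℝ) (B : Finset (ℤ × ℤ)) :
    SFinite (outerMeasure J b B) := by
  unfold outerMeasure; infer_instance

lemma continuous_outerAction (J : Finset (ℤ × ℤ)) (b : ℤ × ℤ → ℝ) (B : Finset (ℤ × ℤ)) :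
    Continuous (outerAction J b B) :=
  (continuous_action J b).comp (continuous_pi fun z => continuous_harm _ b B z)

/-- The domain Markov property: volume is preserved and the action is a sum, so the measure
factorizes. -/
lemma map_decouple {J B : Finset (ℤ × ℤ)} (hB : B ⊆ J) (b : ℤ × ℤ → ℝ) :
    (fieldMeasure J b).map (decouple J b B) =
      (fieldMeasure B fun _ => 0).prod (outerMeasure J b B) := by
  have hm := continuous_decouple J b B
  have h1 := continuous_action B fun _ => 0
  have h2 := continuous_outerAction J b B
  have hw1 : Measurable fun x => ENNReal.ofReal (Real.exp (-action B (fun _ => 0) x)) := by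
    have : Continuous fun x => Real.exp (-action B (fun _ => 0) x) := by fun_prop
    exact this.measurable.ennreal_ofReal
  have hw2 : Measurable fun x => ENNReal.ofReal (Real.exp (-outerAction J b B x)) := by
    have : Continuous fun x => Real.exp (-outerAction J b B x) := by fun_prop
    exact this.measurable.ennreal_ofReal
  rw [outerMeasure, fieldMeasure.eq_1 B, prod_withDensity hw1 hw2,
    ← (measurePreserving_decouple hB b).map_eq]
  ext s hs
  rw [Measure.map_apply hm.measurable hs, fieldMeasure,
    withDensity_apply _ (hm.measurable hs), withDensity_apply _ hs]
  refine Eq.trans ?_ (setLIntegral_map hs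
    ((hw1.comp measurable_fst).mul (hw2.comp measurable_snd)) hm.measurable).symm
  refine lintegral_congr fun x => ?_
  rw [action_eq_add hB b x, neg_add, Real.exp_add, ENNReal.ofReal_mul (Real.exp_pos _).le]
  rfl

/-- The event that the field in `B`, minus its harmonic part, has the signs `P₁`, `M₁`, and the
field outside has the signs `P₃`, `M₃`. -/
def decoupledEvent (J : Finset (ℤ × ℤ)) (b : ℤ × ℤ → ℝ) (B : Finset (ℤ × ℤ))
    (P₁ M₁ P₃ M₃ : Set (ℤ × ℤ)) : Set (J → ℝ) :=
  decouple J b B ⁻¹' (signs B P₁ M₁ ×ˢ signs (J \ B) P₃ M₃)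

lemma measurableSet_decoupledEvent (J : Finset (ℤ × ℤ)) (b : ℤ × ℤ → ℝ) (B : Finset (ℤ × ℤ))
    (P₁ M₁ P₃ M₃ : Set (ℤ × ℤ)) : MeasurableSet (decoupledEvent J b B P₁ M₁ P₃ M₃) :=
  (continuous_decouple J b B).measurable
    ((measurableSet_signs _ _ _).prod (measurableSet_signs _ _ _))

/-- With no signs prescribed inside, the decoupled event is the outer event, so one product formula
serves for both. -/
lemma signs_eq_decouple {J B : Finset (ℤ × ℤ)} (b : ℤ × ℤ → ℝ) {P₃ M₃ : Set (ℤ × ℤ)}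
    (hP : ∀ v ∈ P₃, v ∉ B) (hM : ∀ v ∈ M₃, v ∉ B) :
    signs J P₃ M₃ = decoupledEvent J b B ∅ ∅ P₃ M₃ := by
  ext x
  have h0 : ∀ y : B → ℝ, y ∈ signs B ∅ ∅ := fun y => ⟨by simp, by simp⟩
  simp only [decoupledEvent, Set.mem_preimage, Set.mem_prod, h0, true_and]
  refine and_congr ⟨fun h v hv => ?_, fun h v hv => ?_⟩ ⟨fun h v hv => ?_, fun h v hv => ?_⟩
  · have hz := Finset.mem_sdiff.1 v.2
    simpa [decouple, ext_of_mem _ _ hz.1] using h ⟨v, hz.1⟩ hv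
  · simpa [decouple] using h ⟨v, Finset.mem_sdiff.2 ⟨v.2, hP _ hv⟩⟩ hv
  · have hz := Finset.mem_sdiff.1 v.2
    simpa [decouple, ext_of_mem _ _ hz.1] using h ⟨v, hz.1⟩ hv
  · simpa [decouple] using h ⟨v, Finset.mem_sdiff.2 ⟨v.2, hM _ hv⟩⟩ hv

lemma setIntegral_decoupled {J B : Finset (ℤ × ℤ)} (hB : B ⊆ J) (b : ℤ × ℤ → ℝ)
    (P₁ M₁ P₃ M₃ : Set (ℤ × ℤ)) {f : (B → ℝ) → ℝ} {g : (↥(J \ B) → ℝ) → ℝ}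
    (hf : Continuous f) (hg : Continuous g) :
    ∫ x in decoupledEvent J b B P₁ M₁ P₃ M₃,
        f (decouple J b B x).1 * g (decouple J b B x).2 ∂(fieldMeasure J b) =
      (∫ y in signs B P₁ M₁, f y ∂(fieldMeasure B fun _ => 0)) *
        ∫ y in signs (J \ B) P₃ M₃, g y ∂(outerMeasure J b B) := by
  rw [← setIntegral_prod_mul, ← map_decouple hB b, setIntegral_map]
  · rfl
  · exact (measurableSet_signs _ _ _).prod (measurableSet_signs _ _ _)
  · exact ((hf.comp continuous_fst).mul (hg.comp continuous_snd)).aestronglyMeasurable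
  · exact (continuous_decouple J b B).aemeasurable

lemma measureReal_decoupled {J B : Finset (ℤ × ℤ)} (hB : B ⊆ J) (b : ℤ × ℤ → ℝ)
    (P₁ M₁ P₃ M₃ : Set (ℤ × ℤ)) :
    (fieldMeasure J b).real (decoupledEvent J b B P₁ M₁ P₃ M₃) =
      (fieldMeasure B fun _ => 0).real (signs B P₁ M₁) *
        (outerMeasure J b B).real (signs (J \ B) P₃ M₃) := by
  simpa using setIntegral_decoupled hB b P₁ M₁ P₃ M₃ (f := fun _ => 1) (g := fun _ => 1)
    continuous_const continuous_const

lemma signs_empty (J : Finset (ℤ × ℤ)) : signs J ∅ ∅ = Set.univ := by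
  ext x; simp [signs]

/-- The exact independence behind the proposition, cleared of denominators: given the outer signs,
the decoupled event has the probability of the inner signs for the zero-boundary field on `B`. -/
lemma measureReal_decoupled_mul {J B : Finset (ℤ × ℤ)} (hB : B ⊆ J) (b : ℤ × ℤ → ℝ)
    (P₁ M₁ : Set (ℤ × ℤ)) {P₃ M₃ : Set (ℤ × ℤ)} (hP : ∀ v ∈ P₃, v ∉ B) (hM : ∀ v ∈ M₃, v ∉ B) :
    (fieldMeasure J b).real (decoupledEvent J b B P₁ M₁ P₃ M₃) *
        (fieldMeasure B fun _ => 0).real Set.univ =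
      (fieldMeasure J b).real (signs J P₃ M₃) *
        (fieldMeasure B fun _ => 0).real (signs B P₁ M₁) := by
  rw [signs_eq_decouple b hP hM, measureReal_decoupled hB, measureReal_decoupled hB, signs_empty]
  ring

/-- Given the decoupled event, the field in `B` minus its harmonic part is independent of the
field outside. -/
lemma integral_decoupled {J B : Finset (ℤ × ℤ)} (hB : B ⊆ J) (b : ℤ × ℤ → ℝ)
    {P₁ M₁ P₃ M₃ : Set (ℤ × ℤ)} (h₁ : Disjoint P₁ M₁) (h₃ : Disjoint P₃ M₃)
    (hP : ∀ v ∈ P₃, v ∉ B) (hM : ∀ v ∈ M₃, v ∉ B)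
    {f : (B → ℝ) → ℝ} {g : (↥(J \ B) → ℝ) → ℝ} (hf : Continuous f) (hg : Continuous g) :
    ∫ x, f (decouple J b B x).1 * g (decouple J b B x).2
        ∂(law J b (decoupledEvent J b B P₁ M₁ P₃ M₃)) =
      (∫ y, f y ∂(law B (fun _ => 0) (signs B P₁ M₁))) *
        ∫ x, g (decouple J b B x).2 ∂(law J b (signs J P₃ M₃)) := by
  have hZ1 : (fieldMeasure B fun _ => 0).real (signs B P₁ M₁) ≠ 0 :=
    (ENNReal.toReal_pos (fieldMeasure_signs_ne_zero B _ h₁) (measure_ne_top _ _)).ne'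
  have hZ0 : (fieldMeasure B fun _ => 0).real (signs B ∅ ∅) ≠ 0 :=
    (ENNReal.toReal_pos (fieldMeasure_signs_ne_zero B _ (by simp)) (measure_ne_top _ _)).ne'
  have hZ3 : (fieldMeasure J b).real (signs J P₃ M₃) ≠ 0 :=
    (ENNReal.toReal_pos (fieldMeasure_signs_ne_zero J _ h₃) (measure_ne_top _ _)).ne'
  have e3 := setIntegral_decoupled hB b ∅ ∅ P₃ M₃ (f := fun _ => 1) continuous_const hg
  simp only [one_mul] at e3
  rw [signs_eq_decouple (J := J) b hP hM, measureReal_decoupled hB] at hZ3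
  rw [integral_law, integral_law, integral_law, setIntegral_decoupled hB b P₁ M₁ P₃ M₃ hf hg,
    signs_eq_decouple (J := J) b hP hM, e3, measureReal_decoupled hB, measureReal_decoupled hB]
  -- That the outer mass is a genuine nonzero number, rather than the default 0 of an infinite one,
  -- is read off from the nonzero product.
  have hρ := right_ne_zero_of_mul hZ3
  simp only [setIntegral_const, smul_eq_mul, mul_one]
  field_simp

lemma decoupledEvent_ne_zero {J B : Finset (ℤ × ℤ)} (hB : B ⊆ J) (b : ℤ × ℤ → ℝ)
    {P₁ M₁ P₃ M₃ : Set (ℤ × ℤ)} (h₁ : Disjoint P₁ M₁) (h₃ : Disjoint P₃ M₃)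
    (hP : ∀ v ∈ P₃, v ∉ B) (hM : ∀ v ∈ M₃, v ∉ B) :
    fieldMeasure J b (decoupledEvent J b B P₁ M₁ P₃ M₃) ≠ 0 := by
  have hZ1 : (fieldMeasure B fun _ => 0).real (signs B P₁ M₁) ≠ 0 :=
    (ENNReal.toReal_pos (fieldMeasure_signs_ne_zero B _ h₁) (measure_ne_top _ _)).ne'
  have hZ3 : (fieldMeasure J b).real (signs J P₃ M₃) ≠ 0 :=
    (ENNReal.toReal_pos (fieldMeasure_signs_ne_zero J _ h₃) (measure_ne_top _ _)).ne'
  intro h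
  have := measureReal_decoupled_mul hB b P₁ M₁ hP hM
  rw [measureReal_def, h] at this
  simp [hZ1, hZ3] at this

/-! ## Cut-off functions -/

open Classical in
/-- The energy of the cut-off function `φ`, weighted by `c`. -/
def cutoffEnergy (A : Finset (ℤ × ℤ)) (φ c : ℤ × ℤ → ℝ) : ℝ :=
  (1 / 2) * ∑ u ∈ A, ∑ v ∈ A, if TG.Adj u v then (φ v - φ u) ^ 2 * ((c u + c v) / 2) else 0

/-- Only edges along which φ varies contribute, so the weight need only be bounded at their ends. -/
lemma cutoffEnergy_mono {A : Finset (ℤ × ℤ)} {φ c : ℤ × ℤ → ℝ} {m E : ℝ}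
    (hm : 0 ≤ m) (hE : cutoffEnergy A φ (fun _ => 1) ≤ E)
    (h : ∀ u v, TG.Adj u v → φ u ≠ φ v → c u ≤ m) : cutoffEnergy A φ c ≤ E * m := by
  classical
  refine le_trans ?_ (mul_le_mul_of_nonneg_right hE hm)
  unfold cutoffEnergy
  rw [mul_assoc, Finset.sum_mul]
  refine mul_le_mul_of_nonneg_left (Finset.sum_le_sum fun u _ => ?_) (by norm_num)
  rw [Finset.sum_mul]
  refine Finset.sum_le_sum fun v _ => ?_
  by_cases hadj : TG.Adj u v
  · rw [if_pos hadj, if_pos hadj]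
    by_cases hφ : φ u = φ v
    · simp [hφ]
    · have h1 := h u v hadj hφ
      have h2 := h v u hadj.symm (Ne.symm hφ)
      have := mul_le_mul_of_nonneg_left (by linarith : (c u + c v) / 2 ≤ m) (sq_nonneg (φ v - φ u))
      linarith
  · rw [if_neg hadj, if_neg hadj, zero_mul]

/-- Caccioppoli's identity, with f_u f_v ≤ (f_u² + f_v²) / 2. -/
lemma form_le_cutoffEnergy {J A : Finset (ℤ × ℤ)} (hA : nbhd J ⊆ A) {φ f : ℤ × ℤ → ℝ}
    (hφ : ∀ z ∉ J, φ z = 0) (hf : ∀ z ∈ J, φ z ≠ 0 → lap f z = 0) :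
    form J (fun z => φ z * f z) (fun z => φ z * f z) ≤ cutoffEnergy A φ fun z => f z ^ 2 := by
  classical
  rw [form_mul_self hA hφ hf, cutoffEnergy]
  refine mul_le_mul_of_nonneg_left (Finset.sum_le_sum fun u _ => Finset.sum_le_sum fun v _ => ?_)
    (by norm_num)
  by_cases hadj : TG.Adj u v
  · rw [if_pos hadj, if_pos hadj]
    refine mul_le_mul_of_nonneg_left ?_ (sq_nonneg _)
    linarith [sq_nonneg (f u - f v)]
  · rw [if_neg hadj, if_neg hadj]

lemma integral_cutoffEnergy {α : Type*} [MeasurableSpace α] (μ : Measure α)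
    (A : Finset (ℤ × ℤ)) (φ : ℤ × ℤ → ℝ) {F : α → ℤ × ℤ → ℝ}
    (hF : ∀ z, Integrable (fun x => F x z) μ) :
    Integrable (fun x => cutoffEnergy A φ (F x)) μ ∧
      ∫ x, cutoffEnergy A φ (F x) ∂μ = cutoffEnergy A φ fun z => ∫ x, F x z ∂μ := by
  classical
  have h1 : ∀ u v, Integrable (fun x => if TG.Adj u v then
      (φ v - φ u) ^ 2 * ((F x u + F x v) / 2) else 0) μ := by
    intro u v
    split_ifs
    · exact (((hF u).add (hF v)).div_const 2).const_mul _
    · exact integrable_zero _ _ _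
  have h2 : ∀ u, Integrable (fun x => ∑ v ∈ A, if TG.Adj u v then
      (φ v - φ u) ^ 2 * ((F x u + F x v) / 2) else 0) μ :=
    fun u => integrable_finsetSum _ fun v _ => h1 u v
  refine ⟨(integrable_finsetSum _ fun u _ => h2 u).const_mul _, ?_⟩
  unfold cutoffEnergy
  rw [integral_const_mul, integral_finsetSum _ fun u _ => h2 u]
  congr 1
  refine Finset.sum_congr rfl fun u _ => ?_
  rw [integral_finsetSum _ fun v _ => h1 u v]
  refine Finset.sum_congr rfl fun v _ => ?_
  split_ifs
  · rw [integral_const_mul, integral_div, integral_add (hF u) (hF v)]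
  · simp

/-- Functions `φ` and `ψ` used to cut off the field between an inner set `S` and the complement
of `B`: the first is one on `S`, the second vanishes there and is one where the first varies. -/
structure Cutoff (B : Finset (ℤ × ℤ)) (S : Set (ℤ × ℤ)) (φ ψ : ℤ × ℤ → ℝ) : Prop where
  outer_zero : ∀ z ∉ B, φ z = 0
  outer_one : ∀ z ∈ S, φ z = 1
  inner_zero : ∀ z ∉ B, ψ z = 0
  inner_zero' : ∀ z ∈ S, ψ z = 0
  inner_one : ∀ z, ψ z = 1 ∨ ∀ i, φ (z + step i) = φ z

/-- Where φ is locally constant, φY is locally a multiple of Y and has zero Laplacian. So only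
values of f where φ varies enter the pairing, and there f = ψf. The values of f near `S` and off `B`
therefore drop out before the mean inequality is applied. -/
lemma two_form_cutoff_le {B : Finset (ℤ × ℤ)} {S : Set (ℤ × ℤ)} {φ ψ : ℤ × ℤ → ℝ}
    (hc : Cutoff B S φ ψ) {Y : ℤ × ℤ → ℝ} (hY : ∀ z ∈ B, lap Y z = 0) (f : ℤ × ℤ → ℝ) :
    2 * form B (fun z => φ z * Y z) f ≤ form B (fun z => φ z * Y z) (fun z => φ z * Y z) +
      form B (fun z => ψ z * f z) (fun z => ψ z * f z) := by
  have hk : ∀ z ∉ B, φ z * Y z = 0 := fun z hz => by rw [hc.outer_zero z hz, zero_mul]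
  refine le_trans (le_of_eq ?_) (two_form_le hk fun z hz => by rw [hc.inner_zero z hz, zero_mul])
  congr 1
  classical
  set k : ℤ × ℤ → ℝ := fun z => φ z * Y z with hkdef
  -- The discarded part of f, restricted to `nbhd B` so that it has finite support and the form may
  -- be transposed.
  let g : ℤ × ℤ → ℝ := fun z => if z ∈ nbhd B then (1 - ψ z) * f z else 0
  have h1 : form B k f = form B k (fun z => ψ z * f z) + form B k g := by
    rw [← form_add_right, form, form]
    congr 1
    refine Finset.sum_congr rfl fun z hz => ?_
    congr 1
    have hval : ∀ w ∈ nbhd B, ψ w * f w + g w = f w := fun w hw => by simp [g, hw]; ring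
    unfold lap
    beta_reduce
    rw [hval z (subset_nbhd B hz)]
    exact Finset.sum_congr rfl fun i _ => by rw [hval _ (add_step_mem_nbhd hz i)]
  have h2 : form B k g = 0 := by
    rw [form_superset (subset_nbhd B) hk, form_comm (fun z hz => hk z fun h => hz (subset_nbhd B h))
      fun z hz => by simp [g, hz], form, neg_eq_zero]
    refine Finset.sum_eq_zero fun z hz => ?_
    rcases hc.inner_one z with h | h
    · simp [g, h]
    · have : lap k z = φ z * lap Y z := by
        simp only [lap, hkdef, h, Finset.mul_sum, mul_sub]
      rw [this]
      by_cases hzB : z ∈ B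
      · rw [hY z hzB]; ring
      · rw [hc.outer_zero z hzB]; ring
  rw [h1, h2, add_zero]

/-! ## Comparison of the two events -/

lemma mem_signs_iff {J : Finset (ℤ × ℤ)} (b : ℤ × ℤ → ℝ) {P M : Set (ℤ × ℤ)}
    (hP : ∀ v ∈ P, v ∈ J) (hM : ∀ v ∈ M, v ∈ J) (x : J → ℝ) :
    x ∈ signs J P M ↔ (∀ v ∈ P, 0 < ext J b x v) ∧ ∀ v ∈ M, ext J b x v < 0 := by
  refine and_congr ⟨fun h v hv => ?_, fun h v hv => ?_⟩ ⟨fun h v hv => ?_, fun h v hv => ?_⟩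
  · rw [ext_of_mem _ _ (hP v hv)]; exact h ⟨v, hP v hv⟩ hv
  · simpa using h v hv
  · rw [ext_of_mem _ _ (hM v hv)]; exact h ⟨v, hM v hv⟩ hv
  · simpa using h v hv

/-- The data of two interfaces, one in `B` and one in `J \ B`. -/
structure Separated (J B : Finset (ℤ × ℤ)) (P₁ M₁ P₃ M₃ : Set (ℤ × ℤ)) : Prop where
  subset : B ⊆ J
  disj₁ : Disjoint P₁ M₁
  disj₃ : Disjoint P₃ M₃
  mem₁ : ∀ v, v ∈ P₁ ∨ v ∈ M₁ → v ∈ B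
  mem₃ : ∀ v, v ∈ P₃ ∨ v ∈ M₃ → v ∈ J ∧ v ∉ B
  interface₁ : Interface P₁ M₁
  interface₃ : Interface P₃ M₃

namespace Separated

variable {J B : Finset (ℤ × ℤ)} {P₁ M₁ P₃ M₃ : Set (ℤ × ℤ)}

lemma disj (h : Separated J B P₁ M₁ P₃ M₃) : Disjoint (P₁ ∪ P₃) (M₁ ∪ M₃) := by
  rw [Set.disjoint_left]
  rintro v (h1 | h1) (h2 | h2)
  · exact Set.disjoint_left.1 h.disj₁ h1 h2
  · exact (h.mem₃ v (.inr h2)).2 (h.mem₁ v (.inl h1))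
  · exact (h.mem₃ v (.inl h1)).2 (h.mem₁ v (.inr h2))
  · exact Set.disjoint_left.1 h.disj₃ h1 h2

lemma memP (h : Separated J B P₁ M₁ P₃ M₃) : ∀ v ∈ P₁ ∪ P₃, v ∈ J := by
  rintro v (h1 | h1)
  · exact h.subset (h.mem₁ v (.inl h1))
  · exact (h.mem₃ v (.inl h1)).1

lemma memM (h : Separated J B P₁ M₁ P₃ M₃) : ∀ v ∈ M₁ ∪ M₃, v ∈ J := by
  rintro v (h1 | h1)
  · exact h.subset (h.mem₁ v (.inr h1))
  · exact (h.mem₃ v (.inr h1)).1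

lemma interface (h : Separated J B P₁ M₁ P₃ M₃) : Interface (P₁ ∪ P₃) (M₁ ∪ M₃) := by
  refine ⟨?_, ?_⟩
  · rintro v (hv | hv)
    · obtain ⟨w, hw, ha⟩ := h.interface₁.1 v hv; exact ⟨w, .inl hw, ha⟩
    · obtain ⟨w, hw, ha⟩ := h.interface₃.1 v hv; exact ⟨w, .inr hw, ha⟩
  · rintro v (hv | hv)
    · obtain ⟨w, hw, ha⟩ := h.interface₁.2 v hv; exact ⟨w, .inl hw, ha⟩
    · obtain ⟨w, hw, ha⟩ := h.interface₃.2 v hv; exact ⟨w, .inr hw, ha⟩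

lemma signs_union (h : Separated J B P₁ M₁ P₃ M₃) (b : ℤ × ℤ → ℝ) (x : J → ℝ) :
    x ∈ signs J (P₁ ∪ P₃) (M₁ ∪ M₃) ↔ ((∀ v ∈ P₁, 0 < ext J b x v) ∧ ∀ v ∈ M₁, ext J b x v < 0) ∧
      (∀ v ∈ P₃, 0 < ext J b x v) ∧ ∀ v ∈ M₃, ext J b x v < 0 := by
  rw [mem_signs_iff b h.memP h.memM]
  simp only [Set.mem_union]
  constructor
  · rintro ⟨h1, h2⟩
    exact ⟨⟨fun v hv => h1 v (.inl hv), fun v hv => h2 v (.inl hv)⟩,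
      fun v hv => h1 v (.inr hv), fun v hv => h2 v (.inr hv)⟩
  · rintro ⟨⟨h1, h2⟩, h3, h4⟩
    exact ⟨fun v hv => hv.elim (h1 v) (h3 v), fun v hv => hv.elim (h2 v) (h4 v)⟩

lemma mem_decoupledEvent (h : Separated J B P₁ M₁ P₃ M₃) (b : ℤ × ℤ → ℝ) (x : J → ℝ) :
    x ∈ decoupledEvent J b B P₁ M₁ P₃ M₃ ↔
      ((∀ v ∈ P₁, 0 < ext J b x v - harm B (ext J b x) v) ∧
        ∀ v ∈ M₁, ext J b x v - harm B (ext J b x) v < 0) ∧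
      (∀ v ∈ P₃, 0 < ext J b x v) ∧ ∀ v ∈ M₃, ext J b x v < 0 := by
  rw [decoupledEvent, Set.mem_preimage, Set.mem_prod,
    mem_signs_iff (fun _ => 0) (fun v hv => h.mem₁ v (.inl hv)) fun v hv => h.mem₁ v (.inr hv),
    mem_signs_iff b (fun v hv => Finset.mem_sdiff.2 (h.mem₃ v (.inl hv)))
      fun v hv => Finset.mem_sdiff.2 (h.mem₃ v (.inr hv))]
  simp only [ext_inside]
  have : ∀ v, (v ∈ P₃ ∨ v ∈ M₃) → ext (J \ B) b (decouple J b B x).2 v = ext J b x v := by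
    intro v hv
    rw [ext_of_mem _ _ (Finset.mem_sdiff.2 (h.mem₃ v hv))]; rfl
  refine and_congr_right fun _ => and_congr ?_ ?_ <;>
    refine forall_congr' fun v => imp_congr_right fun hv => ?_
  · rw [this v (.inl hv)]
  · rw [this v (.inr hv)]

/-- Moving the harmonic part of the field, cut off by `φ`. -/
lemma ext_shear (h : Separated J B P₁ M₁ P₃ M₃) (b : ℤ × ℤ → ℝ) {φ : ℤ × ℤ → ℝ}
    (hφ : ∀ z ∉ B, φ z = 0) (t : ℝ) (x : J → ℝ) (z : ℤ × ℤ) :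
    ext J b (shear B (fun x z => t * (φ z * harm B (ext J b x) z)) x) z =
      ext J b x z + t * (φ z * harm B (ext J b x) z) := by
  by_cases hz : z ∈ B
  · simp [ext_of_mem _ _ (h.subset hz), shear, hz]
  · by_cases hJ : z ∈ J
    · simp [ext_of_mem _ _ hJ, shear, hz, hφ z hz]
    · simp [ext_of_notMem _ _ hJ, hφ z hz]

lemma harm_shear (h : Separated J B P₁ M₁ P₃ M₃) (b : ℤ × ℤ → ℝ) {φ : ℤ × ℤ → ℝ}
    (hφ : ∀ z ∉ B, φ z = 0) (t : ℝ) (x : J → ℝ) (z : ℤ × ℤ) :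
    harm B (ext J b (shear B (fun x z => t * (φ z * harm B (ext J b x) z)) x)) z =
      harm B (ext J b x) z :=
  harm_congr (fun w hw => by rw [h.ext_shear b hφ, hφ w hw]; ring) z

lemma measurePreserving_shear_harm (b φ : ℤ × ℤ → ℝ) (t : ℝ) :
    MeasurePreserving (shear (J := J) B fun x z => t * (φ z * harm B (ext J b x) z))
      volume volume :=
  measurePreserving_shear B _
    (fun z => (((continuous_harm J b B z).const_mul (φ z)).const_mul t).measurable)
    fun x x' hx => funext fun z => by rw [harm_ext_congr b B hx]

lemma action_shear (h : Separated J B P₁ M₁ P₃ M₃) (b : ℤ × ℤ → ℝ) {φ : ℤ × ℤ → ℝ}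
    (hφ : ∀ z ∉ B, φ z = 0) (t : ℝ) (x : J → ℝ) :
    action J b (shear B (fun x z => t * (φ z * harm B (ext J b x) z)) x) - action J b x =
      t * form B (fun z => φ z * harm B (ext J b x) z) (ext J b x) +
        t ^ 2 / 2 * form B (fun z => φ z * harm B (ext J b x) z)
          fun z => φ z * harm B (ext J b x) z := by
  have hκ : ∀ z ∉ B, t * (φ z * harm B (ext J b x) z) = 0 := fun z hz => by
    rw [hφ z hz]; ring
  rw [action_sub J b x _ (fun z => t * (φ z * harm B (ext J b x) z))
    (fun z hz => hκ z fun h' => hz (h.subset h')),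
    ← form_superset h.subset hκ, ← form_superset h.subset hκ, form_smul_left, form_smul_left,
    form_smul_right]
  · ring
  · intro z
    have := h.ext_shear b hφ t x z
    rwa [ext_coe, ext_coe] at this

lemma integrable_form (b φ : ℤ × ℤ → ℝ) :
    Integrable (fun x : J → ℝ => form B (fun z => φ z * harm B (ext J b x) z) (ext J b x))
      (fieldMeasure J b) := by
  simp only [form, mul_assoc]
  exact (integrable_finsetSum _ fun z _ =>
    ((memLp_harm J b B z).integrable_mul (memLp_lap J b z)).const_mul _).neg

lemma memLp_lap_mul_harm (b φ : ℤ × ℤ → ℝ) (z : ℤ × ℤ) :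
    MemLp (fun x : J → ℝ => lap (fun z => φ z * harm B (ext J b x) z) z) 2 (fieldMeasure J b) := by
  simp only [lap]
  exact memLp_finsetSum _ fun i _ => ((memLp_harm J b B _).const_mul _).sub
    ((memLp_harm J b B _).const_mul _)

lemma integrable_form_self (b φ : ℤ × ℤ → ℝ) :
    Integrable (fun x : J → ℝ => form B (fun z => φ z * harm B (ext J b x) z)
      fun z => φ z * harm B (ext J b x) z) (fieldMeasure J b) := by
  simp only [form, mul_assoc]
  exact (integrable_finsetSum _ fun z _ =>
    ((memLp_harm J b B z).integrable_mul (memLp_lap_mul_harm b φ z)).const_mul _).neg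

lemma integrable_action_shear (h : Separated J B P₁ M₁ P₃ M₃) (b : ℤ × ℤ → ℝ) {φ : ℤ × ℤ → ℝ}
    (hφ : ∀ z ∉ B, φ z = 0) (t : ℝ) :
    Integrable (fun x => action J b (shear B (fun x z => t * (φ z * harm B (ext J b x) z)) x) -
      action J b x) (fieldMeasure J b) := by
  simp only [h.action_shear b hφ t]
  exact ((integrable_form b φ).const_mul _).add ((integrable_form_self b φ).const_mul _)

end Separated

lemma integrable_law_of_integrable {J : Finset (ℤ × ℤ)} {b : ℤ × ℤ → ℝ} {K : Set (J → ℝ)}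
    {f : (J → ℝ) → ℝ} (hf : Integrable f (fieldMeasure J b)) : Integrable f (law J b K) :=
  memLp_one_iff_integrable.1 (memLp_law (memLp_one_iff_integrable.2 hf))

/-- Expected energy of the cut-off harmonic extension. -/
lemma integral_form_self_le {J B I A : Finset (ℤ × ℤ)} {b : ℤ × ℤ → ℝ} {K : Set (J → ℝ)}
    {φ : ℤ × ℤ → ℝ} (hA : nbhd B ⊆ A) (hφ : ∀ z ∉ B, φ z = 0) (hφI : ∀ z ∈ B, φ z ≠ 0 → z ∈ I)
    {m E : ℝ} (hm : 0 ≤ m) (hE : cutoffEnergy A φ (fun _ => 1) ≤ E)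
    (hbd : ∀ u v, TG.Adj u v → φ u ≠ φ v → ∫ x, harm I (ext J b x) u ^ 2 ∂(law J b K) ≤ m) :
    ∫ x, form B (fun z => φ z * harm I (ext J b x) z) (fun z => φ z * harm I (ext J b x) z)
      ∂(law J b K) ≤ E * m := by
  have hi : ∀ z, Integrable (fun x => harm I (ext J b x) z ^ 2) (law J b K) := fun z =>
    integrable_law_of_integrable (memLp_harm J b I z).integrable_sq
  obtain ⟨h1, h2⟩ := integral_cutoffEnergy (law J b K) A φ
    (F := fun x z => harm I (ext J b x) z ^ 2) hi
  have h3 := cutoffEnergy_mono (c := fun z => ∫ x, harm I (ext J b x) z ^ 2 ∂(law J b K)) hm hE hbd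
  rw [← h2] at h3
  refine le_trans (integral_mono_of_nonneg (.of_forall fun x => ?_) h1 (.of_forall fun x => ?_)) h3
  · exact form_nonneg fun z hz => by simp [hφ z hz]
  · exact form_le_cutoffEnergy hA hφ fun z hz hz' => lap_harm _ (hφI z hz hz')

namespace Separated

variable {J B : Finset (ℤ × ℤ)} {P₁ M₁ P₃ M₃ : Set (ℤ × ℤ)}

/-- The harmonic extension from outside `B` and from the interface in `B` has the same correlations
with the field outside as the field itself. -/
lemma integral_form_eq (h : Separated J B P₁ M₁ P₃ M₃) (b φ : ℤ × ℤ → ℝ) :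
    ∫ x, form B (fun z => φ z * harm B (ext J b x) z) (ext J b x)
        ∂(law J b (signs J (P₁ ∪ P₃) (M₁ ∪ M₃))) =
      ∫ x, form B (fun z => φ z * harm B (ext J b x) z) (harm (free B P₁ M₁) (ext J b x))
        ∂(law J b (signs J (P₁ ∪ P₃) (M₁ ∪ M₃))) := by
  set K := signs J (P₁ ∪ P₃) (M₁ ∪ M₃)
  set I := free B P₁ M₁
  -- The harmonic part at y depends only on the field off `B`, so by integration by parts its
  -- correlation with the field is harmonic on `I`.
  have key : ∀ y z, ∫ x, harm I (ext J b x) z * harm B (ext J b x) y ∂(law J b K) =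
      ∫ x, ext J b x z * harm B (ext J b x) y ∂(law J b K) := by
    intro y z
    rw [← harm_integral_mul J b K (memLp_harm J b B y)]
    refine harm_eq_of_harmonic (fun u hu => ?_) z
    have hu' := mem_free.1 hu
    rw [lap_integral_mul J b K (memLp_harm J b B y)]
    simp_rw [mul_comm (lap _ _)]
    refine integral_mul_lap_eq_zero h.disj (h.subset hu'.1) ?_ ?_ _
      (continuous_harm J b B y).measurable (memLp_harm J b B y) fun x x' hx =>
        harm_ext_congr b B (fun j hj => hx j fun h' => hj (h' ▸ hu'.1)) y
    · rintro (h1 | h1)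
      · exact hu'.2.1 h1
      · exact (h.mem₃ u (.inl h1)).2 hu'.1
    · rintro (h1 | h1)
      · exact hu'.2.2 h1
      · exact (h.mem₃ u (.inr h1)).2 hu'.1
  have i1 : ∀ y z, Integrable (fun x => ext J b x z * harm B (ext J b x) y) (law J b K) :=
    fun y z => integrable_law_mul (memLp_ext J b z) (memLp_harm J b B y)
  have i2 : ∀ y z, Integrable (fun x => harm I (ext J b x) z * harm B (ext J b x) y) (law J b K) :=
    fun y z => integrable_law_mul (memLp_harm J b I z) (memLp_harm J b B y)
  have expand : ∀ (F : (J → ℝ) → ℤ × ℤ → ℝ) (x : J → ℝ),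
      form B (fun z => φ z * harm B (ext J b x) z) (F x) =
        -∑ z ∈ B, ∑ i, φ z * (F x (z + step i) * harm B (ext J b x) z -
          F x z * harm B (ext J b x) z) := by
    intro F x
    simp only [form, lap, Finset.mul_sum]
    congr 1
    exact Finset.sum_congr rfl fun z _ => Finset.sum_congr rfl fun i _ => by ring
  simp only [expand (fun x => ext J b x), expand (fun x => harm I (ext J b x))]
  rw [integral_neg, integral_neg, integral_finsetSum, integral_finsetSum]
  · congr 1
    refine Finset.sum_congr rfl fun z _ => ?_
    rw [integral_finsetSum, integral_finsetSum]
    · refine Finset.sum_congr rfl fun i _ => ?_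
      rw [integral_const_mul, integral_const_mul, integral_sub (i1 _ _) (i1 _ _),
        integral_sub (i2 _ _) (i2 _ _), key, key]
    · exact fun i _ => ((i2 _ _).sub (i2 _ _)).const_mul _
    · exact fun i _ => ((i1 _ _).sub (i1 _ _)).const_mul _
  · exact fun z _ => integrable_finsetSum _ fun i _ => ((i2 _ _).sub (i2 _ _)).const_mul _
  · exact fun z _ => integrable_finsetSum _ fun i _ => ((i1 _ _).sub (i1 _ _)).const_mul _

/-- Given the decoupled event, the interaction term is the product of expectations. -/
lemma integral_form_decoupled (h : Separated J B P₁ M₁ P₃ M₃) (b φ : ℤ × ℤ → ℝ) :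
    ∫ x, form B (fun z => φ z * harm B (ext J b x) z) (ext J b x)
        ∂(law J b (decoupledEvent J b B P₁ M₁ P₃ M₃)) =
      form B (fun z => φ z * ∫ x, harm B (ext J b x) z ∂(law J b (signs J P₃ M₃)))
        fun z => ∫ y, ext B (fun _ => 0) y z ∂(law B (fun _ => 0) (signs B P₁ M₁)) := by
  set K := decoupledEvent J b B P₁ M₁ P₃ M₃
  -- On `B` the Laplacian annihilates the harmonic part, so each term is a function of the inner
  -- decoupled field times a function of the outer field.
  have e1 : ∀ x : J → ℝ, form B (fun z => φ z * harm B (ext J b x) z) (ext J b x) =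
      -∑ z ∈ B, φ z * (lap (ext B (fun _ => 0) (decouple J b B x).1) z *
        harm B (ext (J \ B) b (decouple J b B x).2) z) := by
    intro x
    have : ext B (fun _ => 0) (decouple J b B x).1 =
        fun z => ext J b x z - harm B (ext J b x) z := funext fun z => ext_inside b x z
    rw [form, this]
    congr 1
    refine Finset.sum_congr rfl fun z hz => ?_
    rw [lap_sub, lap_harm _ hz, harm_ext_outside]
    ring
  have i1 : ∀ z, Integrable (fun x => lap (ext B (fun _ => 0) (decouple J b B x).1) z *
      harm B (ext (J \ B) b (decouple J b B x).2) z) (law J b K) := by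
    intro z
    have : ∀ x : J → ℝ, ext B (fun _ => 0) (decouple J b B x).1 =
        fun z => ext J b x z - harm B (ext J b x) z := fun x => funext fun z => ext_inside b x z
    simp only [this, harm_ext_outside, lap_sub]
    refine integrable_law_mul ((memLp_lap J b z).sub ?_) (memLp_harm J b B z)
    simp only [lap]
    exact memLp_finsetSum _ fun i _ => (memLp_harm J b B _).sub (memLp_harm J b B _)
  simp only [e1]
  rw [integral_neg, integral_finsetSum _ fun z _ => (i1 z).const_mul _, form]
  congr 1
  refine Finset.sum_congr rfl fun z _ => ?_
  have hc1 : Continuous fun y : B → ℝ => lap (ext B (fun _ => 0) y) z := by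
    have := continuous_ext B fun _ => 0
    unfold lap
    fun_prop (disch := exact this _)
  rw [integral_const_mul, integral_decoupled h.subset b h.disj₁ h.disj₃
    (fun v hv => (h.mem₃ v (.inl hv)).2) (fun v hv => (h.mem₃ v (.inr hv)).2)
    (f := fun y => lap (ext B (fun _ => 0) y) z) (g := fun y => harm B (ext (J \ B) b y) z) hc1
    (continuous_harm _ b B z)]
  have h2 := lap_integral_mul B (fun _ => 0) (signs B P₁ M₁) (memLp_const 1) z
  simp only [mul_one] at h2
  rw [h2]
  simp only [harm_ext_outside]
  ring

lemma integral_sq_decoupled (h : Separated J B P₁ M₁ P₃ M₃) (b : ℤ × ℤ → ℝ) (z : ℤ × ℤ) :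
    ∫ x, harm B (ext J b x) z ^ 2 ∂(law J b (decoupledEvent J b B P₁ M₁ P₃ M₃)) =
      ∫ x, harm B (ext J b x) z ^ 2 ∂(law J b (signs J P₃ M₃)) := by
  have := integral_decoupled h.subset b h.disj₁ h.disj₃
    (fun v hv => (h.mem₃ v (.inl hv)).2) (fun v hv => (h.mem₃ v (.inr hv)).2)
    (f := fun _ => 1) (g := fun y => harm B (ext (J \ B) b y) z ^ 2) continuous_const
    ((continuous_harm _ b B z).pow 2)
  have hp := isProbabilityMeasure_law (fieldMeasure_signs_ne_zero B (fun _ => 0) h.disj₁)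
  simpa [harm_ext_outside] using this

/-- The two events have comparable probabilities. -/
theorem comparison (h : Separated J B P₁ M₁ P₃ M₃) {b φ ψ : ℤ × ℤ → ℝ} {Λ m E : ℝ}
    (hb : ∀ z, |b z| ≤ Λ) (hc : Cutoff B (P₁ ∪ M₁) φ ψ) (hm : 0 ≤ m)
    (hφE : cutoffEnergy (nbhd B) φ (fun _ => 1) ≤ E)
    (hψE : cutoffEnergy (nbhd B) ψ (fun _ => 1) ≤ E)
    (hgreen : ∀ u v, TG.Adj u v → (φ u ≠ φ v ∨ ψ u ≠ ψ v) →
      ∀ w ∉ B, green (free J P₃ M₃) w u ≤ m) :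
    (fieldMeasure J b).real (decoupledEvent J b B P₁ M₁ P₃ M₃) *
        Real.exp (-(3 / 2 * (E * (max 1 (Λ ^ 2) + m)))) ≤
      (fieldMeasure J b).real (signs J (P₁ ∪ P₃) (M₁ ∪ M₃)) ∧
    (fieldMeasure J b).real (signs J (P₁ ∪ P₃) (M₁ ∪ M₃)) *
        Real.exp (-(3 / 2 * (E * (max 1 (Λ ^ 2) + m)))) ≤
      (fieldMeasure J b).real (decoupledEvent J b B P₁ M₁ P₃ M₃) := by
  set K := signs J (P₁ ∪ P₃) (M₁ ∪ M₃) with hK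
  set K' := decoupledEvent J b B P₁ M₁ P₃ M₃ with hK'
  set I := free B P₁ M₁ with hI
  set q := max 1 (Λ ^ 2) + m with hq
  have hq1 : 1 ≤ q := by have := le_max_left 1 (Λ ^ 2); linarith
  have hBΩ : B ⊆ free J P₃ M₃ := fun z hz => mem_free.2 ⟨h.subset hz,
    fun h' => (h.mem₃ z (.inl h')).2 hz, fun h' => (h.mem₃ z (.inr h')).2 hz⟩
  have hKpos : fieldMeasure J b K ≠ 0 := fieldMeasure_signs_ne_zero J b h.disj
  have hK'pos : fieldMeasure J b K' ≠ 0 := decoupledEvent_ne_zero h.subset b h.disj₁ h.disj₃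
    (fun v hv => (h.mem₃ v (.inl hv)).2) fun v hv => (h.mem₃ v (.inr hv)).2
  have hfreeK : free J (P₁ ∪ P₃) (M₁ ∪ M₃) ⊆ free J P₃ M₃ := fun z hz => by
    have := mem_free.1 hz
    exact mem_free.2 ⟨this.1, fun h' => this.2.1 (.inr h'), fun h' => this.2.2 (.inr h')⟩
  -- second moments
  have m1 : ∀ x, (∀ w ∉ B, green (free J P₃ M₃) w x ≤ m) →
      ∫ ω, harm B (ext J b ω) x ^ 2 ∂(law J b (signs J P₃ M₃)) ≤ q := fun x hx =>
    integral_harm_sq_le h.disj₃ (fun v hv => (h.mem₃ v (.inl hv)).1)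
      (fun v hv => (h.mem₃ v (.inr hv)).1) h.interface₃ hb subset_rfl hBΩ subset_rfl
      (fun z hz hz' => absurd hz hz') hm hx
  have m2 : ∀ x, (∀ w ∉ B, green (free J P₃ M₃) w x ≤ m) →
      ∫ ω, harm B (ext J b ω) x ^ 2 ∂(law J b K) ≤ q := fun x hx =>
    integral_harm_sq_le h.disj h.memP h.memM h.interface hb subset_rfl hBΩ hfreeK
      (fun z hz hz' => absurd hz hz') hm hx
  have m3 : ∀ x, (∀ w ∉ B, green (free J P₃ M₃) w x ≤ m) →
      ∫ ω, harm I (ext J b ω) x ^ 2 ∂(law J b K) ≤ q := fun x hx =>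
    integral_harm_sq_le h.disj h.memP h.memM h.interface hb (fun z hz => (mem_free.1 hz).1) hBΩ
      hfreeK (fun z hz hz' => by
        rcases notMem_free.1 hz' with h1 | h1 | h1
        · exact absurd hz h1
        · exact .inl (.inl h1)
        · exact .inr (.inl h1)) hm hx
  have hψI : ∀ z ∈ B, ψ z ≠ 0 → z ∈ I := fun z hz hz' => mem_free.2 ⟨hz,
    fun h' => hz' (hc.inner_zero' z (.inl h')), fun h' => hz' (hc.inner_zero' z (.inr h'))⟩
  have hφB : ∀ z ∈ B, φ z ≠ 0 → z ∈ B := fun z hz _ => hz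
  -- integrability
  have iE := Separated.integrable_form_self (J := J) (B := B) b φ
  have iF := Separated.integrable_form (J := J) (B := B) b φ
  constructor
  -- With t = -1 the shear subtracts the whole harmonic part on the inner interface, where φ = 1,
  -- and leaves the outer one alone: the sign event pulls back to the decoupled event.
  · have hT := measurePreserving_shear_harm (J := J) (B := B) b φ (-1)
    have hJ := measure_mul_exp_le (b := b) hT.measurable one_pos (by simpa using hT.map_eq)
      (measurableSet_decoupledEvent J b B P₁ M₁ P₃ M₃) (measurableSet_signs J _ _)
      (K := K') (K' := K) ?_ hK'pos (h.integrable_action_shear b hc.outer_zero (-1))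
    · rw [one_mul] at hJ
      refine le_trans ?_ hJ
      refine mul_le_mul_of_nonneg_left (Real.exp_le_exp.2 (neg_le_neg ?_)) measureReal_nonneg
      simp only [h.action_shear b hc.outer_zero]
      rw [integral_add ((integrable_law_of_integrable iF).const_mul _)
        ((integrable_law_of_integrable iE).const_mul _), integral_const_mul, integral_const_mul]
      -- The 3/2 in the exponent is 1 for the pairing and 1/2 for the quadratic term t²/2.
      have b1 : ∫ x, form B (fun z => φ z * harm B (ext J b x) z)
          (fun z => φ z * harm B (ext J b x) z) ∂(law J b K') ≤ E * q := by
        refine integral_form_self_le subset_rfl hc.outer_zero hφB (by linarith) hφE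
          fun u v huv hne => ?_
        rw [h.integral_sq_decoupled]
        exact m1 u (hgreen u v huv (.inl hne))
      -- By independence the pairing involves only two mean functions, `y` harmonic on `B` and `g`
      -- harmonic off the inner interface. As t = -1 a lower bound is required, whence the factor -1
      -- on `g`.
      have b2 : -(∫ x, form B (fun z => φ z * harm B (ext J b x) z) (ext J b x)
          ∂(law J b K')) ≤ E * q := by
        rw [h.integral_form_decoupled b φ]
        set y : ℤ × ℤ → ℝ := fun z => ∫ x, harm B (ext J b x) z ∂(law J b (signs J P₃ M₃)) with hy
        set g : ℤ × ℤ → ℝ := fun z =>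
          ∫ y, ext B (fun _ => 0) y z ∂(law B (fun _ => 0) (signs B P₁ M₁)) with hg
        have hp3 := isProbabilityMeasure_law (fieldMeasure_signs_ne_zero J b h.disj₃)
        have hylap : ∀ z ∈ B, lap y z = 0 := by
          have e0 := fun z => harm_integral_mul J b (signs J P₃ M₃) (memLp_const 1) B z
          simp only [mul_one] at e0
          intro z hz
          have : y = harm B fun z => ∫ x, ext J b x z ∂(law J b (signs J P₃ M₃)) :=
            funext fun z => (e0 z).symm
          rw [this, lap_harm _ hz]
        have hglap : ∀ z ∈ B, ψ z ≠ 0 → lap g z = 0 := by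
          intro z hz hz'
          have hz2 := mem_free.1 (hψI z hz hz')
          have h1 := lap_integral_mul B (fun _ => 0) (signs B P₁ M₁) (memLp_const 1) z
          simp only [mul_one] at h1
          rw [hg, h1]
          simpa using integral_mul_lap_eq_zero h.disj₁ hz hz2.2.1 hz2.2.2 (fun _ => 1)
            measurable_const (memLp_const 1) fun _ _ _ => rfl
        have hD := two_form_cutoff_le hc hylap fun z => (-1) * g z
        rw [form_smul_right] at hD
        have d1 : form B (fun z => φ z * y z) (fun z => φ z * y z) ≤ E * q := by
          refine (form_le_cutoffEnergy subset_rfl hc.outer_zero fun z hz _ => hylap z hz).trans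
            (cutoffEnergy_mono (by linarith) hφE fun u v huv hne => ?_)
          refine le_trans ?_ (m1 u (hgreen u v huv (.inl hne)))
          have hmem := memLp_law (K := signs J P₃ M₃) (memLp_harm J b B u)
          -- The square of the mean is at most the second moment.
          have hv := ProbabilityTheory.variance_nonneg (fun x => harm B (ext J b x) u)
            (law J b (signs J P₃ M₃))
          rw [ProbabilityTheory.variance_eq_sub hmem] at hv
          have : (∫ x, harm B (ext J b x) u ∂(law J b (signs J P₃ M₃))) ^ 2 ≤
            ∫ x, ((fun x => harm B (ext J b x) u) ^ 2) x ∂(law J b (signs J P₃ M₃)) := by linarith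
          exact this
        have d2 : form B (fun z => ψ z * (-1 * g z)) (fun z => ψ z * (-1 * g z)) ≤ E * q := by
          refine (form_le_cutoffEnergy subset_rfl hc.inner_zero fun z hz hz' => ?_).trans
            (cutoffEnergy_mono (by linarith) hψE fun u v _ _ => ?_)
          · rw [lap_const_mul, hglap z hz hz', mul_zero]
          · have := abs_integral_ext_le h.disj₁ (fun v hv => h.mem₁ v (.inl hv))
              (fun v hv => h.mem₁ v (.inr hv)) h.interface₁ u
            have h2 : (g u) ^ 2 ≤ 1 := by rw [← sq_abs]; exact pow_le_one₀ (abs_nonneg _) this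
            nlinarith
        linarith
      linarith
    · ext x
      rw [Set.mem_preimage, h.signs_union b, h.mem_decoupledEvent]
      simp only [h.ext_shear b hc.outer_zero]
      have o1 : ∀ v, (v ∈ P₁ ∨ v ∈ M₁) → φ v = 1 := hc.outer_one
      have o3 : ∀ v, (v ∈ P₃ ∨ v ∈ M₃) → φ v = 0 := fun v hv => hc.outer_zero v (h.mem₃ v hv).2
      refine and_congr (and_congr ?_ ?_) (and_congr ?_ ?_) <;>
        refine forall_congr' fun v => imp_congr_right fun hv => ?_
      · rw [o1 v (.inl hv), one_mul, neg_one_mul, sub_eq_add_neg]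
      · rw [o1 v (.inr hv), one_mul, neg_one_mul, sub_eq_add_neg]
      · rw [o3 v (.inl hv), zero_mul, mul_zero, add_zero]
      · rw [o3 v (.inr hv), zero_mul, mul_zero, add_zero]
  -- The converse direction uses t = 1. The shear moves only values in `B` and so does not change
  -- the harmonic part; the decoupled event pulls back to the sign event.
  · have hT := measurePreserving_shear_harm (J := J) (B := B) b φ 1
    have hJ := measure_mul_exp_le (b := b) hT.measurable one_pos (by simpa using hT.map_eq)
      (measurableSet_signs J _ _) (measurableSet_decoupledEvent J b B P₁ M₁ P₃ M₃)
      (K := K) (K' := K') ?_ hKpos (h.integrable_action_shear b hc.outer_zero 1)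
    · rw [one_mul] at hJ
      refine le_trans ?_ hJ
      refine mul_le_mul_of_nonneg_left (Real.exp_le_exp.2 (neg_le_neg ?_)) measureReal_nonneg
      simp only [h.action_shear b hc.outer_zero]
      rw [integral_add ((integrable_law_of_integrable iF).const_mul _)
        ((integrable_law_of_integrable iE).const_mul _), integral_const_mul, integral_const_mul]
      have b1 : ∫ x, form B (fun z => φ z * harm B (ext J b x) z)
          (fun z => φ z * harm B (ext J b x) z) ∂(law J b K) ≤ E * q :=
        integral_form_self_le subset_rfl hc.outer_zero hφB (by linarith) hφE
          fun u v huv hne => m2 u (hgreen u v huv (.inl hne))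
      have b2 : ∫ x, form B (fun z => ψ z * harm I (ext J b x) z)
          (fun z => ψ z * harm I (ext J b x) z) ∂(law J b K) ≤ E * q :=
        integral_form_self_le subset_rfl hc.inner_zero hψI (by linarith) hψE
          fun u v huv hne => m3 u (hgreen u v huv (.inr hne))
      -- There is no independence given the sign event. Instead the field is replaced by its
      -- extension `harm I`, which is harmonic where ψ ≠ 0 and has bounded second moments where ψ
      -- varies.
      have b3 : ∫ x, form B (fun z => φ z * harm B (ext J b x) z) (ext J b x)
          ∂(law J b K) ≤ E * q := by
        rw [h.integral_form_eq b φ]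
        have hi1 : Integrable (fun x => form B (fun z => φ z * harm B (ext J b x) z)
            (harm I (ext J b x))) (law J b K) := by
          simp only [form, mul_assoc]
          refine (integrable_finsetSum _ fun z _ => ?_).neg
          refine (integrable_law_mul (memLp_harm J b B z) ?_).const_mul _
          simp only [lap]
          exact memLp_finsetSum _ fun i _ => (memLp_harm J b I _).sub (memLp_harm J b I _)
        have hi2 : Integrable (fun x => form B (fun z => ψ z * harm I (ext J b x) z)
            (fun z => ψ z * harm I (ext J b x) z)) (law J b K) := by
          simp only [form, mul_assoc]
          refine (integrable_finsetSum _ fun z _ => ?_).neg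
          refine (integrable_law_mul (memLp_harm J b I z) ?_).const_mul _
          simp only [lap]
          exact memLp_finsetSum _ fun i _ => ((memLp_harm J b I _).const_mul _).sub
            ((memLp_harm J b I _).const_mul _)
        have hmono := integral_mono (hi1.const_mul 2) ((integrable_law_of_integrable iE).add hi2)
          fun x => two_form_cutoff_le hc (fun z hz => lap_harm (ext J b x) hz)
            (harm I (ext J b x))
        rw [integral_const_mul, integral_add' (integrable_law_of_integrable iE) hi2] at hmono
        linarith
      linarith
    · ext x
      rw [Set.mem_preimage, h.signs_union b, h.mem_decoupledEvent]
      simp only [h.ext_shear b hc.outer_zero, h.harm_shear b hc.outer_zero]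
      have o1 : ∀ v, (v ∈ P₁ ∨ v ∈ M₁) → φ v = 1 := hc.outer_one
      have o3 : ∀ v, (v ∈ P₃ ∨ v ∈ M₃) → φ v = 0 := fun v hv => hc.outer_zero v (h.mem₃ v hv).2
      refine and_congr (and_congr ?_ ?_) (and_congr ?_ ?_) <;>
        refine forall_congr' fun v => imp_congr_right fun hv => ?_
      · rw [o1 v (.inl hv), one_mul, one_mul, add_sub_cancel_right]
      · rw [o1 v (.inr hv), one_mul, one_mul, add_sub_cancel_right]
      · rw [o3 v (.inl hv), zero_mul, mul_zero, add_zero]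
      · rw [o3 v (.inr hv), zero_mul, mul_zero, add_zero]

end Separated

/-! ## Logarithmic barriers -/

lemma norm_pos_sq' (z : ℤ × ℤ) :
    ‖pos z‖ ^ 2 = (z.1 : ℝ) ^ 2 + z.1 * z.2 + (z.2 : ℝ) ^ 2 := by
  rw [norm_pos_sq]; push_cast; ring

lemma one_le_norm_pos_sq {z : ℤ × ℤ} (hz : z ≠ 0) : 1 ≤ ‖pos z‖ ^ 2 := by
  rw [norm_pos_sq]
  have : 1 ≤ z.1 ^ 2 + z.1 * z.2 + z.2 ^ 2 := by
    by_contra! h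
    have h1 : z.1 = 0 := by nlinarith [sq_nonneg (z.1 + 2 * z.2)]
    have h2 : z.2 = 0 := by nlinarith [sq_nonneg (2 * z.1 + z.2)]
    exact hz (Prod.ext h1 h2)
  exact_mod_cast this

lemma one_le_norm_pos {z : ℤ × ℤ} (hz : z ≠ 0) : 1 ≤ ‖pos z‖ := by
  have := one_le_norm_pos_sq hz
  nlinarith [norm_nonneg (pos z)]

lemma sum_log_six {f : Fin 6 → ℝ} (hf : ∀ i, 0 < f i) :
    ∑ i, Real.log (f i) = Real.log (∏ i, f i) :=
  (Real.log_prod fun i _ => (hf i).ne').symm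

/-- The logarithm of this product is the sum over the neighbors, which turns sub- and
superharmonicity of logarithmic functions into polynomial inequalities in |z|². -/
lemma norm_pos_add_step_sq (z : ℤ × ℤ) (c : ℝ) :
    ∏ i, (‖pos (z + step i)‖ ^ 2 + c) =
      ((‖pos z‖ ^ 2 + 1 + c) ^ 2) * ((‖pos z‖ ^ 2 + 1 + c) ^ 2 - 3 * ‖pos z‖ ^ 2) ^ 2 -
        ((2 * z.1 + z.2) * (z.2 - z.1) * (z.1 + 2 * z.2)) ^ 2 := by
  simp only [norm_pos_sq', Fin.prod_univ_six, step, Matrix.cons_val, Prod.fst_add, Prod.snd_add]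
  push_cast
  ring

/-- A function that grows like `2 log |z|` and is superharmonic except at the origin. -/
def ell (z : ℤ × ℤ) : ℝ := if z = 0 then -Real.log 350 else Real.log (‖pos z‖ ^ 2 + -(1 / 2))

/-- Away from the origin and its neighbors this is the polynomial inequality from
`norm_pos_add_step_sq`. At a neighbor of the origin the constant 350 makes the Laplacian exactly
zero: (7/2)(5/2)² / 350 = (1/2)⁴. -/
lemma lap_ell_nonpos {z : ℤ × ℤ} (hz : z ≠ 0) : lap ell z ≤ 0 := by
  have hn1 := one_le_norm_pos_sq hz
  rw [lap_eq]
  rcases eq_or_lt_of_le hn1 with h1 | h1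
  · have hadj : TG.Adj 0 z := by
      change dist (pos 0) (pos z) = 1
      rw [pos_zero, dist_comm, dist_zero_right]
      have := norm_nonneg (pos z)
      nlinarith
    obtain ⟨i, hi⟩ := (adj_iff _ _).1 hadj
    rw [zero_add] at hi
    subst hi
    have e : ∀ w : ℤ × ℤ, ell w = if w = 0 then -Real.log 350 else
        Real.log ((w.1 : ℝ) ^ 2 + w.1 * w.2 + (w.2 : ℝ) ^ 2 + -(1 / 2)) := by
      intro w; rw [ell, norm_pos_sq']
    have hval : ∀ i, ∑ j, ell (step i + step j) = Real.log (7 / 2) + 2 * Real.log (5 / 2) +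
        2 * Real.log (1 / 2) - Real.log 350 := by
      intro i
      have hl : Real.log (1 / 2) = -Real.log 2 := by rw [one_div, Real.log_inv]
      fin_cases i <;> simp [e, Fin.sum_univ_six, step] <;> norm_num <;> rw [hl] <;> ring
    have hself : ell (step i) = Real.log (1 / 2) := by
      rw [ell, if_neg hz, ← h1]; norm_num
    rw [hval, hself]
    have : Real.log (7 / 2) + 2 * Real.log (5 / 2) - Real.log 350 = 4 * Real.log (1 / 2) := by
      have a1 : (2 : ℝ) * Real.log (5 / 2) = Real.log ((5 / 2) ^ 2) := by
        rw [Real.log_pow]; norm_num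
      have a2 : (4 : ℝ) * Real.log (1 / 2) = Real.log ((1 / 2) ^ 4) := by
        rw [Real.log_pow]; norm_num
      rw [a1, a2, ← Real.log_mul (by norm_num) (by norm_num),
        ← Real.log_div (by norm_num) (by norm_num)]
      norm_num
    linarith
  · have hn2 : 2 ≤ ‖pos z‖ ^ 2 := by
      rw [norm_pos_sq] at h1 ⊢
      have : 1 < z.1 ^ 2 + z.1 * z.2 + z.2 ^ 2 := by exact_mod_cast h1
      exact_mod_cast this
    have hne : ∀ i, z + step i ≠ 0 := by
      intro i h
      have : z = -step i := eq_neg_of_add_eq_zero_left h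
      rw [this, pos_neg, norm_neg, norm_pos_step] at h1
      norm_num at h1
    have hpos : ∀ i, 0 < ‖pos (z + step i)‖ ^ 2 + -(1 / 2) := fun i => by
      have := one_le_norm_pos_sq (hne i); linarith
    have e1 : ∀ i, ell (z + step i) = Real.log (‖pos (z + step i)‖ ^ 2 + -(1 / 2)) := fun i => by
      rw [ell, if_neg (hne i)]
    simp only [e1]
    rw [sum_log_six hpos, ell, if_neg hz]
    have h6 : 6 * Real.log (‖pos z‖ ^ 2 + -(1 / 2)) =
        Real.log ((‖pos z‖ ^ 2 + -(1 / 2)) ^ 6) := by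
      rw [Real.log_pow]; norm_num
    rw [h6, sub_nonpos]
    refine Real.log_le_log (Finset.prod_pos fun i _ => hpos i) ?_
    rw [norm_pos_add_step_sq]
    set n := ‖pos z‖ ^ 2
    have hX : 0 ≤ (n + 1 / 2) * (n ^ 2 - 2 * n + 1 / 4) := by
      have : 0 ≤ n ^ 2 - 2 * n + 1 / 4 := by nlinarith
      positivity
    have hXY : (n + 1 / 2) * (n ^ 2 - 2 * n + 1 / 4) ≤ (n - 1 / 2) ^ 3 := by nlinarith
    have := pow_le_pow_left₀ hX hXY 2
    nlinarith [sq_nonneg (((2 * z.1 + z.2) * (z.2 - z.1) * (z.1 + 2 * z.2) : ℝ))]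

/-- A function that grows like `2 log |z|` and is subharmonic. -/
def logBarrier (z : ℤ × ℤ) : ℝ := Real.log (‖pos z‖ ^ 2 + 1)

lemma lap_logBarrier_nonneg (z : ℤ × ℤ) : 0 ≤ lap logBarrier z := by
  rw [lap_eq]
  have hpos : ∀ i, 0 < ‖pos (z + step i)‖ ^ 2 + 1 := fun i => by positivity
  simp only [logBarrier]
  rw [sum_log_six hpos]
  have h6 : 6 * Real.log (‖pos z‖ ^ 2 + 1) = Real.log ((‖pos z‖ ^ 2 + 1) ^ 6) := by
    rw [Real.log_pow]; norm_num
  rw [h6, sub_nonneg]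
  refine Real.log_le_log (by positivity) ?_
  rw [norm_pos_add_step_sq]
  have hpi : ((2 * z.1 + z.2) * (z.2 - z.1) * (z.1 + 2 * z.2) : ℝ) ^ 2 ≤ 4 * (‖pos z‖ ^ 2) ^ 3 := by
    rw [norm_pos_sq']
    have : 0 ≤ 27 * ((z.1 : ℝ) * z.2 * (z.1 + z.2)) ^ 2 := by positivity
    linarith
  have hn : 0 ≤ ‖pos z‖ ^ 2 := by positivity
  set n := ‖pos z‖ ^ 2
  have : 0 ≤ 6 * n ^ 4 + 28 * n ^ 3 + 69 * n ^ 2 + 90 * n + 63 := by positivity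
  nlinarith

lemma lap_logBarrier_zero : lap logBarrier 0 = 6 * Real.log 2 := by
  simp [lap, logBarrier, pos_zero, norm_pos_step]
  norm_num

/-! ## Discs -/

/-- The vertices in an open disc. -/
def disc (y : ℤ × ℤ) (r : ℝ) : Finset (ℤ × ℤ) :=
  (finite_pos_preimage (A := Metric.ball (pos y) r) Metric.isBounded_ball).toFinset

lemma mem_disc {y z : ℤ × ℤ} {r : ℝ} : z ∈ disc y r ↔ ‖pos z - pos y‖ < r := by
  simp [disc, dist_eq_norm]

lemma norm_pos_add_step_le (z : ℤ × ℤ) (w : ℂ) (i : Fin 6) :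
    ‖pos (z + step i) - w‖ ≤ ‖pos z - w‖ + 1 := by
  rw [pos_add, add_sub_right_comm]
  exact (norm_add_le _ _).trans (by rw [norm_pos_step])

lemma lap_translate (f : ℤ × ℤ → ℝ) (w z : ℤ × ℤ) :
    lap (fun x => f (x - w)) z = lap f (z - w) := by
  simp only [lap, add_sub_right_comm]

/-! ## The Harnack inequality -/

lemma ell_le {z : ℤ × ℤ} {r : ℝ} (hr : 1 ≤ r) (h : ‖pos z‖ ≤ r) : ell z ≤ Real.log (r ^ 2) := by
  have hlog : 0 ≤ Real.log (r ^ 2) := Real.log_nonneg (one_le_pow₀ hr)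
  rw [ell]
  split_ifs with hz
  · have : 0 ≤ Real.log 350 := Real.log_nonneg (by norm_num)
    linarith
  · have h1 := one_le_norm_pos_sq hz
    refine Real.log_le_log (by linarith) ?_
    have := pow_le_pow_left₀ (norm_nonneg _) h 2
    linarith

lemma le_ell {z : ℤ × ℤ} {t : ℝ} (ht : 0 < t) (hz : z ≠ 0) (h : t ≤ ‖pos z‖ ^ 2 - 1 / 2) :
    Real.log t ≤ ell z := by
  rw [ell, if_neg hz]
  exact Real.log_le_log ht (by linarith)

/-- To be used for points in annuli whose indices differ by `d`, which are at least d - 1 apart. The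
constant 350 makes one formula cover the pole itself. -/
lemma le_ell_of_dist {z : ℤ × ℤ} (d : ℕ) (h : (d : ℝ) - 1 ≤ ‖pos z‖) (hz : 1 ≤ d → z ≠ 0) :
    Real.log ((d + 1 : ℝ) ^ 2 / 350) ≤ ell z := by
  rcases Nat.eq_zero_or_pos d with rfl | hd
  · by_cases hz0 : z = 0
    · rw [ell, if_pos hz0, ← Real.log_inv]; norm_num
    · refine le_ell (by norm_num) hz0 ?_
      have := one_le_norm_pos_sq hz0
      norm_num
      linarith
  · have hz0 := hz hd
    refine le_ell (by positivity) hz0 ?_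
    have h1 := one_le_norm_pos_sq hz0
    have hd1 : (1 : ℝ) ≤ d := by exact_mod_cast hd
    have h2 : ((d : ℝ) - 1) ^ 2 ≤ ‖pos z‖ ^ 2 := pow_le_pow_left₀ (by linarith) h 2
    rw [div_le_iff₀ (by norm_num)]
    rcases eq_or_lt_of_le (Nat.succ_le_of_lt hd) with h3 | h3
    · have : (d : ℝ) = 1 := by exact_mod_cast h3.symm
      rw [this]; linarith
    · have : (2 : ℝ) ≤ d := by exact_mod_cast h3
      nlinarith

lemma sum_inv_sqrt_le (N : ℕ) : ∑ d ∈ Finset.range N, (√(d + 1 : ℝ))⁻¹ ≤ 2 * √N := by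
  induction N with
  | zero => simp
  | succ n ih =>
    rw [Finset.sum_range_succ]
    have h1 : (√(n + 1 : ℝ))⁻¹ ≤ 2 * (√(n + 1 : ℝ) - √n) := by
      have hp : 0 < √(n + 1 : ℝ) := Real.sqrt_pos.2 (by positivity)
      rw [inv_le_iff_one_le_mul₀ hp]
      have e1 : √(n + 1 : ℝ) ^ 2 = n + 1 := Real.sq_sqrt (by positivity)
      have e2 : √(n : ℝ) ^ 2 = n := Real.sq_sqrt (by positivity)
      nlinarith [sq_nonneg (√(n + 1 : ℝ) - √n)]
    push_cast
    linarith

lemma sum_dist_le {F : ℕ → ℝ} (hF : ∀ d, 0 ≤ F d) {N j : ℕ} (hj : j < N) :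
    ∑ k ∈ Finset.range N, F (Nat.dist j k) ≤ 2 * ∑ d ∈ Finset.range N, F d := by
  rw [← Finset.sum_filter_add_sum_filter_not (Finset.range N) (fun k => k ≤ j), two_mul]
  have key : ∀ s : Finset ℕ, s ⊆ Finset.range N → Set.InjOn (Nat.dist j) s →
      ∑ k ∈ s, F (Nat.dist j k) ≤ ∑ d ∈ Finset.range N, F d := by
    intro s hs hinj
    rw [← Finset.sum_image (f := F) hinj]
    refine Finset.sum_le_sum_of_subset_of_nonneg (fun d hd => ?_) fun d _ _ => hF d
    obtain ⟨k, hk, rfl⟩ := Finset.mem_image.1 hd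
    have := Finset.mem_range.1 (hs hk)
    rw [Finset.mem_range, Nat.dist]
    omega
  refine add_le_add (key _ (Finset.filter_subset _ _) ?_) (key _ (Finset.filter_subset _ _) ?_)
  · intro k hk k' hk' h
    have h1 := (Finset.mem_filter.1 (Finset.mem_coe.1 hk)).2
    have h2 := (Finset.mem_filter.1 (Finset.mem_coe.1 hk')).2
    simp only [Nat.dist] at h
    omega
  · intro k hk k' hk' h
    have h1 := (Finset.mem_filter.1 (Finset.mem_coe.1 hk)).2
    have h2 := (Finset.mem_filter.1 (Finset.mem_coe.1 hk')).2
    simp only [Nat.dist] at h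
    omega

/-- Trading the logarithm for a square root, log t² ≤ 4√t, gives a bound that sums over `d` to order
N. The constants: 16² · 350 / 4 ≤ 150² and 4√150 ≤ 50. -/
lemma log_ratio_le {N : ℕ} (hN : 1 ≤ N) {s : ℝ} (hs : 0 < s) (hsN : s ≤ 16 * N) (d : ℕ) :
    Real.log (s ^ 2 / 4) - Real.log ((d + 1 : ℝ) ^ 2 / 350) ≤ 50 * √N * (√(d + 1 : ℝ))⁻¹ := by
  have hN0 : (0 : ℝ) < N := by exact_mod_cast hN
  set t : ℝ := 150 * N / (d + 1) with ht
  have htpos : 0 < t := by positivity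
  rw [← Real.log_div (by positivity) (by positivity)]
  have h1 : Real.log (s ^ 2 / 4 / ((d + 1 : ℝ) ^ 2 / 350)) ≤ Real.log (t ^ 2) := by
    refine Real.log_le_log (by positivity) ?_
    rw [ht, div_pow, div_div_eq_mul_div, div_le_div_iff_of_pos_right (by positivity)]
    nlinarith
  have h2 : Real.log (t ^ 2) ≤ 4 * √t := by
    have e : Real.log (t ^ 2) = 4 * Real.log (√t) := by
      rw [Real.log_sqrt htpos.le, Real.log_pow]; push_cast; ring
    have := Real.log_le_sub_one_of_pos (Real.sqrt_pos.2 htpos)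
    linarith
  have h3 : √t = √150 * √N * (√(d + 1 : ℝ))⁻¹ := by
    rw [ht, Real.sqrt_div (by positivity), Real.sqrt_mul (by norm_num)]; rfl
  have h4 : √(150 : ℝ) ≤ 12.5 := Real.sqrt_le_sqrt (by norm_num : (150 : ℝ) ≤ 12.5 ^ 2) |>.trans
    (by rw [Real.sqrt_sq (by norm_num)])
  have h5 : 0 ≤ √(N : ℝ) * (√(d + 1 : ℝ))⁻¹ := by positivity
  rw [h3] at h2
  nlinarith

/-- The maximum principle on the disc of radius `k`: one step out of it lands in the annulus between
k and k + 1. -/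
lemma exists_large_value {u : ℤ × ℤ → ℝ} {y : ℤ × ℤ} {s : ℝ}
    (hu : ∀ z, ‖pos z - pos y‖ < s → lap u z = 0) {k : ℕ} (hk : 1 ≤ k) (hks : (k : ℝ) ≤ s) :
    ∃ z, (k : ℝ) ≤ ‖pos z - pos y‖ ∧ ‖pos z - pos y‖ < k + 1 ∧ u y ≤ u z := by
  have hk' : (1 : ℝ) ≤ k := by exact_mod_cast hk
  obtain ⟨z, hz, i, hi, h⟩ := exists_boundary_ge (disc y k) u
    (fun z hz => (hu z ((mem_disc.1 hz).trans_le hks)).ge) (y := y)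
    (mem_disc.2 (by simp; linarith))
  refine ⟨z + step i, not_lt.1 fun h' => hi (mem_disc.2 h'), ?_, h⟩
  have := norm_pos_add_step_le z (pos y) i
  have := mem_disc.1 hz
  linarith

/-- The Harnack inequality for positive harmonic functions. -/
theorem harnack {u : ℤ × ℤ → ℝ} (hu0 : ∀ z, 0 ≤ u z) {y : ℤ × ℤ} {s : ℝ} (hs : 100 ≤ s)
    (hu : ∀ z, ‖pos z - pos y‖ < s → lap u z = 0) {x : ℤ × ℤ} (hx : ‖pos x - pos y‖ ≤ s / 8) :
    u y / 360 ≤ u x := by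
  -- Pick in each of N annuli around `y` a point p_k at which `u` is at least u(y). Spread over N
  -- scales these points have large capacity, which is expressed by the potential `W`, subharmonic
  -- off them. A multiple of `W` is compared with `u` on the disc of radius `s` minus the points.
  set N := ⌊s / 8⌋₊ with hN
  have hNle : (N : ℝ) ≤ s / 8 := Nat.floor_le (by linarith)
  have hNlt : s / 8 < N + 1 := Nat.lt_floor_add_one _
  have hN1 : 1 ≤ N := Nat.le_floor (by push_cast; linarith)
  have hN0 : (0 : ℝ) < N := by exact_mod_cast hN1
  have hex : ∀ k : ℕ, ∃ z, k < N → ((k + 1 : ℕ) : ℝ) ≤ ‖pos z - pos y‖ ∧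
      ‖pos z - pos y‖ < ((k + 1 : ℕ) : ℝ) + 1 ∧ u y ≤ u z := by
    intro k
    by_cases hk : k < N
    · have : ((k + 1 : ℕ) : ℝ) ≤ N := by exact_mod_cast hk
      obtain ⟨z, hz⟩ := exists_large_value hu (Nat.succ_pos k) (by linarith)
      exact ⟨z, fun _ => hz⟩
    · exact ⟨0, fun h => absurd h hk⟩
  choose p hp using hex
  have hpN : ∀ k < N, ‖pos (p k) - pos y‖ < N + 1 := fun k hk => by
    have h1 := (hp k hk).2.1
    have : ((k + 1 : ℕ) : ℝ) ≤ N := by exact_mod_cast hk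
    linarith
  let W : ℤ × ℤ → ℝ := fun x => ∑ k ∈ Finset.range N, (Real.log (s ^ 2 / 4) - ell (x - p k))
  -- far away
  have hfar : ∀ x, s ≤ ‖pos x - pos y‖ → W x ≤ 0 := by
    intro x hx
    refine Finset.sum_nonpos fun k hk => ?_
    have h1 := hpN k (Finset.mem_range.1 hk)
    have h2 : s - (N + 1) ≤ ‖pos (x - p k)‖ := by
      have e : pos x - pos y = (pos x - pos (p k)) + (pos (p k) - pos y) := by ring
      have := norm_add_le (pos x - pos (p k)) (pos (p k) - pos y)
      rw [← e] at this
      rw [pos_sub]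
      linarith
    have h3 : s - (s / 8 + 1) ≤ ‖pos (x - p k)‖ := by linarith
    rw [sub_nonpos]
    refine le_ell (by positivity) (fun h0 => ?_) ?_
    · rw [h0, pos_zero, norm_zero] at h3; linarith
    · have := pow_le_pow_left₀ (by linarith) h3 2
      nlinarith
  -- near the center
  have hnear : N * Real.log (9 / 4) ≤ W x := by
    have : ∀ k ∈ Finset.range N, Real.log (9 / 4) ≤ Real.log (s ^ 2 / 4) - ell (x - p k) := by
      intro k hk
      have h1 := hpN k (Finset.mem_range.1 hk)
      have h2 : ‖pos (x - p k)‖ ≤ s / 3 := by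
        have e : pos (x - p k) = (pos x - pos y) - (pos (p k) - pos y) := by rw [pos_sub]; ring
        rw [e]
        have := norm_sub_le (pos x - pos y) (pos (p k) - pos y)
        linarith
      have h3 := ell_le (by linarith) h2
      have h4 : Real.log (s ^ 2 / 4) = Real.log (9 / 4) + Real.log ((s / 3) ^ 2) := by
        rw [← Real.log_mul (by norm_num) (by positivity)]
        congr 1
        ring
      linarith
    have := Finset.sum_le_sum this
    rw [Finset.sum_const, Finset.card_range, nsmul_eq_mul] at this
    exact this
  -- at the poles
  have hpole : ∀ j < N, W (p j) ≤ N * 200 := by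
    intro j hj
    have h1 : W (p j) ≤ ∑ k ∈ Finset.range N,
        50 * √N * (√((Nat.dist j k : ℕ) + 1 : ℝ))⁻¹ := by
      refine Finset.sum_le_sum fun k hk => ?_
      have hk' := Finset.mem_range.1 hk
      refine le_trans ?_ (log_ratio_le hN1 (s := s) (by linarith) (by linarith) (Nat.dist j k))
      refine sub_le_sub_left (le_ell_of_dist _ ?_ ?_) _
      · have e1 : ‖pos (p j) - pos y‖ ≤ ‖pos (p j - p k)‖ + ‖pos (p k) - pos y‖ := by
          have := norm_add_le (pos (p j) - pos (p k)) (pos (p k) - pos y)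
          rwa [sub_add_sub_cancel, ← pos_sub (p j) (p k)] at this
        have e2 : ‖pos (p k) - pos y‖ ≤ ‖pos (p j - p k)‖ + ‖pos (p j) - pos y‖ := by
          have := norm_add_le (pos (p k) - pos (p j)) (pos (p j) - pos y)
          rw [sub_add_sub_cancel, norm_sub_rev (pos (p k)) (pos (p j)), ← pos_sub (p j) (p k)] at this
          exact this
        have a1 := hp j hj
        have a2 := hp k hk'
        push_cast at a1 a2
        rcases le_total j k with hjk | hjk
        · rw [Nat.dist_eq_sub_of_le hjk, Nat.cast_sub hjk]; linarith
        · rw [Nat.dist_eq_sub_of_le_right hjk, Nat.cast_sub hjk]; linarith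
      · intro hd h0
        have heq : p j = p k := sub_eq_zero.1 h0
        have a1 := hp j hj
        have a2 := hp k hk'
        rw [heq] at a1
        have b1 : ((k + 1 : ℕ) : ℝ) < ((j + 1 : ℕ) : ℝ) + 1 := by linarith
        have b2 : ((j + 1 : ℕ) : ℝ) < ((k + 1 : ℕ) : ℝ) + 1 := by linarith
        have b1' : k + 1 < j + 1 + 1 := by exact_mod_cast b1
        have b2' : j + 1 < k + 1 + 1 := by exact_mod_cast b2
        rw [Nat.dist] at hd
        omega
    rw [← Finset.mul_sum] at h1
    have h2 := sum_dist_le (F := fun d => (√(d + 1 : ℝ))⁻¹) (fun d => by positivity) hj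
    have h3 := sum_inv_sqrt_le N
    have h4 : √(N : ℝ) * √N = N := Real.mul_self_sqrt hN0.le
    have h5 : 50 * √N * ∑ k ∈ Finset.range N, (√((Nat.dist j k : ℕ) + 1 : ℝ))⁻¹ ≤
        50 * √N * (2 * (2 * √N)) := by
      refine mul_le_mul_of_nonneg_left (h2.trans ?_) (by positivity)
      linarith
    nlinarith
  have hcomp := le_of_lap_le (disc y s \ (Finset.range N).image p)
    (fun z => u y / (N * 200) * W z) u ?_ ?_ x
  · refine le_trans ?_ hcomp
    -- `W` is at least 5N/9 near the center and at most 200N at the poles, and (5/9) / 200 = 1/360.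
    have hlog : 5 / 9 ≤ Real.log (9 / 4) := by
      have := Real.one_sub_inv_le_log_of_pos (by norm_num : (0 : ℝ) < 9 / 4)
      norm_num at this ⊢
      linarith
    have h1 : N * (5 / 9) ≤ W x := le_trans (by gcongr) hnear
    calc u y / 360 = u y / (N * 200) * (N * (5 / 9)) := by field_simp; ring
      _ ≤ _ := by
        have := hu0 y
        gcongr
  · intro z hz
    obtain ⟨hz1, hz2⟩ := Finset.mem_sdiff.1 hz
    rw [hu z (mem_disc.1 hz1), lap_const_mul]
    refine mul_nonneg (div_nonneg (hu0 y) (by positivity)) ?_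
    simp only [W]
    rw [lap_sum]
    refine Finset.sum_nonneg fun k hk => ?_
    rw [lap_sub, lap_const, lap_translate]
    have : z - p k ≠ 0 := fun h0 => hz2 (Finset.mem_image.2 ⟨k, hk, (sub_eq_zero.1 h0).symm⟩)
    linarith [lap_ell_nonpos this]
  · intro z hz
    rw [Finset.mem_sdiff, not_and_or, not_not] at hz
    rcases hz with hz | hz
    · have := hfar z (not_lt.1 fun h => hz (mem_disc.2 h))
      exact (mul_nonpos_of_nonneg_of_nonpos (div_nonneg (hu0 y) (by positivity)) this).trans (hu0 z)
    · obtain ⟨k, hk, rfl⟩ := Finset.mem_image.1 hz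
      have hk' := Finset.mem_range.1 hk
      refine le_trans ?_ (hp k hk').2.2
      calc u y / (N * 200) * W (p k) ≤ u y / (N * 200) * (N * 200) :=
            mul_le_mul_of_nonneg_left (hpole k hk') (div_nonneg (hu0 y) (by positivity))
        _ = u y := by field_simp

/-! ## Hitting probabilities of simple random walk -/

/-- Put a first step in front of a sequence of steps. -/
def consStep (p : Fin 6 × (ℕ → Fin 6)) : ℕ → Fin 6 := fun n => Nat.casesOn n p.1 p.2

lemma measurable_consStep : Measurable consStep := by
  refine measurable_pi_lambda _ fun n => ?_
  cases n with
  | zero => exact measurable_fst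
  | succ n => exact (measurable_pi_apply n).comp measurable_snd

instance : IsProbabilityMeasure stepLaw := by
  unfold stepLaw; infer_instance

/-- Prepending an independent uniform step does not change the law, as is checked on cylinder sets.
First-step analysis of the walk rests on this. -/
lemma map_consStep :
    ((PMF.uniformOfFintype (Fin 6)).toMeasure.prod stepLaw).map consStep = stepLaw := by
  refine Measure.eq_infinitePi _ fun s t ht => ?_
  set μ := (PMF.uniformOfFintype (Fin 6)).toMeasure
  obtain ⟨N, hN⟩ := s.exists_nat_subset_range
  let t' : ℕ → Set (Fin 6) := fun n => if n ∈ s then t n else Set.univ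
  have ht' : ∀ n, MeasurableSet (t' n) := fun n => (Set.to_countable _).measurableSet
  have hpre : consStep ⁻¹' Set.pi s t =
      t' 0 ×ˢ Set.pi (Finset.range N) fun n => t' (n + 1) := by
    ext ⟨i, ω⟩
    simp only [Set.mem_preimage, Set.mem_pi, Set.mem_prod, Finset.mem_coe, Finset.mem_range]
    constructor
    · intro h
      refine ⟨?_, fun n _ => ?_⟩
      · by_cases h0 : 0 ∈ s
        · simpa [t', h0, consStep] using h 0 h0
        · simp [t', h0]
      · by_cases h0 : n + 1 ∈ s
        · simpa [t', h0, consStep] using h _ h0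
        · simp [t', h0]
    · rintro ⟨h0, h1⟩ n hn
      cases n with
      | zero => simpa [t', hn, consStep] using h0
      | succ n =>
        have := Finset.mem_range.1 (hN hn)
        simpa [t', hn, consStep] using h1 n (by omega)
  have hprod : ∏ n ∈ s, μ (t n) = ∏ n ∈ Finset.range (N + 1), μ (t' n) := by
    have h1 : ∏ n ∈ s, μ (t n) = ∏ n ∈ s, μ (t' n) :=
      Finset.prod_congr rfl fun n hn => by simp [t', hn]
    rw [h1]
    refine Finset.prod_subset (hN.trans (Finset.range_mono (Nat.le_succ N))) fun n _ hn => ?_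
    simp [t', hn]
  rw [Measure.map_apply measurable_consStep (MeasurableSet.pi s.countable_toSet fun n _ => ht n),
    hpre, Measure.prod_prod, stepLaw, Measure.infinitePi_pi _ fun n _ => ht' (n + 1), hprod,
    Finset.prod_range_succ', mul_comm]

/-- The event that the walk from `v` hits `A` before exiting `K`. -/
def hitEvent (v : ℤ × ℤ) (A : Set (ℤ × ℤ)) (K : Set ℂ) : Set (ℕ → Fin 6) :=
  {ω | ∃ n, walk v ω n ∈ A ∧ ∀ m ≤ n, pos (walk v ω m) ∈ K}

lemma measurable_walk (v : ℤ × ℤ) (n : ℕ) : Measurable fun ω => walk v ω n := by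
  unfold walk
  refine measurable_const.add (Finset.measurable_sum _ fun i _ => ?_)
  exact (measurable_of_countable step).comp (measurable_pi_apply i)

lemma measurableSet_hitEvent (v : ℤ × ℤ) (A : Set (ℤ × ℤ)) (K : Set ℂ) :
    MeasurableSet (hitEvent v A K) := by
  have : hitEvent v A K = ⋃ n, ((fun ω => walk v ω n) ⁻¹' A ∩
      ⋂ m, ⋂ (_ : m ≤ n), (fun ω => walk v ω m) ⁻¹' (pos ⁻¹' K)) := by
    ext ω; simp [hitEvent]
  rw [this]
  refine MeasurableSet.iUnion fun n => (measurable_walk v n (Set.to_countable _).measurableSet).inter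
    (MeasurableSet.iInter fun m => MeasurableSet.iInter fun _ =>
      measurable_walk v m (Set.to_countable _).measurableSet)

lemma walk_consStep_succ (v : ℤ × ℤ) (i : Fin 6) (ω : ℕ → Fin 6) (n : ℕ) :
    walk v (consStep (i, ω)) (n + 1) = walk (v + step i) ω n := by
  rw [walk, walk, Finset.sum_range_succ', add_comm _ (step _), ← add_assoc]
  rfl

lemma consStep_mem_hitEvent {v : ℤ × ℤ} {A : Set (ℤ × ℤ)} {K : Set ℂ} (hK : pos v ∈ K)
    (hA : v ∉ A) (i : Fin 6) (ω : ℕ → Fin 6) :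
    consStep (i, ω) ∈ hitEvent v A K ↔ ω ∈ hitEvent (v + step i) A K := by
  have h0 : ∀ ω, walk v ω 0 = v := fun ω => by simp [walk]
  constructor
  · rintro ⟨n, hn, hm⟩
    cases n with
    | zero => rw [h0] at hn; exact absurd hn hA
    | succ n =>
      refine ⟨n, by rwa [walk_consStep_succ] at hn, fun m hmn => ?_⟩
      rw [← walk_consStep_succ]
      exact hm _ (by omega)
  · rintro ⟨n, hn, hm⟩
    refine ⟨n + 1, by rwa [walk_consStep_succ], fun m hmn => ?_⟩
    cases m with
    | zero => rwa [h0]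
    | succ m => rw [walk_consStep_succ]; exact hm _ (by omega)

lemma lap_hitProb {v : ℤ × ℤ} {A : Set (ℤ × ℤ)} {K : Set ℂ} (hK : pos v ∈ K) (hA : v ∉ A) :
    lap (fun x => hitProb x A K) v = 0 := by
  have h : stepLaw (hitEvent v A K) = ∑ i : Fin 6, 6⁻¹ * stepLaw (hitEvent (v + step i) A K) := by
    nth_rw 1 [← map_consStep]
    rw [Measure.map_apply measurable_consStep (measurableSet_hitEvent _ _ _),
      Measure.prod_apply (measurable_consStep (measurableSet_hitEvent _ _ _)), lintegral_fintype]
    refine Finset.sum_congr rfl fun i _ => ?_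
    rw [PMF.toMeasure_apply_singleton _ _ (measurableSet_singleton _),
      PMF.uniformOfFintype_apply, Fintype.card_fin, mul_comm]
    congr 2
    ext ω
    exact consStep_mem_hitEvent hK hA i ω
  have h' : hitProb v A K = ∑ i : Fin 6, 6⁻¹ * hitProb (v + step i) A K := by
    have := congrArg ENNReal.toReal h
    rw [ENNReal.toReal_sum fun i _ => ENNReal.mul_ne_top (by simp) (measure_ne_top _ _)] at this
    simpa [hitProb, Measure.real, hitEvent] using this
  rw [lap_eq, h', ← Finset.mul_sum]
  ring

lemma hitProb_nonneg (v : ℤ × ℤ) (A : Set (ℤ × ℤ)) (K : Set ℂ) : 0 ≤ hitProb v A K :=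
  measureReal_nonneg

lemma hitProb_le_one (v : ℤ × ℤ) (A : Set (ℤ × ℤ)) (K : Set ℂ) : hitProb v A K ≤ 1 :=
  measureReal_le_one

lemma hitProb_eq_zero {v : ℤ × ℤ} {A : Set (ℤ × ℤ)} {K : Set ℂ} (hK : pos v ∉ K) :
    hitProb v A K = 0 := by
  have : hitEvent v A K = ∅ := by
    refine Set.eq_empty_of_forall_notMem ?_
    rintro ω ⟨n, -, hm⟩
    exact hK (by simpa [walk] using hm 0 (Nat.zero_le _))
  change stepLaw.real (hitEvent v A K) = 0
  rw [this, measureReal_empty]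

/-! ## Geometry of hexagon balls -/

lemma exists_norm_pos_sub_le (w : ℂ) : ∃ v, ‖pos v - w‖ ≤ 1 := by
  have h3 : 0 < √3 := Real.sqrt_pos.2 (by norm_num)
  have h3' : √3 * √3 = 3 := Real.mul_self_sqrt (by norm_num)
  set b := round (w.im * 2 / √3) with hb
  set a := round (w.re - b / 2) with ha
  refine ⟨(a, b), ?_⟩
  have h1 := abs_sub_round (w.im * 2 / √3)
  have h2 := abs_sub_round (w.re - b / 2)
  rw [← hb] at h1
  rw [← ha] at h2
  have hre : (pos (a, b) - w).re = -(w.re - b / 2 - a) := by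
    simp [pos]; ring
  have him : (pos (a, b) - w).im = -(w.im * 2 / √3 - b) * (√3 / 2) := by
    simp [pos]; field_simp
  rw [← Real.sqrt_one, ← Real.sqrt_sq (norm_nonneg _)]
  refine Real.sqrt_le_sqrt ?_
  rw [← Complex.normSq_eq_norm_sq, Complex.normSq_apply, hre, him]
  have e1 := sq_le_sq' (abs_le.1 h1).1 (abs_le.1 h1).2
  have e2 := sq_le_sq' (abs_le.1 h2).1 (abs_le.1 h2).2
  nlinarith

lemma eq_of_pos_eq {v w : ℤ × ℤ} (h : pos v = pos w) : v = w := by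
  by_contra hne
  have := one_le_norm_pos (sub_ne_zero.2 hne)
  rw [pos_sub, h, sub_self, norm_zero] at this
  norm_num at this

lemma pos_mem_hexBall {R : ℝ} {v : ℤ × ℤ} :
    pos v ∈ hexBall R ↔ (hexagon v ∩ Metric.ball (0 : ℂ) R).Nonempty := by
  constructor
  · intro h
    obtain ⟨⟨w, hw⟩, hv⟩ := Set.mem_iUnion.1 h
    have e : dist (pos v) (pos w) ≤ 0 := by simpa using hv v
    rwa [eq_of_pos_eq (dist_le_zero.1 e)]
  · intro h
    exact Set.mem_iUnion.2 ⟨⟨v, h⟩, fun w => by simp⟩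

lemma pos_mem_hexBall_of_lt {R : ℝ} {v : ℤ × ℤ} (h : ‖pos v‖ < R) : pos v ∈ hexBall R :=
  pos_mem_hexBall.2 ⟨pos v, fun w => by simp, by simpa using h⟩

lemma norm_pos_lt_add_one {R : ℝ} {v : ℤ × ℤ} (h : pos v ∈ hexBall R) : ‖pos v‖ < R + 1 := by
  obtain ⟨z, hz, hzR⟩ := pos_mem_hexBall.1 h
  obtain ⟨w, hw⟩ := exists_norm_pos_sub_le z
  have h1 := hz w
  rw [dist_comm z (pos w), dist_comm, dist_eq_norm, dist_eq_norm] at h1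
  have h2 : ‖z‖ < R := by simpa using hzR
  have h3 := norm_add_le (pos v - z) z
  rw [sub_add_cancel] at h3
  linarith

/-- The vertices in a hexagon ball. -/
def ballFinset (R : ℝ) : Finset (ℤ × ℤ) :=
  ((finite_pos_preimage (A := Metric.ball 0 (R + 1)) Metric.isBounded_ball).subset
    (t := pos ⁻¹' hexBall R) fun _ hv => by simpa using norm_pos_lt_add_one hv).toFinset

lemma mem_ballFinset {R : ℝ} {v : ℤ × ℤ} : v ∈ ballFinset R ↔ pos v ∈ hexBall R := by
  simp [ballFinset]

/-! ## A chain of Harnack inequalities -/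

/-- Move from `x` towards the origin, gaining at least s/10 in norm at the cost of a factor 360 per
move; the discs of radius `s` stay inside the ball of radius `T`. -/
lemma harnack_chain {u : ℤ × ℤ → ℝ} (hu0 : ∀ z, 0 ≤ u z) {T s : ℝ} (hs : 100 ≤ s)
    (hu : ∀ z, ‖pos z‖ < T → lap u z = 0) (n : ℕ) (x : ℤ × ℤ) (hx : ‖pos x‖ ≤ T - s)
    (hn : ‖pos x‖ ≤ n * (s / 10)) : u 0 / 360 ^ n ≤ u x := by
  induction n generalizing x with
  | zero =>
    have : x = 0 := by
      by_contra h
      have := one_le_norm_pos h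
      simp at hn
      rw [hn, norm_zero] at this
      norm_num at this
    simp [this]
  | succ n ih =>
    by_cases h : ‖pos x‖ ≤ s / 10 + 1
    · have := harnack hu0 (y := 0) (x := x) hs (fun z hz => hu z ?_) ?_
      · refine le_trans ?_ this
        refine div_le_div_of_nonneg_left (hu0 0) (by norm_num) ?_
        exact le_self_pow₀ (by norm_num) (Nat.succ_ne_zero n)
      · rw [pos_zero, sub_zero] at hz
        linarith [norm_nonneg (pos x)]
      · rw [pos_zero, sub_zero]; linarith
    · push Not at h
      set N := ‖pos x‖ with hN
      have hN0 : 0 < N := by linarith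
      -- A lattice point within 1 of the point s/10 + 1 closer to the origin. Thus |y| ≤ |x| - s/10,
      -- while |x - y| ≤ s/10 + 2 ≤ s/8 because s ≥ 100.
      obtain ⟨y, hy⟩ := exists_norm_pos_sub_le (((1 - (s / 10 + 1) / N : ℝ) : ℂ) * pos x)
      have h1 : ‖((1 - (s / 10 + 1) / N : ℝ) : ℂ) * pos x‖ = N - (s / 10 + 1) := by
        rw [norm_mul, Complex.norm_real, Real.norm_of_nonneg, ← hN]
        · field_simp
        · rw [sub_nonneg, div_le_one hN0]; exact h.le
      have h2 : ‖pos x - ((1 - (s / 10 + 1) / N : ℝ) : ℂ) * pos x‖ = s / 10 + 1 := by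
        have e : pos x - ((1 - (s / 10 + 1) / N : ℝ) : ℂ) * pos x =
            (((s / 10 + 1) / N : ℝ) : ℂ) * pos x := by push_cast; ring
        rw [e, norm_mul, Complex.norm_real, Real.norm_of_nonneg (by positivity), ← hN]
        field_simp
      have hyN : ‖pos y‖ ≤ N - s / 10 := by
        have := norm_add_le (pos y - ((1 - (s / 10 + 1) / N : ℝ) : ℂ) * pos x)
          (((1 - (s / 10 + 1) / N : ℝ) : ℂ) * pos x)
        rw [sub_add_cancel] at this
        linarith
      have hxy : ‖pos x - pos y‖ ≤ s / 8 := by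
        have := norm_sub_le (pos x - ((1 - (s / 10 + 1) / N : ℝ) : ℂ) * pos x)
          (pos y - ((1 - (s / 10 + 1) / N : ℝ) : ℂ) * pos x)
        rw [sub_sub_sub_cancel_right] at this
        linarith
      push_cast at hn
      have hy' := ih y (by linarith) (by linarith)
      have := harnack hu0 hs (fun z hz => hu z ?_) hxy
      · refine le_trans ?_ this
        rw [pow_succ, ← div_div]
        linarith
      · have := norm_add_le (pos z - pos y) (pos y)
        rw [sub_add_cancel] at this
        linarith

/-! ## Green's function off a ball -/

lemma lap_congr {f g : ℤ × ℤ → ℝ} {z : ℤ × ℤ} (h : f z = g z)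
    (h' : ∀ i, f (z + step i) = g (z + step i)) : lap f z = lap g z := by
  simp only [lap, h, h']

/-- If `u` bounds from below the probability of being absorbed before exiting `K`, then Green's
function with a pole in `B ⊆ K` is bounded off `B`. -/
lemma green_le_div {Ω B : Finset (ℤ × ℤ)} {K : Set (ℤ × ℤ)} {u F : ℤ × ℤ → ℝ} {v : ℤ × ℤ}
    {p c : ℝ} (hp : 0 < p) (hc : 0 ≤ c) (hv : v ∈ B) (hBK : ∀ z ∈ B, z ∈ K)
    (hu1 : ∀ z, u z ≤ 1) (hu : ∀ z ∈ Ω, z ∈ K → lap u z = 0) (hu0 : ∀ z ∉ K, u z = 0)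
    (hF0 : ∀ z, 0 ≤ F z) (hF : ∀ z ∈ Ω, z ∈ K → lap F z ≤ if z = v then -1 else 0)
    (hB : ∀ z ∈ B, (∃ i, z + step i ∉ B) → F z ≤ c ∧ p ≤ u z) {w : ℤ × ℤ} (hw : w ∉ B) :
    green Ω v w ≤ c / p := by
  classical
  by_cases hwΩ : w ∈ Ω
  swap
  · rw [green_of_notMem v hwΩ]; positivity
  -- Let m be the maximum off `B`. Inside `K`, Green's function is at most F + m(1 - u), since a
  -- walk absorbed before exiting contributes no return from outside. On the rim of `B` this is at
  -- most c + m(1 - p).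
  obtain ⟨y, hy, hmax⟩ := (Ω \ B).exists_max_image (green Ω v) ⟨w, Finset.mem_sdiff.2 ⟨hwΩ, hw⟩⟩
  refine (hmax w (Finset.mem_sdiff.2 ⟨hwΩ, hw⟩)).trans ?_
  set m := green Ω v y
  have hm0 : 0 ≤ m := green_nonneg _ _ _
  have hoff : ∀ z ∉ B, green Ω v z ≤ m := fun z hz => by
    by_cases hzΩ : z ∈ Ω
    · exact hmax z (Finset.mem_sdiff.2 ⟨hzΩ, hz⟩)
    · rw [green_of_notMem v hzΩ]; exact hm0
  have hcmp := le_of_lap_le (Ω.filter (· ∈ K)) (green Ω v) (fun z => F z + m * (1 - u z))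
    (fun z hz => by
      obtain ⟨hzΩ, hzK⟩ := Finset.mem_filter.1 hz
      rw [lap_green v hzΩ, lap_add, lap_const_mul, lap_sub, lap_const, hu z hzΩ hzK]
      simpa using hF z hzΩ hzK)
    (fun z hz => by
      have h1 := hF0 z
      by_cases hzK : z ∈ K
      · have hzΩ : z ∉ Ω := fun h => hz (Finset.mem_filter.2 ⟨h, hzK⟩)
        rw [green_of_notMem v hzΩ]
        exact add_nonneg h1 (mul_nonneg hm0 (sub_nonneg.2 (hu1 z)))
      · have := hoff z fun h => hzK (hBK z h)
        rw [hu0 z hzK]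
        linarith)
  -- The maximum over `Ω \ B` is dominated at an exit vertex, either off `Ω`, where Green's function
  -- is zero, or on the rim of `B`. The latter gives m ≤ c + m(1 - p).
  obtain ⟨z, hz, i, hi, hyz⟩ := exists_boundary_ge (Ω \ B) (green Ω v) (fun z hz => by
    obtain ⟨hzΩ, hzB⟩ := Finset.mem_sdiff.1 hz
    rw [lap_green v hzΩ, if_neg]
    rintro rfl
    exact hzB hv) hy
  by_cases hzΩ : z + step i ∈ Ω
  · have hzB : z + step i ∈ B := by
      by_contra h
      exact hi (Finset.mem_sdiff.2 ⟨hzΩ, h⟩)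
    obtain ⟨h1, h2⟩ := hB _ hzB ⟨i + 3, by
      rw [step_add_three, add_neg_cancel_right]; exact (Finset.mem_sdiff.1 hz).2⟩
    have h3 := hcmp (z + step i)
    rw [le_div_iff₀ hp]
    nlinarith
  · rw [green_of_notMem v hzΩ] at hyz
    exact hyz.trans (by positivity)

/-! ### Explicit constants for Green's function off the inner ball. -/

/-- The truncated logarithmic potential with pole `v`. -/
def logPotential (T : ℝ) (v z : ℤ × ℤ) : ℝ :=
  max 0 ((Real.log T - logBarrier (z - v)) / (6 * Real.log 2))

/-- The hypothesis makes the truncation inactive at `z` and its neighbors. The divisor 6 log 2 is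
the Laplacian of `logBarrier` at its center, so the pole has weight -1. -/
lemma lap_logPotential_le {T : ℝ} {v z : ℤ × ℤ} (h : (‖pos z - pos v‖ + 1) ^ 2 + 1 ≤ T) :
    lap (logPotential T v) z ≤ if z = v then -1 else 0 := by
  have hl : 0 < 6 * Real.log 2 := by have := Real.log_pos one_lt_two; linarith
  have key : ∀ w : ℤ × ℤ, ‖pos w - pos v‖ ≤ ‖pos z - pos v‖ + 1 →
      logPotential T v w = (Real.log T - logBarrier (w - v)) / (6 * Real.log 2) := by
    intro w hw
    refine max_eq_right (div_nonneg (sub_nonneg.2 (Real.log_le_log (by positivity) ?_)) hl.le)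
    rw [pos_sub]
    have := pow_le_pow_left₀ (norm_nonneg _) hw 2
    linarith
  have e : lap (logPotential T v) z =
      lap (fun w => (6 * Real.log 2)⁻¹ * (Real.log T - logBarrier (w - v))) z := by
    refine lap_congr ?_ fun i => ?_
    · rw [key z (by linarith), div_eq_inv_mul]
    · rw [key _ (norm_pos_add_step_le z _ i), div_eq_inv_mul]
  rw [e, lap_const_mul, lap_sub, lap_const, lap_translate]
  split_ifs with hz
  · rw [hz, sub_self, lap_logBarrier_zero, zero_sub, mul_neg, inv_mul_cancel₀ hl.ne']
  · rw [zero_sub, mul_neg, neg_nonpos]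
    exact mul_nonneg (inv_nonneg.2 hl.le) (lap_logBarrier_nonneg _)

lemma logPotential_le {T r c : ℝ} {v z : ℤ × ℤ} (hT : 0 < T) (hr : 0 < r)
    (h : r ≤ ‖pos z - pos v‖) (hc : Real.log (T / r ^ 2) ≤ c * (6 * Real.log 2)) (hc0 : 0 ≤ c) :
    logPotential T v z ≤ c := by
  have hl : 0 < 6 * Real.log 2 := by have := Real.log_pos one_lt_two; linarith
  refine max_le hc0 ?_
  rw [div_le_iff₀ hl]
  refine le_trans ?_ hc
  rw [Real.log_div hT.ne' (by positivity)]
  refine sub_le_sub_left (Real.log_le_log (by positivity) ?_) _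
  rw [pos_sub]
  have := pow_le_pow_left₀ hr.le h 2
  linarith

/-- A bound for the hitting probability near the outer layer of the inner ball. -/
def hitBound (C : ℝ) : ℝ := 1 / C / 360 ^ ⌈100 * C⌉₊

/-- A bound for Green's function off the inner ball. -/
def greenBound (C : ℝ) : ℝ :=
  Real.log (121 * 256 * C ^ 2) / (6 * Real.log 2) / hitBound C

lemma hitBound_pos {C : ℝ} (hC : 1 < C) : 0 < hitBound C := by
  have : 0 < C := by linarith
  unfold hitBound; positivity

lemma log_const_nonneg {C : ℝ} (hC : 1 < C) :
    0 ≤ Real.log (121 * 256 * C ^ 2) / (6 * Real.log 2) :=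
  div_nonneg (Real.log_nonneg (by nlinarith)) (by have := Real.log_pos one_lt_two; linarith)

lemma greenBound_nonneg {C : ℝ} (hC : 1 < C) : 0 ≤ greenBound C :=
  div_nonneg (log_const_nonneg hC) (hitBound_pos hC).le

/-- The layer of the cut-offs keeps a distance of order R/C from the rim of `B`, which bounds the
potential there. From the rim the walk reaches `P ∪ M` with probability at least `hitBound C`. -/
lemma green_le_greenBound {C R R₁ R₂ R₃ : ℝ} (hC : 1 < C) (hR : 10 ^ 3 * C < R)
    (h₁₂ : R₁ + C⁻¹ * R < R₂) (h₂₃ : R₂ + C⁻¹ * R < R₃) (h₃ : R₃ < 5 * R) {P M : Set (ℤ × ℤ)}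
    (hPM : ∀ v ∈ P ∪ M, pos v ∉ hexBall R₃) (hit : 1 / C ≤ hitProb 0 (M ∪ P) (hexBall (5 * R)))
    (J : Finset (ℤ × ℤ)) {v w : ℤ × ℤ} (hv : ‖pos v‖ ≤ R₁ + 7 / 8 * (C⁻¹ * R) + 1)
    (hw : w ∉ ballFinset R₂) : green (free J P M) w v ≤ greenBound C := by
  have hC0 : 0 < C := by linarith
  set δ := C⁻¹ * R with hδ
  have hRδ : R = C * δ := by rw [hδ]; field_simp
  have hδ' : 1000 ≤ δ := by
    by_contra hlt
    push Not at hlt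
    rw [hRδ] at hR
    nlinarith
  have hR' : 1000 ≤ R := by nlinarith
  rw [green_symm]
  -- Symmetry has moved the pole into `B`. Distances from it to points of the ball of radius 5R,
  -- plus one, are at most 10.1R, so T = 121R² avoids truncation.
  refine green_le_div (K := pos ⁻¹' hexBall (5 * R))
    (u := fun x => hitProb x (M ∪ P) (hexBall (5 * R)))
    (F := logPotential (121 * R ^ 2) v) (hitBound_pos hC)
    (log_const_nonneg hC) ?_ ?_ ?_ ?_ ?_ ?_ ?_ ?_ hw
  · exact mem_ballFinset.2 (pos_mem_hexBall_of_lt (by linarith))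
  · intro z hz
    have := norm_pos_lt_add_one (mem_ballFinset.1 hz)
    exact pos_mem_hexBall_of_lt (by linarith)
  · exact fun z => hitProb_le_one _ _ _
  · intro z hz hzK
    refine lap_hitProb hzK ?_
    have := mem_free.1 hz
    simp [this.2.1, this.2.2]
  · exact fun z hz => hitProb_eq_zero hz
  · exact fun z => le_max_left _ _
  · intro z hz hzK
    refine lap_logPotential_le ?_
    have h1 := norm_pos_lt_add_one hzK
    have h2 := norm_sub_le (pos z) (pos v)
    have h3 : ‖pos z - pos v‖ + 1 ≤ 10.1 * R := by linarith
    have h4 := pow_le_pow_left₀ (by positivity) h3 2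
    nlinarith
  · rintro z hz ⟨i, hi⟩
    have hz1 := norm_pos_lt_add_one (mem_ballFinset.1 hz)
    have hz2 : R₂ ≤ ‖pos (z + step i)‖ :=
      not_lt.1 fun h => hi (mem_ballFinset.2 (pos_mem_hexBall_of_lt h))
    have hz3 := norm_pos_add_step_le z 0 i
    rw [sub_zero, sub_zero] at hz3
    constructor
    -- The rim of `B` lies beyond R₁ + δ - 1 and the pole within R₁ + 7δ/8 + 1; the gap δ/8 - 2
    -- exceeds δ/16. Then T / r² = 121 · 256 · C².
    · refine logPotential_le (r := δ / 16) (by positivity) (by linarith) ?_ ?_ (log_const_nonneg hC)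
      · have := norm_sub_norm_le (pos z) (pos v)
        linarith
      · have hl : 0 < 6 * Real.log 2 := by have := Real.log_pos one_lt_two; linarith
        rw [div_mul_cancel₀ _ hl.ne']
        refine (congrArg Real.log ?_).le
        have : δ ≠ 0 := by linarith
        rw [hRδ]
        field_simp
        ring
    -- Moves of length s/10 = δ/20: at least 100C of them cover 5Cδ = 5R, which exceeds the norm of
    -- every rim vertex.
    · have := harnack_chain (u := fun x => hitProb x (M ∪ P) (hexBall (5 * R))) (T := R₃)
        (s := δ / 2) (fun z => hitProb_nonneg _ _ _) (by linarith) (fun z hz => ?_)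
        ⌈100 * C⌉₊ z (by linarith) ?_
      · refine le_trans ?_ this
        exact div_le_div_of_nonneg_right hit (by positivity)
      · refine lap_hitProb (pos_mem_hexBall_of_lt (by linarith)) fun h => ?_
        exact hPM z h.symm (pos_mem_hexBall_of_lt hz)
      · have h1 := Nat.le_ceil (100 * C)
        have h2 : 100 * C * (δ / 2 / 10) ≤ ⌈100 * C⌉₊ * (δ / 2 / 10) := by gcongr
        rw [hRδ] at h₃
        linarith

/-! ## The cutoffs -/

/-- The continuous piecewise linear function that is zero up to `a` and one from `b` on. -/
def ramp (a b t : ℝ) : ℝ := max 0 (min 1 ((t - a) / (b - a)))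

lemma ramp_of_le {a b t : ℝ} (hab : a < b) (h : t ≤ a) : ramp a b t = 0 :=
  max_eq_left ((min_le_right _ _).trans (div_nonpos_of_nonpos_of_nonneg (by linarith) (by linarith)))

lemma ramp_of_ge {a b t : ℝ} (hab : a < b) (h : b ≤ t) : ramp a b t = 1 := by
  have : 1 ≤ (t - a) / (b - a) := by rw [le_div_iff₀ (by linarith)]; linarith
  rw [ramp, min_eq_left this, max_eq_right zero_le_one]

lemma abs_ramp_sub_le {a b : ℝ} (hab : a < b) (s t : ℝ) :
    |ramp a b s - ramp a b t| ≤ |s - t| / (b - a) := by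
  have h1 := abs_max_sub_max_le_abs (min 1 ((s - a) / (b - a))) (min 1 ((t - a) / (b - a))) 0
  have h2 := abs_min_sub_min_le_max 1 ((s - a) / (b - a)) 1 ((t - a) / (b - a))
  rw [ramp, ramp, max_comm 0, max_comm 0]
  refine h1.trans (h2.trans (max_le ?_ ?_))
  · rw [sub_self, abs_zero]
    exact div_nonneg (abs_nonneg _) (by linarith)
  · rw [← sub_div, sub_sub_sub_cancel_right, abs_div, abs_of_pos (sub_pos.2 hab)]

lemma abs_norm_pos_sub_le {u v : ℤ × ℤ} (h : TG.Adj u v) : |‖pos u‖ - ‖pos v‖| ≤ 1 := by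
  have h1 : dist (pos u) (pos v) = 1 := h
  have := abs_norm_sub_norm_le (pos u) (pos v)
  rwa [← dist_eq_norm, h1] at this

lemma cutoffEnergy_one_le {A : Finset (ℤ × ℤ)} {f : ℤ × ℤ → ℝ} {κ : ℝ}
    (h : ∀ u v, TG.Adj u v → |f v - f u| ≤ κ) :
    cutoffEnergy A f (fun _ => 1) ≤ 3 * A.card * κ ^ 2 := by
  classical
  have key : ∀ u ∈ A, (∑ v ∈ A, if TG.Adj u v then (f v - f u) ^ 2 * ((1 + 1 : ℝ) / 2) else 0) ≤
      6 * κ ^ 2 := by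
    intro u _
    rw [← Finset.sum_filter]
    have h6 : (A.filter fun v => TG.Adj u v).card ≤ 6 := by
      have hsub : (A.filter fun v => TG.Adj u v) ⊆ Finset.univ.image fun i => u + step i := by
        intro v hv
        obtain ⟨i, rfl⟩ := (adj_iff u v).1 (Finset.mem_filter.1 hv).2
        exact Finset.mem_image_of_mem _ (Finset.mem_univ i)
      exact (Finset.card_le_card hsub).trans (Finset.card_image_le.trans (by simp))
    have h6' : ((A.filter fun v => TG.Adj u v).card : ℝ) ≤ 6 := by exact_mod_cast h6
    refine (Finset.sum_le_card_nsmul _ _ (κ ^ 2) fun v hv => ?_).trans ?_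
    · have := sq_le_sq' (abs_le.1 (h u v (Finset.mem_filter.1 hv).2)).1
        (abs_le.1 (h u v (Finset.mem_filter.1 hv).2)).2
      linarith
    · rw [nsmul_eq_mul]
      exact mul_le_mul_of_nonneg_right h6' (sq_nonneg κ)
  have := Finset.sum_le_card_nsmul _ _ _ key
  rw [nsmul_eq_mul] at this
  refine (mul_le_mul_of_nonneg_left this (by norm_num : (0 : ℝ) ≤ 1 / 2)).trans (le_of_eq ?_)
  ring

lemma card_nbhd_ballFinset_le {R r : ℝ} (hR : 1 ≤ R) (hr : r + 2 ≤ 6 * R) :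
    ((nbhd (ballFinset r)).card : ℝ) ≤ 225 * R ^ 2 := by
  set N := ⌊7 * R⌋₊
  have hN : (N : ℝ) ≤ 7 * R := Nat.floor_le (by linarith)
  have hsub : nbhd (ballFinset r) ⊆
      Finset.Icc (-(N : ℤ)) N ×ˢ Finset.Icc (-(N : ℤ)) N := by
    intro z hz
    have hz6 : ‖pos z‖ < 6 * R := by
      rcases Finset.mem_union.1 hz with h | h
      · have := norm_pos_lt_add_one (mem_ballFinset.1 h)
        linarith
      · obtain ⟨y, hy, h⟩ := Finset.mem_biUnion.1 h
        obtain ⟨i, -, rfl⟩ := Finset.mem_image.1 h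
        have h1 := norm_pos_lt_add_one (mem_ballFinset.1 hy)
        have h2 := norm_pos_add_step_le y 0 i
        rw [sub_zero, sub_zero] at h2
        linarith
    have hsq := pow_le_pow_left₀ (norm_nonneg _) hz6.le 2
    rw [norm_pos_sq'] at hsq
    have key : ∀ a b : ℤ, (a : ℝ) ^ 2 + a * b + (b : ℝ) ^ 2 ≤ (6 * R) ^ 2 →
        a ∈ Finset.Icc (-(N : ℤ)) N := by
      intro a b h
      have h1 : |(a : ℝ)| ≤ 7 * R :=
        abs_le_of_sq_le_sq (by nlinarith [sq_nonneg ((a : ℝ) + 2 * b)]) (by linarith)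
      have h2 : a.natAbs ≤ N := Nat.le_floor (by rwa [Nat.cast_natAbs, Int.cast_abs])
      rw [Finset.mem_Icc]
      omega
    exact Finset.mem_product.2 ⟨key z.1 z.2 hsq, key z.2 z.1 (by linarith)⟩
  have h1 := Finset.card_le_card hsub
  rw [Finset.card_product, Int.card_Icc] at h1
  have h2 : ((N : ℤ) + 1 - -(N : ℤ)).toNat = 2 * N + 1 := by omega
  rw [h2] at h1
  have h3 : ((nbhd (ballFinset r)).card : ℝ) ≤ (2 * N + 1) * (2 * N + 1) := by exact_mod_cast h1
  nlinarith

/-- A bound for the energy of the cutoffs. -/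
def energyBound (C : ℝ) : ℝ := 388800 * C ^ 2

/-- Between radii R₁ and R₁ + δ, with δ = R/C, the profile ψ rises over [δ/8, δ/4], φ falls over
[δ/2, 3δ/4] and ψ falls over [13δ/16, 7δ/8]. The gaps are longer than an edge, so ψ = 1 around every
edge on which φ varies. The steepest contribution is bounded by 8/δ + 16/δ = 24/δ, and 3 · 225 · 24²
= 388800. -/
lemma exists_cutoff {C R R₁ R₂ : ℝ} (hC : 1 < C) (hR : 10 ^ 3 * C < R)
    (h₁₂ : R₁ + C⁻¹ * R < R₂) (h₂ : R₂ ≤ 5 * R) {S : Set (ℤ × ℤ)}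
    (hS : ∀ v ∈ S, pos v ∈ hexBall R₁) :
    ∃ φ ψ : ℤ × ℤ → ℝ, Cutoff (ballFinset R₂) S φ ψ ∧
      cutoffEnergy (nbhd (ballFinset R₂)) φ (fun _ => 1) ≤ energyBound C ∧
      cutoffEnergy (nbhd (ballFinset R₂)) ψ (fun _ => 1) ≤ energyBound C ∧
      ∀ u v, TG.Adj u v → (φ u ≠ φ v ∨ ψ u ≠ ψ v) →
        ‖pos u‖ ≤ R₁ + 7 / 8 * (C⁻¹ * R) + 1 := by
  have hC0 : 0 < C := by linarith
  set δ := C⁻¹ * R with hδ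
  have hRδ : R = C * δ := by rw [hδ]; field_simp
  have hδ' : 1000 ≤ δ := by
    by_contra hlt
    push Not at hlt
    rw [hRδ] at hR
    nlinarith
  have hR' : 1000 ≤ R := by nlinarith
  have ha : R₁ + δ / 8 < R₁ + δ / 4 := by linarith
  have hb : R₁ + δ / 2 < R₁ + 3 * δ / 4 := by linarith
  have hc : R₁ + 13 * δ / 16 < R₁ + 7 * δ / 8 := by linarith
  have hE : ∀ f : ℤ × ℤ → ℝ, (∀ u v, TG.Adj u v → |f v - f u| ≤ 24 / δ) →
      cutoffEnergy (nbhd (ballFinset R₂)) f (fun _ => 1) ≤ energyBound C := by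
    intro f hf
    refine (cutoffEnergy_one_le hf).trans ?_
    have := card_nbhd_ballFinset_le (R := R) (r := R₂) (by linarith) (by linarith)
    calc 3 * ((nbhd (ballFinset R₂)).card : ℝ) * (24 / δ) ^ 2
        ≤ 3 * (225 * R ^ 2) * (24 / δ) ^ 2 := by gcongr
      _ = energyBound C := by
        rw [energyBound, hRδ]
        have : δ ≠ 0 := by linarith
        field_simp
        norm_num
  have hramp : ∀ a b : ℝ, a < b → ∀ u v, TG.Adj u v →
      |ramp a b ‖pos v‖ - ramp a b ‖pos u‖| ≤ 1 / (b - a) := by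
    intro a b hab u v h
    refine (abs_ramp_sub_le hab _ _).trans (div_le_div_of_nonneg_right ?_ (by linarith))
    exact abs_norm_pos_sub_le h.symm
  have hB : ∀ z ∉ ballFinset R₂, R₁ + δ ≤ ‖pos z‖ := fun z hz => by
    have : R₂ ≤ ‖pos z‖ := not_lt.1 fun h => hz (mem_ballFinset.2 (pos_mem_hexBall_of_lt h))
    linarith
  have hS' : ∀ z ∈ S, ‖pos z‖ ≤ R₁ + δ / 8 := fun z hz => by
    have := norm_pos_lt_add_one (hS z hz)
    linarith
  refine ⟨fun z => 1 - ramp (R₁ + δ / 2) (R₁ + 3 * δ / 4) ‖pos z‖,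
    fun z => ramp (R₁ + δ / 8) (R₁ + δ / 4) ‖pos z‖ -
      ramp (R₁ + 13 * δ / 16) (R₁ + 7 * δ / 8) ‖pos z‖, ⟨?_, ?_, ?_, ?_, ?_⟩, hE _ ?_, hE _ ?_, ?_⟩
  · intro z hz
    have := hB z hz
    rw [ramp_of_ge hb (by linarith), sub_self]
  · intro z hz
    have := hS' z hz
    rw [ramp_of_le hb (by linarith), sub_zero]
  · intro z hz
    have := hB z hz
    rw [ramp_of_ge ha (by linarith), ramp_of_ge hc (by linarith), sub_self]
  · intro z hz
    have := hS' z hz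
    rw [ramp_of_le ha (by linarith), ramp_of_le hc (by linarith), sub_self]
  · intro z
    have hz : ∀ i, |‖pos z‖ - ‖pos (z + step i)‖| ≤ 1 := fun i =>
      abs_norm_pos_sub_le ((adj_iff _ _).2 ⟨i, rfl⟩)
    rcases lt_or_ge ‖pos z‖ (R₁ + δ / 4) with h1 | h1
    · refine .inr fun i => ?_
      have := abs_le.1 (hz i)
      rw [ramp_of_le hb (by linarith), ramp_of_le hb (by linarith)]
    · rcases lt_or_ge (R₁ + 13 * δ / 16) ‖pos z‖ with h2 | h2
      · refine .inr fun i => ?_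
        have := abs_le.1 (hz i)
        rw [ramp_of_ge hb (by linarith), ramp_of_ge hb (by linarith)]
      · left
        rw [ramp_of_ge ha h1, ramp_of_le hc h2, sub_zero]
  · intro u v h
    have := hramp _ _ hb u v h
    rw [sub_sub_sub_cancel_left, abs_sub_comm]
    refine this.trans ?_
    rw [div_le_div_iff₀ (by linarith) (by linarith)]
    linarith
  · intro u v h
    have h1 := hramp _ _ ha u v h
    have h2 := hramp _ _ hc u v h
    rw [sub_sub_sub_comm]
    refine (abs_sub _ _).trans ((add_le_add h1 h2).trans (le_of_eq ?_))
    have : δ ≠ 0 := by linarith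
    have e1 : R₁ + δ / 4 - (R₁ + δ / 8) = δ / 8 := by ring
    have e2 : R₁ + 7 * δ / 8 - (R₁ + 13 * δ / 16) = δ / 16 := by ring
    rw [e1, e2]
    field_simp
    norm_num
  · intro u v h hne
    by_contra! hu
    have huv := abs_le.1 (abs_norm_pos_sub_le h)
    simp only at hne
    rw [ramp_of_ge hb (by linarith), ramp_of_ge hb (by linarith), ramp_of_ge ha (by linarith),
      ramp_of_ge hc (by linarith), ramp_of_ge ha (by linarith), ramp_of_ge hc (by linarith)] at hne
    simp at hne

/-! ## Edges that leave a grid domain -/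

lemma one_le_norm_pos_sub {v w : ℤ × ℤ} (h : v ≠ w) : 1 ≤ ‖pos v - pos w‖ := by
  rw [← pos_sub]
  exact one_le_norm_pos (sub_ne_zero.2 h)

/-- A point of an edge other than its ends lies on no other edge. -/
lemma eq_or_eq_of_mem_segment {v w a b : ℤ × ℤ} (hvw : TG.Adj v w) (hab : TG.Adj a b) {z : ℂ}
    (hz : z ∈ segment ℝ (pos v) (pos w)) (hzv : z ≠ pos v) (hzw : z ≠ pos w)
    (hz' : z ∈ segment ℝ (pos a) (pos b)) : v = a ∨ v = b := by
  by_contra! hne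
  obtain ⟨hva, hvb⟩ := hne
  have hvw1 : ‖pos w - pos v‖ = 1 := by rw [← dist_eq_norm, dist_comm]; exact hvw
  have hab1 : ‖pos b - pos a‖ = 1 := by rw [← dist_eq_norm, dist_comm]; exact hab
  rw [segment_eq_image'] at hz hz'
  obtain ⟨t, ⟨ht0, ht1⟩, rfl⟩ := hz
  obtain ⟨s, ⟨hs0, hs1⟩, hs⟩ := hz'
  simp only [Complex.real_smul] at hs hzv hzw
  have ht0' : 0 < t := lt_of_le_of_ne ht0 (by rintro rfl; simp at hzv)
  have ht1' : t < 1 := lt_of_le_of_ne ht1 (by rintro rfl; simp at hzw)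
  have nt : ∀ r : ℝ, 0 ≤ r → ‖(r : ℂ) * (pos w - pos v)‖ = r := fun r hr => by
    rw [norm_mul, hvw1, mul_one, Complex.norm_real, Real.norm_of_nonneg hr]
  have ns : ∀ r : ℝ, 0 ≤ r → ‖(r : ℂ) * (pos b - pos a)‖ = r := fun r hr => by
    rw [norm_mul, hab1, mul_one, Complex.norm_real, Real.norm_of_nonneg hr]
  have e1 : pos v - pos a = (s : ℂ) * (pos b - pos a) - (t : ℂ) * (pos w - pos v) := by
    linear_combination -hs
  have e2 : pos v - pos b = -(((1 - s : ℝ) : ℂ) * (pos b - pos a)) - (t : ℂ) * (pos w - pos v) := by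
    push_cast; linear_combination -hs
  have e3 : pos w - pos a = (s : ℂ) * (pos b - pos a) + ((1 - t : ℝ) : ℂ) * (pos w - pos v) := by
    push_cast; linear_combination -hs
  have e4 : pos w - pos b =
      ((1 - t : ℝ) : ℂ) * (pos w - pos v) - (((1 - s : ℝ) : ℂ) * (pos b - pos a)) := by
    push_cast; linear_combination -hs
  have h1 := one_le_norm_pos_sub hva
  have h2 := one_le_norm_pos_sub hvb
  have h1' : 1 ≤ s + t := by
    rw [e1] at h1
    have := norm_sub_le ((s : ℂ) * (pos b - pos a)) ((t : ℂ) * (pos w - pos v))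
    rw [nt t ht0, ns s hs0] at this
    linarith
  have h2' : 1 ≤ 1 - s + t := by
    rw [e2] at h2
    have := norm_sub_le (-(((1 - s : ℝ) : ℂ) * (pos b - pos a))) ((t : ℂ) * (pos w - pos v))
    rw [norm_neg, nt t ht0, ns (1 - s) (by linarith)] at this
    linarith
  -- If the edges share the end `w`, equal lengths along the same ray make the other ends coincide.
  -- Otherwise four triangle inequalities force s = t = 1/2, and the parallelogram law gives |v -
  -- a|² + |v - b|² = 1, although both terms are at least one.
  by_cases hwa : w = a
  · rw [hwa, sub_self] at e3
    have e : (s : ℂ) * (pos b - pos a) = -(((1 - t : ℝ) : ℂ) * (pos w - pos v)) := by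
      rw [hwa]; linear_combination -e3
    have hn := congrArg norm e
    rw [norm_neg, ns s hs0, nt (1 - t) (by linarith)] at hn
    rw [← hn, hwa] at e
    have hs' : (s : ℂ) ≠ 0 := by
      intro h0
      have : s = 0 := by exact_mod_cast h0
      linarith
    have : (s : ℂ) * (pos b - pos v) = 0 := by linear_combination e
    exact hvb (eq_of_pos_eq (sub_eq_zero.1 ((mul_eq_zero.1 this).resolve_left hs')).symm)
  by_cases hwb : w = b
  · rw [hwb, sub_self] at e4
    have e : ((1 - t : ℝ) : ℂ) * (pos w - pos v) = ((1 - s : ℝ) : ℂ) * (pos b - pos a) := by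
      rw [hwb]; linear_combination -e4
    have hn := congrArg norm e
    rw [ns (1 - s) (by linarith), nt (1 - t) (by linarith)] at hn
    rw [hn, hwb] at e
    have hs' : ((1 - s : ℝ) : ℂ) ≠ 0 := by
      intro h0
      have : 1 - s = 0 := by exact_mod_cast h0
      linarith
    have : ((1 - s : ℝ) : ℂ) * (pos a - pos v) = 0 := by linear_combination e
    exact hva (eq_of_pos_eq (sub_eq_zero.1 ((mul_eq_zero.1 this).resolve_left hs')).symm)
  have h3 := one_le_norm_pos_sub hwa
  have h4 := one_le_norm_pos_sub hwb
  have h3' : 1 ≤ s + (1 - t) := by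
    rw [e3] at h3
    have := norm_add_le ((s : ℂ) * (pos b - pos a)) (((1 - t : ℝ) : ℂ) * (pos w - pos v))
    rw [nt (1 - t) (by linarith), ns s hs0] at this
    linarith
  have h4' : 1 ≤ (1 - t) + (1 - s) := by
    rw [e4] at h4
    have := norm_sub_le (((1 - t : ℝ) : ℂ) * (pos w - pos v)) (((1 - s : ℝ) : ℂ) * (pos b - pos a))
    rw [nt (1 - t) (by linarith), ns (1 - s) (by linarith)] at this
    linarith
  have hs2 : s = 1 / 2 := by linarith
  have ht2 : t = 1 / 2 := by linarith
  have par := parallelogram_law_with_norm ℝ ((s : ℂ) * (pos b - pos a)) ((t : ℂ) * (pos w - pos v))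
  have e2' : pos v - pos b = -((s : ℂ) * (pos b - pos a) + (t : ℂ) * (pos w - pos v)) := by
    rw [e2, hs2]; push_cast; ring
  rw [← e1, ← norm_neg (_ + _), ← e2', ns s hs0, nt t ht0, hs2, ht2] at par
  nlinarith

/-- An edge leaving the closure would cross the boundary in its interior, but the boundary is drawn
with grid edges and these meet only at vertices. Hence all six neighbors of an inner vertex belong
to the graph carrying the field. -/
lemma GridDomain.pos_mem_closure (D : GridDomain) {v w : ℤ × ℤ} (hv : pos v ∈ D.carrier)
    (h : TG.Adj v w) : pos w ∈ closure D.carrier := by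
  by_contra hw
  have hvf : pos v ∉ frontier D.carrier := fun h' => by
    rw [D.isOpen.frontier_eq] at h'; exact h'.2 hv
  have hwf : pos w ∉ frontier D.carrier := fun h' => hw (frontier_subset_closure h')
  have hpre : IsPreconnected (segment ℝ (pos v) (pos w)) :=
    (convex_segment _ _).isPreconnected
  have : (segment ℝ (pos v) (pos w) ∩ frontier D.carrier).Nonempty := by
    by_contra hemp
    rw [Set.not_nonempty_iff_eq_empty] at hemp
    obtain ⟨z, -, hz1, hz2⟩ := hpre D.carrier (closure D.carrier)ᶜ D.isOpen
      isClosed_closure.isOpen_compl (fun z hz => by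
        by_cases hzc : z ∈ closure D.carrier
        · left
          by_contra hzD
          have : z ∈ segment ℝ (pos v) (pos w) ∩ frontier D.carrier :=
            ⟨hz, by rw [D.isOpen.frontier_eq]; exact ⟨hzc, hzD⟩⟩
          rw [hemp] at this
          exact this
        · exact .inr hzc)
      ⟨pos v, left_mem_segment _ _ _, hv⟩ ⟨pos w, right_mem_segment _ _ _, hw⟩
    exact hz2 (subset_closure hz1)
  obtain ⟨z, hz, hzf⟩ := this
  have hzv : z ≠ pos v := by rintro rfl; exact hvf hzf
  have hzw : z ≠ pos w := by rintro rfl; exact hwf hzf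
  obtain ⟨H, hH⟩ := D.frontier_eq
  have hvH : v ∉ H.verts := fun hvH => hvf (by rw [hH]; exact .inl ⟨v, hvH, rfl⟩)
  have hzf' := hzf
  rw [hH] at hzf'
  rcases hzf' with ⟨u, hu, rfl⟩ | ⟨a, b, hab, hzab⟩
  -- A boundary vertex may be isolated in the subgraph, so two grid edges at `u` are used: `v`
  -- cannot be the far end of both.
  · have hu' : TG.Adj u (u + step 0) := (adj_iff _ _).2 ⟨0, rfl⟩
    rcases eq_or_eq_of_mem_segment h hu' hz hzv hzw (left_mem_segment _ _ _) with rfl | h'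
    · exact hzv rfl
    · have hu2 : TG.Adj u (u + step 1) := (adj_iff _ _).2 ⟨1, rfl⟩
      rcases eq_or_eq_of_mem_segment h hu2 hz hzv hzw (left_mem_segment _ _ _) with rfl | h''
      · exact hzv rfl
      · rw [h'] at h''
        exact absurd (step_injective (add_left_cancel h'')) (by decide)
  · rcases eq_or_eq_of_mem_segment h (H.adj_sub hab) hz hzv hzw hzab with rfl | rfl
    · exact hvH (H.edge_vert hab)
    · exact hvH (H.edge_vert hab.symm)

/-! ## The law of the field -/

section Transfer

variable {A : Set (ℤ × ℤ)} {Bd : Set A} {J : Finset (ℤ × ℤ)}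

/-- The free vertices of the graph induced on `A`. -/
def freeEquiv (hBd : ∀ v : A, v ∈ Bd ↔ v.1 ∉ J) (hA : ∀ z ∈ J, z ∈ A) : ↥Bdᶜ ≃ J where
  toFun v := ⟨v.1.1, by
    have := v.2
    rw [Set.mem_compl_iff, hBd, not_not] at this
    exact this⟩
  invFun z := ⟨⟨z.1, hA z.1 z.2⟩, by simp [hBd]⟩

/-- Reading a configuration on the free vertices as a function on `J`. -/
def reindex (hBd : ∀ v : A, v ∈ Bd ↔ v.1 ∉ J) (hA : ∀ z ∈ J, z ∈ A) :
    (↥Bdᶜ → ℝ) ≃ᵐ (J → ℝ) :=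
  MeasurableEquiv.piCongrLeft (fun _ => ℝ) (freeEquiv hBd hA)

lemma reindex_apply (hBd : ∀ v : A, v ∈ Bd ↔ v.1 ∉ J) (hA : ∀ z ∈ J, z ∈ A) (x : ↥Bdᶜ → ℝ)
    (v : ↥Bdᶜ) (h : v.1.1 ∈ J) : reindex hBd hA x ⟨v.1.1, h⟩ = x v :=
  MeasurableEquiv.piCongrLeft_apply_apply (β := fun _ => ℝ) (freeEquiv hBd hA) x v

lemma glue_eq_ext (hBd : ∀ v : A, v ∈ Bd ↔ v.1 ∉ J) (hA : ∀ z ∈ J, z ∈ A) {β : A → ℝ}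
    {b : ℤ × ℤ → ℝ} (hβ : ∀ v ∈ Bd, β v = b v.1) (x : ↥Bdᶜ → ℝ) (v : A) :
    glue Bd β x v = ext J b (reindex hBd hA x) v.1 := by
  unfold glue
  split_ifs with h
  · rw [ext_of_notMem _ _ ((hBd v).1 h), hβ v h]
  · have hJ : v.1 ∈ J := by by_contra h'; exact h ((hBd v).2 h')
    rw [ext_of_mem _ _ hJ]
    exact (reindex_apply hBd hA x ⟨v, h⟩ hJ).symm

lemma measurable_glue (β : A → ℝ) : Measurable (glue Bd β) := by
  refine measurable_pi_lambda _ fun v => ?_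
  unfold glue
  split_ifs with h
  · exact measurable_const
  · exact measurable_pi_apply _

lemma measurableSet_signEvent (P M : Set (ℤ × ℤ)) : MeasurableSet (signEvent A P M) := by
  have : signEvent A P M = (⋂ v : A, ⋂ _ : v.1 ∈ P, {x | 0 < x v}) ∩
      ⋂ v : A, ⋂ _ : v.1 ∈ M, {x | x v < 0} := by
    ext x; simp [signEvent]
  rw [this]
  refine (MeasurableSet.iInter fun v => MeasurableSet.iInter fun _ => ?_).inter
    (MeasurableSet.iInter fun v => MeasurableSet.iInter fun _ => ?_)
  · exact measurableSet_lt measurable_const (measurable_pi_apply v)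
  · exact measurableSet_lt (measurable_pi_apply v) measurable_const

variable [Fintype A]

/-- As `A` contains all neighbors of `J`, the induced graph has every edge touching `J`. The
remaining edges contribute a constant, which cancels on normalization. -/
lemma dirichletEnergy_ext (hA : ∀ z ∈ nbhd J, z ∈ A) (b : ℤ × ℤ → ℝ) (x : J → ℝ) :
    dirichletEnergy (TG.induce A) (fun v => ext J b x v.1) =
      2 * action J b x + dirichletEnergy (TG.induce A) fun v => ext J b (fun _ => 0) v.1 := by
  classical
  have hsum : ∀ F : ℤ × ℤ → ℤ × ℤ → ℝ, (∑ u : A, ∑ v : A,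
      @ite ℝ ((TG.induce A).Adj u v) (Classical.propDecidable _) (F u.1 v.1) 0) = ∑ u ∈ A.toFinset, ∑ v ∈ A.toFinset, if TG.Adj u v then F u v else 0 := by
    intro F
    rw [← Finset.sum_set_coe A (f := fun u => ∑ v ∈ A.toFinset, if TG.Adj u v then F u v else 0)]
    refine Finset.sum_congr rfl fun u _ => ?_
    rw [← Finset.sum_set_coe A (f := fun v => if TG.Adj u.1 v then F u.1 v else 0)]
    exact Finset.sum_congr rfl fun v _ => if_congr Iff.rfl rfl rfl
  have hA' : nbhd J ⊆ A.toFinset := fun z hz => Set.mem_toFinset.2 (hA z hz)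
  have hk : ∀ z ∉ J, ext J (fun _ => 0) x z = 0 := fun z hz => ext_of_notMem _ _ hz
  unfold dirichletEnergy
  beta_reduce
  rw [hsum fun u v => (ext J b x v - ext J b x u) ^ 2,
    hsum fun u v => (ext J b (fun _ => 0) v - ext J b (fun _ => 0) u) ^ 2, action,
    form_eq_sum hA' hk, form_eq_sum hA' hk]
  simp only [Finset.mul_sum, ← Finset.sum_add_distrib]
  refine Finset.sum_congr rfl fun u _ => Finset.sum_congr rfl fun v _ => ?_
  split_ifs
  · rw [congrFun (ext_eq_add J b x) u, congrFun (ext_eq_add J b x) v]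
    ring
  · ring

open Classical in
lemma dgffWeight_preimage (hBd : ∀ v : A, v ∈ Bd ↔ v.1 ∉ J) (hA : ∀ z ∈ nbhd J, z ∈ A)
    {β : A → ℝ} {b : ℤ × ℤ → ℝ} (hβ : ∀ v ∈ Bd, β v = b v.1) {S : Set (J → ℝ)}
    (hS : MeasurableSet S) :
    dgffWeight (TG.induce A) Bd β (reindex hBd (fun z hz => hA z (subset_nbhd J hz)) ⁻¹' S) =
      ENNReal.ofReal (Real.exp (-(1 / 2) *
        dirichletEnergy (TG.induce A) fun v => ext J b (fun _ => 0) v.1)) * fieldMeasure J b S := by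
  set T := reindex hBd (fun z hz => hA z (subset_nbhd J hz))
  have hT : MeasurePreserving T volume volume := volume_measurePreserving_piCongrLeft _ _
  have hm : Measurable fun x => ENNReal.ofReal (Real.exp (-action J b x)) :=
    (((continuous_action J b).neg.rexp).measurable).ennreal_ofReal
  rw [dgffWeight, withDensity_apply _ (T.measurable hS), fieldMeasure, withDensity_apply _ hS,
    ← lintegral_const_mul _ hm, ← hT.setLIntegral_comp_preimage hS (hm.const_mul _)]
  refine lintegral_congr fun x => ?_
  rw [← ENNReal.ofReal_mul (Real.exp_nonneg _), ← Real.exp_add]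
  have : glue Bd β x = fun v => ext J b (T x) v.1 := funext fun v => glue_eq_ext hBd _ hβ x v
  rw [this, dirichletEnergy_ext hA]
  congr 2
  ring

/-- The probability of a sign event under the discrete Gaussian free field. -/
lemma dgff_real_signEvent (hBd : ∀ v : A, v ∈ Bd ↔ v.1 ∉ J) (hA : ∀ z ∈ nbhd J, z ∈ A)
    {β : A → ℝ} {b : ℤ × ℤ → ℝ} (hβ : ∀ v ∈ Bd, β v = b v.1) {P M : Set (ℤ × ℤ)}
    (hP : ∀ v ∈ P, v ∈ J) (hM : ∀ v ∈ M, v ∈ J) :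
    (dgff (TG.induce A) Bd β).real (signEvent A P M) =
      (fieldMeasure J b).real (signs J P M) / (fieldMeasure J b).real Set.univ := by
  have hA' : ∀ z ∈ J, z ∈ A := fun z hz => hA z (subset_nbhd J hz)
  have hpre : glue Bd β ⁻¹' signEvent A P M = reindex hBd hA' ⁻¹' signs J P M := by
    ext x
    simp only [Set.mem_preimage, signEvent, signs, Set.mem_ofPred_eq, glue_eq_ext hBd hA' hβ x]
    constructor
    · rintro ⟨h1, h2⟩
      exact ⟨fun v hv => by simpa using h1 ⟨v.1, hA' _ v.2⟩ hv,
        fun v hv => by simpa using h2 ⟨v.1, hA' _ v.2⟩ hv⟩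
    · rintro ⟨h1, h2⟩
      refine ⟨fun v hv => ?_, fun v hv => ?_⟩
      · rw [ext_of_mem _ _ (hP _ hv)]; exact h1 ⟨v.1, hP _ hv⟩ hv
      · rw [ext_of_mem _ _ (hM _ hv)]; exact h2 ⟨v.1, hM _ hv⟩ hv
  have huniv := dgffWeight_preimage hBd hA hβ (MeasurableSet.univ (α := J → ℝ))
  rw [Set.preimage_univ] at huniv
  rw [measureReal_def, dgff, Measure.map_apply (measurable_glue β) (measurableSet_signEvent P M),
    hpre, Measure.smul_apply, dgffWeight_preimage hBd hA hβ (measurableSet_signs J P M), huniv,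
    smul_eq_mul, ENNReal.toReal_mul, ENNReal.toReal_inv, ENNReal.toReal_mul, ENNReal.toReal_mul,
    ENNReal.toReal_ofReal (Real.exp_nonneg _), measureReal_def, measureReal_def, mul_inv]
  have := Real.exp_ne_zero (-(1 / 2) *
        dirichletEnergy (TG.induce A) fun v => ext J b (fun _ => 0) v.1)
  field_simp

end Transfer

/-! ## The comparison for the fields on a domain and on a ball -/

lemma pos_mem_hexBall_of_add_one_le {r R : ℝ} (h : r + 1 ≤ R) {v : ℤ × ℤ}
    (hv : pos v ∈ hexBall r) : pos v ∈ hexBall R :=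
  pos_mem_hexBall_of_lt ((norm_pos_lt_add_one hv).trans_le h)

/-- The vertices in a grid domain. -/
def GridDomain.interior (D : GridDomain) : Finset (ℤ × ℤ) :=
  (finite_pos_preimage D.isBounded).toFinset

lemma GridDomain.mem_interior {D : GridDomain} {v : ℤ × ℤ} :
    v ∈ D.interior ↔ pos v ∈ D.carrier := by
  simp [GridDomain.interior]

lemma GridDomain.pos_mem_frontier {D : GridDomain} {v : ℤ × ℤ} :
    pos v ∈ frontier D.carrier ↔ pos v ∈ closure D.carrier ∧ v ∉ D.interior := by
  rw [D.isOpen.frontier_eq, GridDomain.mem_interior]; rfl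

lemma GridDomain.field_real_signEvent (D : GridDomain) {f b : ℤ × ℤ → ℝ}
    (h : ∀ v, pos v ∈ frontier D.carrier → f v = b v) {P M : Set (ℤ × ℤ)}
    (hP : ∀ v ∈ P, v ∈ D.interior) (hM : ∀ v ∈ M, v ∈ D.interior) :
    (D.field f).real (signEvent D.vertices P M) =
      (fieldMeasure D.interior b).real (signs D.interior P M) /
        (fieldMeasure D.interior b).real Set.univ := by
  refine dgff_real_signEvent (fun v => ?_) (fun z hz => ?_) (fun v hv => h _ hv) hP hM
  · exact GridDomain.pos_mem_frontier.trans ⟨fun h => h.2, fun h => ⟨v.2, h⟩⟩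
  · rcases Finset.mem_union.1 hz with h | h
    · exact subset_closure (GridDomain.mem_interior.1 h)
    · obtain ⟨y, hy, h⟩ := Finset.mem_biUnion.1 h
      obtain ⟨i, -, rfl⟩ := Finset.mem_image.1 h
      exact D.pos_mem_closure (GridDomain.mem_interior.1 hy) ((adj_iff _ _).2 ⟨i, rfl⟩)

lemma ballField_real_signEvent {R : ℝ} {P M : Set (ℤ × ℤ)}
    (hP : ∀ v ∈ P, v ∈ ballFinset R) (hM : ∀ v ∈ M, v ∈ ballFinset R) :
    (ballField R).real (signEvent (ballVertices R) P M) =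
      (fieldMeasure (ballFinset R) fun _ => 0).real (signs (ballFinset R) P M) /
        (fieldMeasure (ballFinset R) fun _ => 0).real Set.univ := by
  refine dgff_real_signEvent (A := ballVertices R) (b := fun _ => 0) (fun v => ?_) (fun z hz => ?_)
    (fun v hv => rfl) hP hM
  · exact mem_ballFinset.not.symm
  · rcases Finset.mem_union.1 hz with h | h
    · exact .inl (mem_ballFinset.1 h)
    · obtain ⟨y, hy, h⟩ := Finset.mem_biUnion.1 h
      obtain ⟨i, -, rfl⟩ := Finset.mem_image.1 h
      exact .inr ⟨y, mem_ballFinset.1 hy, ((adj_iff _ _).2 ⟨i, rfl⟩ : TG.Adj y _).symm⟩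

end TriGrid

end

/-! ### Near independence. -/

theorem propositionp (Λ C : ℝ) (hΛ : 0 < Λ) (hC : 1 < C) :
    ∃ c : ℝ, 0 < c ∧
      ∀ (D : GridDomain) (hbd : ℤ × ℤ → ℝ),
        (∀ v : ℤ × ℤ, pos v ∈ frontier D.carrier → |hbd v| ≤ Λ) →
      ∀ R R₁ R₂ R₃ : ℝ,
        10 ^ 3 * C < R →
        hexBall (5 * R) ⊆ D.carrier →
        R₁ ∈ Set.Icc R (5 * R) → R₂ ∈ Set.Icc R (5 * R) → R₃ ∈ Set.Icc R (5 * R) →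
        R₁ + C⁻¹ * R < R₂ → R₂ + C⁻¹ * R < R₃ → R₃ + C⁻¹ * R < 5 * R →
      ∀ P₁ M₁ P₃ M₃ : Set (ℤ × ℤ),
        Disjoint P₁ M₁ → Disjoint P₃ M₃ →
        (∀ v ∈ P₁ ∪ M₁, pos v ∈ hexBall R₁) →
        (∀ v ∈ P₃ ∪ M₃, pos v ∈ D.carrier \ hexBall R₃) →
        (∀ v ∈ P₁, ∃ w ∈ M₁, TG.Adj v w) → (∀ v ∈ M₁, ∃ w ∈ P₁, TG.Adj v w) →
        (∀ v ∈ P₃, ∃ w ∈ M₃, TG.Adj v w) → (∀ v ∈ M₃, ∃ w ∈ P₃, TG.Adj v w) →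
        1 / C ≤ hitProb 0 (M₃ ∪ P₃) (hexBall (5 * R)) →
        c⁻¹ * (ballField R₂).real (signEvent (ballVertices R₂) P₁ M₁) ≤
            (ProbabilityTheory.cond (D.field hbd) (signEvent D.vertices P₃ M₃)).real
              (signEvent D.vertices P₁ M₁) ∧
          (ProbabilityTheory.cond (D.field hbd) (signEvent D.vertices P₃ M₃)).real
              (signEvent D.vertices P₁ M₁) ≤
            c * (ballField R₂).real (signEvent (ballVertices R₂) P₁ M₁) := by
  classical
  set κ := 3 / 2 * (energyBound C * (max 1 (Λ ^ 2) + greenBound C)) with hκ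
  refine ⟨Real.exp κ, Real.exp_pos _, ?_⟩
  intro D hbd hb R R₁ R₂ R₃ hR hD hR₁ hR₂ hR₃ h₁₂ h₂₃ h₃ P₁ M₁ P₃ M₃ hd₁ hd₃ hm₁ hm₃ hP₁ hM₁ hP₃ hM₃
    hit
  have hδ : 1000 ≤ C⁻¹ * R := by
    rw [inv_mul_eq_div, le_div_iff₀ (by linarith)]
    linarith
  -- The bound on the boundary values holds only on the boundary. Extending by zero elsewhere makes
  -- it global without changing the field.
  set b : ℤ × ℤ → ℝ := fun v => if pos v ∈ frontier D.carrier then hbd v else 0 with hbdef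
  have hb' : ∀ z, |b z| ≤ Λ := by
    intro z
    simp only [hbdef]
    split_ifs with h
    · exact hb z h
    · rw [abs_zero]; exact hΛ.le
  set J := D.interior with hJ
  set B := ballFinset R₂ with hB
  have hsep : Separated J B P₁ M₁ P₃ M₃ := by
    refine ⟨fun z hz => ?_, hd₁, hd₃, fun v hv => ?_, fun v hv => ⟨?_, fun h => ?_⟩, ⟨hP₁, hM₁⟩,
      ⟨hP₃, hM₃⟩⟩
    · exact GridDomain.mem_interior.2
        (hD (pos_mem_hexBall_of_add_one_le (by linarith) (mem_ballFinset.1 hz)))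
    · exact mem_ballFinset.2 (pos_mem_hexBall_of_add_one_le (by linarith) (hm₁ v hv))
    · exact GridDomain.mem_interior.2 (hm₃ v hv).1
    · exact (hm₃ v hv).2 (pos_mem_hexBall_of_add_one_le (by linarith) (mem_ballFinset.1 h))
  obtain ⟨φ, ψ, hcut, hφE, hψE, hvar⟩ := exists_cutoff hC hR h₁₂ hR₂.2 hm₁
  obtain ⟨hlo, hup⟩ := hsep.comparison hb' hcut (greenBound_nonneg hC) hφE hψE
    fun u v huv hne w hw => green_le_greenBound hC hR h₁₂ h₂₃ (by linarith)
      (fun v hv => (hm₃ v hv).2) hit J (hvar u v huv hne) hw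
  have hmul := measureReal_decoupled_mul hsep.subset b P₁ M₁ (fun v hv => (hsep.mem₃ v (.inl hv)).2)
    (fun v hv => (hsep.mem₃ v (.inr hv)).2)
  have hfield := fun P M => D.field_real_signEvent (f := hbd) (b := b) (P := P) (M := M)
    fun v hv => by simp [hbdef, hv]
  have hinter : signEvent D.vertices P₃ M₃ ∩ signEvent D.vertices P₁ M₁ =
      signEvent D.vertices (P₁ ∪ P₃) (M₁ ∪ M₃) := by
    ext x
    simp only [signEvent, Set.mem_inter_iff, Set.mem_ofPred_eq, Set.mem_union]
    constructor
    · rintro ⟨⟨h1, h2⟩, h3, h4⟩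
      exact ⟨fun v hv => hv.elim (h3 v) (h1 v), fun v hv => hv.elim (h4 v) (h2 v)⟩
    · rintro ⟨h1, h2⟩
      exact ⟨⟨fun v hv => h1 v (.inr hv), fun v hv => h2 v (.inr hv)⟩,
        fun v hv => h1 v (.inl hv), fun v hv => h2 v (.inl hv)⟩
  have hcond : (ProbabilityTheory.cond (D.field hbd) (signEvent D.vertices P₃ M₃)).real
      (signEvent D.vertices P₁ M₁) = ((D.field hbd).real (signEvent D.vertices P₃ M₃))⁻¹ *
        (D.field hbd).real (signEvent D.vertices P₃ M₃ ∩ signEvent D.vertices P₁ M₁) := by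
    rw [measureReal_def, ProbabilityTheory.cond_apply (measurableSet_signEvent P₃ M₃),
      ENNReal.toReal_mul, ENNReal.toReal_inv, measureReal_def, measureReal_def]
  rw [hcond, hinter,
    hfield _ _ hsep.memP hsep.memM,
    hfield P₃ M₃ (fun v hv => (hsep.mem₃ v (.inl hv)).1) (fun v hv => (hsep.mem₃ v (.inr hv)).1),
    ballField_real_signEvent (fun v hv => hsep.mem₁ v (.inl hv))
      (fun v hv => hsep.mem₁ v (.inr hv))]
  have hpos : ∀ {J : Finset (ℤ × ℤ)} {b : ℤ × ℤ → ℝ} {K : Set (J → ℝ)}, fieldMeasure J b K ≠ 0 →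
      0 < (fieldMeasure J b).real K := fun h => ENNReal.toReal_pos h (measure_ne_top _ _)
  have hZ := hpos (fieldMeasure_pos J b isOpen_univ Set.univ_nonempty)
  have hZB := hpos (fieldMeasure_pos B (fun _ => 0) isOpen_univ Set.univ_nonempty)
  have h3pos := hpos (fieldMeasure_signs_ne_zero J b hd₃)
  set Z := (fieldMeasure J b).real Set.univ
  set ZB := (fieldMeasure B fun _ => 0).real Set.univ
  set x₃ := (fieldMeasure J b).real (signs J P₃ M₃)
  set x := (fieldMeasure J b).real (signs J (P₁ ∪ P₃) (M₁ ∪ M₃))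
  set y := (fieldMeasure J b).real (decoupledEvent J b B P₁ M₁ P₃ M₃)
  have e1 : (x₃ / Z)⁻¹ * (x / Z) = x / x₃ := by field_simp
  have e2 : (fieldMeasure B fun _ => 0).real (signs B P₁ M₁) / ZB = y / x₃ := by
    -- The probability for the ball field equals that of the decoupled event given the outer signs,
    -- exactly; only the passage from `y` to `x` costs the constant exp κ.
    rw [div_eq_div_iff hZB.ne' h3pos.ne']
    linarith
  rw [e1, e2, ← Real.exp_neg]
  rw [Real.exp_neg] at hup
  constructor
  · rw [← mul_div_assoc]
    refine div_le_div_of_nonneg_right ?_ h3pos.le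
    linarith
  · rw [← mul_div_assoc]
    refine div_le_div_of_nonneg_right ?_ h3pos.le
    have hexp := Real.exp_pos κ
    rwa [← div_eq_mul_inv, div_le_iff₀ hexp, mul_comm] at hup
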